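/- **Theorem (separation of infinities principle).** Let $q:\mathbb R\to\mathbb R$ be short-range, i.e. $\int_{\mathbb R}(1+|x|)|q(x)|\,dx<\infty$, and let $q_+=q|_{(0,\infty)}$, $q_-=q|_{(-\infty,0)}$ (extended by zero). For $\operatorname{Im}k\ge 0$ let $\psi_\pm(x,k)$ be the Jost solutions of $-\psi''+q\psi=k^2\psi$, i.e. $e^{\mp ikx}\psi_\pm\to1$ and $e^{\mp ikx}(\psi_\pm'\mp ik\psi_\pm)\to0$ as $x\to\pm\infty$. For real $k\neq 0$ the transmission coefficient $T$ and the right and left reflection coefficients $R,L$ of $q$ are given by $T\psi_-=\overline{\psi_+}+R\psi_+$ and $T\psi_+=\overline{\psi_-}+L\psi_-$. Let $-\kappa_n^2$, $\kappa_n>0$, be the negative eigenvalues of $-\partial_x^2+q$ on $L^2(\mathbb R)$, and let $c_n=\|\psi_+(\cdot,i\kappa_n)\|_{L^2}^{-2}$. Let $R_+,T_+,L_+,\kappa_n^+,c_n^+$ be the corresponding data of $q_+$, let $R_-$ be the right reflection coefficient of $q_-$, and put $$G=\frac{T_+^2R_-}{1-L_+R_-},$$ where $T_+,L_+,R_-$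 are continued meromorphically from $\mathbb R$ to the upper half-plane $\mathbb C^+$. For $x\in\mathbb R$ and $t\ge0$ let $\xi_{x,t}(k)=e^{i(8k^3t+2kx)}$ and, for real $k$, $$\varphi(k)=\sum_n\frac{c_n\,\xi_{x,t}(i\kappa_n)}{ik+\kappa_n}+\xi_{x,t}(k)R(k),\qquad \varphi_+(k)=\sum_n\frac{c_n^+\,\xi_{x,t}(i\kappa_n^+)}{ik+\kappa_n^+}+\xi_{x,t}(k)R_+(k).$$ Let $H^2_\pm\subset L^2(\mathbb R)$ be the Hardy spaces of the upper and lower half-planes, $\mathbb P_-$ the orthogonal projection of $L^2(\mathbb R)$ onto $H^2_-$, $(\mathbb Jf)(x)=f(-x)$, and for $\varphi\in L^\infty(\mathbb R)$ let $\mathbb H(\varphi):H^2_+\to H^2_+$, $\mathbb H(\varphi)f=\mathbb J\mathbb P_-(\varphi f)$, be the Hankel operator with symbol $\varphi$. Then there are only finitely many $\kappa_n$ and $\kappa_n^+$, and for every $h>0$ with $h>\kappa_n$ and $h>\kappa_n^+$ for all $n$, the integral $$\Phi(k)=-\frac1{2\pi i}\int_{\mathbb R+ih}\frac{\xi_{x,t}(\lambda)G(\lambda)}{\lambda-k}\,d\lambda,\qquad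 \operatorname{Im}k<h,$$ converges absolutely and extends to an entire function of $k$; the functions $\varphi$, $\varphi_+$ and $\Phi$ are in $L^\infty(\mathbb R)$, and $$\mathbb H(\varphi)=\mathbb H(\varphi_+)+\mathbb H(\Phi).$$ -/

import Mathlib

open MeasureTheory Filter Topology Complex
open scoped ENNReal

noncomputable section

namespace SepInf

/-! ### Potentials and the Schrödinger equation -/

/-- `q ∈ L¹₁(ℝ)`: the real potential `q` is short-range. -/
def ShortRange (q : ℝ → ℝ) : Prop :=
  Integrable (fun x : ℝ => (1 + |x|) * q x)

/-- The restriction `q₊` of `q` to `(0, ∞)`, extended by zero. -/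
def posPart (q : ℝ → ℝ) : ℝ → ℝ := Set.indicator (Set.Ioi 0) q

/-- The restriction `q₋` of `q` to `(-∞, 0)`, extended by zero. -/
def negPart (q : ℝ → ℝ) : ℝ → ℝ := Set.indicator (Set.Iio 0) q

/-- `ψ` solves `-ψ'' + q ψ = k² ψ` on the line in the Carathéodory sense: `ψ` is differentiable
and `ψ'` is an indefinite integral of `(q - k²) ψ` (so `ψ'` is locally absolutely continuous and
the equation holds almost everywhere). -/
def IsSolution (q : ℝ → ℝ) (k : ℂ) (ψ : ℝ → ℂ) : Prop :=
  Differentiable ℝ ψ ∧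
    ∀ a b : ℝ, deriv ψ b - deriv ψ a = ∫ s in a..b, ((q s : ℂ) - k ^ 2) * ψ s

/-- The right Jost solution: `ψ = e^{ikx}(1 + o(1))` and `ψ' - ikψ = e^{ikx} o(1)` as `x → +∞`.
For `Im k ≥ 0` and short-range `q` there is exactly one such solution; for real `k` the
factors `e^{ikx}` have modulus one, and for `Im k > 0` this is the analytic continuation in `k`. -/
def IsJostRight (q : ℝ → ℝ) (k : ℂ) (ψ : ℝ → ℂ) : Prop :=
  IsSolution q k ψ ∧
    Tendsto (fun x : ℝ => exp (-(I * k * x)) * ψ x) atTop (𝓝 1) ∧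
    Tendsto (fun x : ℝ => exp (-(I * k * x)) * (deriv ψ x - I * k * ψ x)) atTop (𝓝 0)

/-- The left Jost solution: `ψ = e^{-ikx}(1 + o(1))` and `ψ' + ikψ = e^{-ikx} o(1)` as
`x → -∞`. -/
def IsJostLeft (q : ℝ → ℝ) (k : ℂ) (ψ : ℝ → ℂ) : Prop :=
  IsSolution q k ψ ∧
    Tendsto (fun x : ℝ => exp (I * k * x) * ψ x) atBot (𝓝 1) ∧
    Tendsto (fun x : ℝ => exp (I * k * x) * (deriv ψ x + I * k * ψ x)) atBot (𝓝 0)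

/-- `ψ₊(·, k)`. -/
def jostRight (q : ℝ → ℝ) (k : ℂ) : ℝ → ℂ := Classical.epsilon (IsJostRight q k)

/-- `ψ₋(·, k)`. -/
def jostLeft (q : ℝ → ℝ) (k : ℂ) : ℝ → ℂ := Classical.epsilon (IsJostLeft q k)

/-! ### Scattering data -/

/-- The set of `κ > 0` such that `-κ²` is an eigenvalue of `-∂ₓ² + q` on `L²(ℝ)`. -/
def boundStates (q : ℝ → ℝ) : Set ℝ :=
  {κ | 0 < κ ∧ ∃ ψ : ℝ → ℂ, IsSolution q (I * κ) ψ ∧ MemLp ψ 2 volume ∧ ψ ≠ 0}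

/-- The norming constant `c = ‖ψ₊(·, iκ)‖⁻²` (norm of `L²(ℝ)`) of the bound state `-κ²`. -/
def normingConst (q : ℝ → ℝ) (κ : ℝ) : ℝ :=
  (∫ s : ℝ, ‖jostRight q (I * κ) s‖ ^ 2)⁻¹

/-- The pair `(T, R)` at real `k`, given by `T ψ₋ = conj ψ₊ + R ψ₊`. For `k ≠ 0` the pair is
unique. -/
def rightScattering (q : ℝ → ℝ) (k : ℝ) : ℂ × ℂ :=
  Classical.epsilon fun p : ℂ × ℂ => ∀ x : ℝ,
    p.1 * jostLeft q k x = (starRingEnd ℂ) (jostRight q k x) + p.2 * jostRight q k x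

/-- The right reflection coefficient `R` on the real line. -/
def rightReflection (q : ℝ → ℝ) (k : ℝ) : ℂ := (rightScattering q k).2

/-- The transmission and left reflection coefficients `(T, L)` in the closed upper half-plane of
a potential `q` that vanishes on `(-∞, 0)`, given by `T ψ₊ = e^{ikx} + L e^{-ikx}` for `x ≤ 0`.
As `ψ₋ = e^{-ikx}` for `x ≤ 0`, this is the left scattering relation `T ψ₊ = conj ψ₋ + L ψ₋` when
`k` is real, and it continues `T` and `L` meromorphically to `Im k > 0`. The pair is unique
except at `k = 0` and at the poles, where the value is immaterial. -/
def leftScatteringOfPos (q : ℝ → ℝ) (k : ℂ) : ℂ × ℂ :=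
  Classical.epsilon fun p : ℂ × ℂ => ∀ x : ℝ, x ≤ 0 →
    p.1 * jostRight q k x = exp (I * k * x) + p.2 * exp (-(I * k * x))

/-- The transmission and right reflection coefficients `(T, R)` in the closed upper half-plane of
a potential `q` that vanishes on `(0, ∞)`, given by `T ψ₋ = e^{-ikx} + R e^{ikx}` for `x ≥ 0`.
As `ψ₊ = e^{ikx}` for `x ≥ 0`, this is the right scattering relation when `k` is real, and it
continues `T` and `R` meromorphically to `Im k > 0`. The pair is unique except at `k = 0` and at
the poles, where the value is immaterial. -/
def rightScatteringOfNeg (q : ℝ → ℝ) (k : ℂ) : ℂ × ℂ :=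
  Classical.epsilon fun p : ℂ × ℂ => ∀ x : ℝ, 0 ≤ x →
    p.1 * jostLeft q k x = exp (-(I * k * x)) + p.2 * exp (I * k * x)

/-- `G = T₊² R₋ / (1 - L₊ R₋)` in the closed upper half-plane, where `T₊, L₊` belong to `q₊` and
`R₋` belongs to `q₋`. -/
def G (q : ℝ → ℝ) (k : ℂ) : ℂ :=
  let T := (leftScatteringOfPos (posPart q) k).1
  let L := (leftScatteringOfPos (posPart q) k).2
  let R := (rightScatteringOfNeg (negPart q) k).2
  T ^ 2 * R / (1 - L * R)

/-- The KdV phase `ξ_{x,t}(k) = exp(i(8k³t + 2kx))`. -/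
def xi (x t : ℝ) (k : ℂ) : ℂ := exp (I * (8 * k ^ 3 * t + 2 * k * x))

/-- The symbol `φ(k) = ∑ₙ cₙ ξ(iκₙ) / (ik + κₙ) + ξ(k) R(k)` built from the scattering data
of `q`. -/
def symbol (q : ℝ → ℝ) (x t : ℝ) (k : ℝ) : ℂ :=
  (∑ᶠ κ ∈ boundStates q, (normingConst q κ : ℂ) * xi x t (I * κ) / (I * k + κ))
    + xi x t k * rightReflection q k

/-- The integrand of `Φ` at the point `λ = u + ih` of the line `ℝ + ih`. -/
def PhiIntegrand (q : ℝ → ℝ) (h x t : ℝ) (k : ℂ) (u : ℝ) : ℂ :=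
  xi x t (u + I * h) * G q (u + I * h) / (u + I * h - k)

/-- `Φ(k) = -(2πi)⁻¹ ∫_{ℝ+ih} ξ(λ) G(λ) / (λ - k) dλ`. -/
def Phi (q : ℝ → ℝ) (h x t : ℝ) (k : ℂ) : ℂ :=
  -(2 * Real.pi * I)⁻¹ * ∫ u : ℝ, PhiIntegrand q h x t k u

/-! ### Hardy spaces and Hankel operators -/

/-- The Hilbert space `L²(ℝ)`. -/
abbrev L2 : Type := Lp ℂ 2 (volume : Measure ℝ)

/-- `F` is analytic in the half-plane `s Im z > 0` (`s = 1` or `s = -1`), and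
`sup_{y > 0} ∫ |F(u + isy)|² du < ∞`. -/
def IsHardy (s : ℝ) (F : ℂ → ℂ) : Prop :=
  DifferentiableOn ℂ F {z : ℂ | 0 < s * z.im} ∧
    ∃ C : ℝ≥0∞, C ≠ ∞ ∧ ∀ y : ℝ, 0 < y → ∫⁻ u : ℝ, ‖F (u + I * (s * y : ℝ))‖ₑ ^ 2 ≤ C

/-- `f` is the boundary value of `F` on the real line: for almost every `u`,
`F(u + isy) → f(u)` as `y ↓ 0`. -/
def HasBoundaryValue (s : ℝ) (F : ℂ → ℂ) (f : ℝ → ℂ) : Prop :=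
  ∀ᵐ u : ℝ, Tendsto (fun y : ℝ => F (u + I * (s * y : ℝ))) (𝓝[>] 0) (𝓝 (f u))

lemma line_mem {s : ℝ} (hs : s ≠ 0) {y : ℝ} (hy : 0 < y) (u : ℝ) :
    ((u : ℂ) + I * (s * y : ℝ)) ∈ {z : ℂ | 0 < s * z.im} := by
  have : 0 < s * s * y := mul_pos (mul_self_pos.2 hs) hy
  simpa [mul_assoc] using this

lemma IsHardy.measurable_line {s : ℝ} (hs : s ≠ 0) {F : ℂ → ℂ} (hF : IsHardy s F) {y : ℝ}
    (hy : 0 < y) : Measurable fun u : ℝ => ‖F (u + I * (s * y : ℝ))‖ₑ ^ 2 := by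
  have hc : Continuous fun u : ℝ => F (u + I * (s * y : ℝ)) :=
    hF.1.continuousOn.comp_continuous (by fun_prop) (fun u => line_mem hs hy u)
  exact (hc.measurable.enorm).pow_const 2

lemma IsHardy.add {s : ℝ} (hs : s ≠ 0) {F₁ F₂ : ℂ → ℂ} (h₁ : IsHardy s F₁) (h₂ : IsHardy s F₂) :
    IsHardy s (F₁ + F₂) := by
  refine ⟨h₁.1.add h₂.1, ?_⟩
  obtain ⟨C₁, hC₁, hb₁⟩ := h₁.2
  obtain ⟨C₂, hC₂, hb₂⟩ := h₂.2
  refine ⟨2 * (C₁ + C₂), ENNReal.mul_ne_top (by simp) (ENNReal.add_ne_top.2 ⟨hC₁, hC₂⟩), ?_⟩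
  intro y hy
  calc ∫⁻ u : ℝ, ‖(F₁ + F₂) (u + I * (s * y : ℝ))‖ₑ ^ 2
      ≤ ∫⁻ u : ℝ, 2 * (‖F₁ (u + I * (s * y : ℝ))‖ₑ ^ 2 + ‖F₂ (u + I * (s * y : ℝ))‖ₑ ^ 2) := by
        refine lintegral_mono fun u => ?_
        refine (pow_le_pow_left' (enorm_add_le _ _) 2).trans ?_
        have := ENNReal.rpow_add_le_mul_rpow_add_rpow (‖F₁ (u + I * (s * y : ℝ))‖ₑ)
          (‖F₂ (u + I * (s * y : ℝ))‖ₑ) (p := 2) (by norm_num)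
        norm_num at this
        exact_mod_cast this
    _ ≤ 2 * (C₁ + C₂) := by
        rw [lintegral_const_mul' _ _ (by simp), lintegral_add_left (h₁.measurable_line hs hy)]
        gcongr
        · exact hb₁ y hy
        · exact hb₂ y hy

lemma IsHardy.const_smul {s : ℝ} (hs : s ≠ 0) {F : ℂ → ℂ} (hF : IsHardy s F) (c : ℂ) :
    IsHardy s (c • F) := by
  refine ⟨hF.1.const_smul c, ?_⟩
  obtain ⟨C, hC, hb⟩ := hF.2
  refine ⟨‖c‖ₑ ^ 2 * C, ENNReal.mul_ne_top (by simp) hC, fun y hy => ?_⟩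
  have : ∀ u : ℝ, ‖(c • F) (u + I * (s * y : ℝ))‖ₑ ^ 2
      = ‖c‖ₑ ^ 2 * ‖F (u + I * (s * y : ℝ))‖ₑ ^ 2 := by
    intro u
    rw [Pi.smul_apply, enorm_smul, mul_pow]
  simp_rw [this]
  rw [lintegral_const_mul _ (hF.measurable_line hs hy)]
  gcongr
  exact hb y hy

/-- The boundary values in `L²(ℝ)` of the functions of the Hardy class of the upper (`s = 1`) or
lower (`s = -1`) half-plane. -/
def hardyBoundary (s : ℝ) (hs : s ≠ 0) : Submodule ℂ L2 where
  carrier := {f | ∃ F : ℂ → ℂ, IsHardy s F ∧ HasBoundaryValue s F f}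
  add_mem' := by
    rintro f g ⟨F, hF, hf⟩ ⟨K, hK, hg⟩
    refine ⟨F + K, hF.add hs hK, ?_⟩
    filter_upwards [hf, hg, Lp.coeFn_add f g] with u h₁ h₂ h₃
    rw [h₃]
    exact h₁.add h₂
  zero_mem' := by
    refine ⟨0, ⟨differentiableOn_const 0, 0, by simp, by simp⟩, ?_⟩
    filter_upwards [Lp.coeFn_zero ℂ 2 (volume : Measure ℝ)] with u hu
    rw [hu]
    exact tendsto_const_nhds
  smul_mem' := by
    rintro c f ⟨F, hF, hf⟩
    refine ⟨c • F, hF.const_smul hs c, ?_⟩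
    filter_upwards [hf, Lp.coeFn_smul c f] with u h₁ h₂
    rw [h₂]
    exact h₁.const_smul c

/-- The Hardy space `H²₊` as a closed subspace of `L²(ℝ)`. (The space of boundary values is
already closed; the closure is written only to have the closedness available without proof.) -/
def hardyPlus : Submodule ℂ L2 := (hardyBoundary 1 one_ne_zero).topologicalClosure

/-- The Hardy space `H²₋` as a closed subspace of `L²(ℝ)`. -/
def hardyMinus : Submodule ℂ L2 :=
  (hardyBoundary (-1) (neg_ne_zero.2 one_ne_zero)).topologicalClosure

instance : CompleteSpace hardyPlus :=
  (Submodule.isClosed_topologicalClosure _).completeSpace_coe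

instance : CompleteSpace hardyMinus :=
  (Submodule.isClosed_topologicalClosure _).completeSpace_coe

/-- The reflection `(J f)(x) = f(-x)` on `L²(ℝ)`. -/
def reflection : L2 →L[ℂ] L2 :=
  (Lp.compMeasurePreservingₗᵢ ℂ (fun x : ℝ => -x)
    (Measure.measurePreserving_neg (volume : Measure ℝ))).toContinuousLinearMap

/-- The Riesz projection `P₋` of `L²(ℝ)` onto `H²₋`. -/
def rieszMinus : L2 →L[ℂ] L2 := hardyMinus.starProjection

/-- Multiplication by `φ ∈ L^∞(ℝ)` on `L²(ℝ)`. -/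
def mulOp (φ : Lp ℂ ∞ (volume : Measure ℝ)) : L2 →L[ℂ] L2 :=
  (ContinuousLinearMap.mul ℂ ℂ).holderL (volume : Measure ℝ) ∞ 2 2 φ

lemma IsHardy.reflect {F : ℂ → ℂ} (hF : IsHardy (-1) F) : IsHardy 1 (fun z => F (-z)) := by
  refine ⟨?_, ?_⟩
  · refine hF.1.comp (differentiable_neg.differentiableOn) ?_
    intro z hz
    simpa using hz
  · obtain ⟨C, hC, hb⟩ := hF.2
    refine ⟨C, hC, fun y hy => ?_⟩
    refine le_trans (le_of_eq ?_) (hb y hy)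
    rw [← lintegral_neg_eq_self (fun u : ℝ => ‖F (u + I * ((-1) * y : ℝ))‖ₑ ^ 2)]
    congr 1
    ext u
    have e : -((u : ℂ) + I * ((1 : ℝ) * y : ℝ)) = ((-u : ℝ) : ℂ) + I * ((-1 : ℝ) * y : ℝ) := by
      push_cast
      ring
    simp only [e]

lemma reflection_mem_hardyBoundary {f : L2}
    (hf : f ∈ hardyBoundary (-1) (neg_ne_zero.2 one_ne_zero)) :
    reflection f ∈ hardyBoundary 1 one_ne_zero := by
  obtain ⟨F, hF, hb⟩ := hf
  refine ⟨fun z => F (-z), hF.reflect, ?_⟩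
  have hmp := Measure.measurePreserving_neg (volume : Measure ℝ)
  have h₁ : reflection f =ᵐ[volume] f ∘ (fun x : ℝ => -x) :=
    Lp.coeFn_compMeasurePreserving f hmp
  filter_upwards [h₁, hmp.quasiMeasurePreserving.ae hb] with u hu hbu
  rw [hu]
  refine Tendsto.congr (fun y => ?_) hbu
  congr 1
  push_cast
  ring

lemma reflection_mem_hardyPlus {f : L2} (hf : f ∈ hardyMinus) : reflection f ∈ hardyPlus :=
  map_mem_closure reflection.continuous hf fun _ hg => reflection_mem_hardyBoundary hg

/-- The Hankel operator `H(φ) f = J P₋ (φ f)`, `f ∈ H²₊`, on `H²₊` with symbol `φ ∈ L^∞(ℝ)`. -/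
def hankel (φ : Lp ℂ ∞ (volume : Measure ℝ)) : hardyPlus →L[ℂ] hardyPlus :=
  (reflection ∘L rieszMinus ∘L mulOp φ ∘L hardyPlus.subtypeL).codRestrict hardyPlus
    fun _ => reflection_mem_hardyPlus (Submodule.starProjection_apply_mem _ _)

end SepInf

end

/-!
A Hankel operator ignores bounded analytic summands of its symbol (`hankel_eq_zero`), so the
identity of operators reduces to exhibiting `φ - φ₊ - Φ` as the boundary value of a bounded
holomorphic function on the upper half-plane.

On the real line the Cauchy data at `x = 0` of the Jost solutions give `R - R₊ = G` (`Rfun_sub`),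
where `G` is a rational expression in these data (`Gfun`); its denominator is the product of the
Wronskians of the Jost solutions of `q` and of `q₊`. The data are constructed by the Volterra
series, are holomorphic for `Im k > 0`, and are continuous up to the real line. The zeros of a
Wronskian in the upper half-plane are the points `iκ` with `-κ²` an eigenvalue. Near any point `G`
is a difference of two functions `chart`, one for `q` and one for `q₊`, whose only singularities
there are simple poles at zeros of the respective Wronskian, with residue `i c` at `iκ`, where `c`
is the norming constant (`Gfun_eq_chart_sub`, `tendsto_residue`). The sums over bound states in
`φ - φ₊` are therefore minus the polar part of `ξ G` (`symbol_sub`), and `φ - φ₊` is the boundary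
value of the regular part `H` of `ξ G`. There are finitely many bound states because the zeros of the
Wronskian do not accumulate at `0`: it vanishes there at most to first order
(`exists_wron_lower_bound`). The same bound keeps `G` bounded near `k = 0`.

The function `H` is `O(1 / |k|)` on every strip `0 < Im k ≤ Y` (`stripDecay_regular_part`). On a
line above all poles the Cauchy integral of the polar part vanishes below that line, so `Φ` is the
Cauchy integral of `H`. By Cauchy's formula in a strip (`cauchyLine_sub`) it continues to an entire
function `F`, equal to `H` minus a Cauchy integral over a lower line, and both representations
together show that `H - F` is bounded on the whole upper half-plane (`exists_entire_extension`).
-/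

noncomputable section

namespace SepInf

/-! ### Indefinite integrals -/

/-- `u` is an indefinite integral of the locally integrable function `g`. -/
def IsPrim {𝕜 : Type*} [RCLike 𝕜] (u g : ℝ → 𝕜) : Prop :=
  (∀ a b : ℝ, IntervalIntegrable g volume a b) ∧ ∀ a b : ℝ, u b - u a = ∫ s in a..b, g s

namespace IsPrim

variable {𝕜 : Type*} [RCLike 𝕜] {u v g h : ℝ → 𝕜}

lemma eq_add (hu : IsPrim u g) (a x : ℝ) : u x = u a + ∫ s in a..x, g s := by
  rw [← hu.2 a x]; ring

lemma continuous (hu : IsPrim u g) : Continuous u := by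
  have h : u = fun x => u 0 + ∫ s in (0 : ℝ)..x, g s := funext fun x => hu.eq_add 0 x
  rw [h]
  exact continuous_const.add (intervalIntegral.continuous_primitive hu.1 0)

lemma absolutelyContinuous (hu : IsPrim u g) (a b : ℝ) :
    AbsolutelyContinuousOnInterval u a b := by
  have hn : ∀ x y : ℝ, IntervalIntegrable (fun s => ‖g s‖) volume x y := fun x y => (hu.1 x y).norm
  have hac := (hn a b).absolutelyContinuousOnInterval_intervalIntegral (c := a) (by simp)
  rw [absolutelyContinuousOnInterval_iff] at hac ⊢
  intro ε hε
  obtain ⟨δ, hδ, h⟩ := hac ε hε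
  refine ⟨δ, hδ, fun E hE hlen => lt_of_le_of_lt (Finset.sum_le_sum fun i _ => ?_) (h E hE hlen)⟩
  rw [dist_comm, dist_eq_norm, hu.2, dist_comm, Real.dist_eq,
    intervalIntegral.integral_interval_sub_left (hn _ _) (hn _ _)]
  exact intervalIntegral.norm_integral_le_abs_integral_norm

lemma ae_hasDerivAt (hu : IsPrim u g) : ∀ᵐ x : ℝ, HasDerivAt u (g x) x := by
  have hl : LocallyIntegrable g volume := by
    rw [locallyIntegrable_iff]
    intro K hK
    obtain ⟨R, hR⟩ := hK.isBounded.subset_closedBall 0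
    have : K ⊆ Set.Icc (-R) R := by simpa [Real.closedBall_eq_Icc] using hR
    by_cases hR0 : -R ≤ R
    · exact ((intervalIntegrable_iff_integrableOn_Icc_of_le hR0).1 (hu.1 (-R) R)).mono_set this
    · rw [Set.Icc_eq_empty hR0] at this
      rw [Set.subset_empty_iff.1 this]; simp
  filter_upwards [_root_.LocallyIntegrable.ae_hasDerivAt_integral hl] with x hx
  have h : u = fun x => u 0 + ∫ s in (0 : ℝ)..x, g s := funext fun x => hu.eq_add 0 x
  rw [h]
  exact (hx 0).const_add _

lemma of_ae_hasDerivAt (hu : ∀ a b : ℝ, AbsolutelyContinuousOnInterval u a b)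
    (hg : ∀ a b : ℝ, IntervalIntegrable g volume a b)
    (hd : ∀ᵐ x : ℝ, HasDerivAt u (g x) x) : IsPrim u g := by
  refine ⟨hg, fun a b => ?_⟩
  have hp : IsPrim (fun x => ∫ s in a..x, g s) g :=
    ⟨hg, fun x y => by rw [intervalIntegral.integral_interval_sub_left (hg _ _) (hg _ _)]⟩
  have hac : AbsolutelyContinuousOnInterval (u - fun x => ∫ s in a..x, g s) a b :=
    (hu a b).sub (hp.absolutelyContinuous a b)
  obtain ⟨C, hC⟩ := hac.const_of_ae_hasDerivAt_zero (by
    filter_upwards [hd, hp.ae_hasDerivAt] with x h₁ h₂ _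
    simpa using h₁.sub h₂)
  have h₁ := hC a (by simp)
  have h₂ := hC b (by simp)
  simp only [Pi.sub_apply, intervalIntegral.integral_same, sub_zero] at h₁ h₂
  rw [h₁, ← h₂]; ring

lemma of_hasDerivAt (hu : ∀ x, HasDerivAt u (g x) x) (hg : Continuous g) : IsPrim u g :=
  ⟨fun _ _ => hg.intervalIntegrable _ _, fun a b =>
    (intervalIntegral.integral_eq_sub_of_hasDerivAt (fun x _ => hu x)
      (hg.intervalIntegrable a b)).symm⟩

lemma add (hu : IsPrim u g) (hv : IsPrim v h) :
    IsPrim (fun x => u x + v x) (fun x => g x + h x) := by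
  refine ⟨fun a b => (hu.1 a b).add (hv.1 a b), fun a b => ?_⟩
  rw [intervalIntegral.integral_add (hu.1 a b) (hv.1 a b), ← hu.2, ← hv.2]; ring

lemma sub (hu : IsPrim u g) (hv : IsPrim v h) :
    IsPrim (fun x => u x - v x) (fun x => g x - h x) := by
  refine ⟨fun a b => (hu.1 a b).sub (hv.1 a b), fun a b => ?_⟩
  rw [intervalIntegral.integral_sub (hu.1 a b) (hv.1 a b), ← hu.2, ← hv.2]; ring

lemma const_mul (c : 𝕜) (hu : IsPrim u g) : IsPrim (fun x => c * u x) (fun x => c * g x) := by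
  refine ⟨fun a b => (hu.1 a b).const_mul c, fun a b => ?_⟩
  rw [intervalIntegral.integral_const_mul, ← hu.2]; ring

lemma mul (hu : IsPrim u g) (hv : IsPrim v h) :
    IsPrim (fun x => u x * v x) (fun x => g x * v x + u x * h x) := by
  refine of_ae_hasDerivAt
    (fun a b => (hu.absolutelyContinuous a b).smul (hv.absolutelyContinuous a b))
    (fun a b => ?_) ?_
  · exact ((hu.1 a b).mul_continuousOn hv.continuous.continuousOn).add
      ((hv.1 a b).continuousOn_mul hu.continuous.continuousOn)
  · filter_upwards [hu.ae_hasDerivAt, hv.ae_hasDerivAt] with x h₁ h₂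
    exact h₁.mul h₂

lemma congr (hu : IsPrim u g) (hg : ∀ᵐ x : ℝ, g x = h x) : IsPrim u h := by
  refine ⟨fun a b => (hu.1 a b).congr_ae (ae_restrict_of_ae hg), fun a b => ?_⟩
  rw [hu.2]
  exact intervalIntegral.integral_congr_ae (by filter_upwards [hg] with x hx _ using hx)

lemma comp_neg (hu : IsPrim u g) : IsPrim (fun x => u (-x)) (fun x => -g (-x)) := by
  refine ⟨fun a b => ?_, fun a b => ?_⟩
  · have := (hu.1 (-a) (-b)).comp_mul_left (c := -1)
    simpa [Pi.neg_def] using this.neg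
  · rw [intervalIntegral.integral_neg, intervalIntegral.integral_comp_neg,
      intervalIntegral.integral_symm, ← hu.2]; ring

lemma pow (hu : IsPrim u g) (n : ℕ) :
    IsPrim (fun x => u x ^ (n + 1)) (fun x => (n + 1 : 𝕜) * (g x * u x ^ n)) := by
  induction n with
  | zero => simpa using hu
  | succ n ih =>
    have e₁ : (fun x => u x ^ (n + 1 + 1)) = fun x => u x ^ (n + 1) * u x := by
      funext x; ring
    have e₂ : (fun x => ((n + 1 : ℕ) + 1 : 𝕜) * (g x * u x ^ (n + 1)))
        = fun x => (n + 1 : 𝕜) * (g x * u x ^ n) * u x + u x ^ (n + 1) * g x := by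
      funext x; push_cast; ring
    rw [e₁, e₂]
    exact ih.mul hu

/-- An indefinite integral whose density vanishes on an interval is constant there. -/
lemma eq_of_density_zero (hu : IsPrim u g) {a b : ℝ} (hg : ∀ x ∈ Set.uIoc a b, g x = 0) :
    u b = u a := by
  have h := hu.2 a b
  rw [intervalIntegral.integral_congr_ae (g := fun _ => (0 : 𝕜))
    (ae_of_all _ fun x hx => hg x hx)] at h
  simpa [sub_eq_zero] using h

end IsPrim

lemma isPrim_integral {𝕜 : Type*} [RCLike 𝕜] {g : ℝ → 𝕜}
    (hg : ∀ a b : ℝ, IntervalIntegrable g volume a b) (a : ℝ) :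
    IsPrim (fun x => ∫ s in a..x, g s) g :=
  ⟨hg, fun x y => by rw [intervalIntegral.integral_interval_sub_left (hg _ _) (hg _ _)]⟩

/-- Grönwall's inequality with a locally integrable rate: the bound by `S M ^ n / n!`, where `M` is
an indefinite integral of `m`, improves itself to all orders `n`. -/
lemma gronwall_zero {m N : ℝ → ℝ} (hm : ∀ a b : ℝ, IntervalIntegrable m volume a b)
    (hm0 : ∀ x, 0 ≤ m x) (hN : Continuous N) {a b : ℝ}
    (h : ∀ x ∈ Set.Icc a b, N x ≤ ∫ s in a..x, m s * N s) :
    ∀ x ∈ Set.Icc a b, N x ≤ 0 := by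
  obtain ⟨S, hS⟩ : ∃ S, ∀ x ∈ Set.Icc a b, N x ≤ S := by
    obtain ⟨S, hS⟩ := isCompact_Icc.bddAbove_image (f := N) hN.continuousOn
    exact ⟨S, fun x hx => hS (Set.mem_image_of_mem _ hx)⟩
  set M : ℝ → ℝ := fun x => ∫ s in a..x, m s with hM
  have hMp : IsPrim M m := isPrim_integral hm a
  have hMa : M a = 0 := by simp [hM]
  have key : ∀ n : ℕ, ∀ x ∈ Set.Icc a b, N x ≤ S * (M x ^ n / n.factorial) := by
    intro n
    induction n with
    | zero => intro x hx; simpa using hS x hx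
    | succ n ih =>
      intro x hx
      have hi : ∀ c d : ℝ, IntervalIntegrable (fun s => m s * (S * (M s ^ n / n.factorial)))
          volume c d := fun c d =>
        (hm c d).mul_continuousOn (by have := hMp.continuous; fun_prop)
      refine (h x hx).trans ((intervalIntegral.integral_mono_on hx.1
        ((hm a x).mul_continuousOn hN.continuousOn) (hi a x) fun s hs =>
          mul_le_mul_of_nonneg_left (ih s ⟨hs.1, hs.2.trans hx.2⟩) (hm0 s)).trans (le_of_eq ?_))
      have hp := (hMp.pow n).2 a x
      dsimp only at hp
      rw [hMa, zero_pow (Nat.succ_ne_zero n), sub_zero, intervalIntegral.integral_const_mul] at hp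
      have e : ∀ s, m s * (S * (M s ^ n / n.factorial))
          = (S / n.factorial) * (m s * M s ^ n) := fun s => by ring
      simp_rw [e]
      rw [intervalIntegral.integral_const_mul, Nat.factorial_succ, hp]
      have := Nat.factorial_ne_zero n
      push_cast
      field_simp
  intro x hx
  have hl := (FloorSemiring.tendsto_pow_div_factorial_atTop (M x)).const_mul S
  rw [mul_zero] at hl
  exact ge_of_tendsto' hl fun n => key n x hx

/-- A solution of `u'' = V u` with locally integrable `V` and zero Cauchy data vanishes. -/
lemma eq_zero_of_cauchy_data_zero {V u v : ℝ → ℂ} (hV : ∀ a b : ℝ, IntervalIntegrable V volume a b)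
    (hu : IsPrim u v) (hv : IsPrim v fun x => V x * u x) {a : ℝ} (hua : u a = 0) (hva : v a = 0) :
    ∀ x, u x = 0 := by
  have right : ∀ {V u v : ℝ → ℂ}, (∀ a b : ℝ, IntervalIntegrable V volume a b) →
      IsPrim u v → (IsPrim v fun x => V x * u x) → ∀ {a : ℝ}, u a = 0 → v a = 0 →
      ∀ x, a ≤ x → u x = 0 := by
    intro V u v hV hu hv a hua hva x hx
    have hm : ∀ c d : ℝ, IntervalIntegrable (fun s => 1 + ‖V s‖) volume c d := fun c d =>
      intervalIntegrable_const.add (hV c d).norm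
    have hN : Continuous fun s => ‖u s‖ + ‖v s‖ := hu.continuous.norm.add hv.continuous.norm
    have key := gronwall_zero (b := x) hm (fun s => by positivity) hN (a := a) ?_ x ⟨hx, le_rfl⟩
    · have : ‖u x‖ ≤ 0 := by linarith [norm_nonneg (v x)]
      simpa using this
    · intro y hy
      rw [hu.eq_add a y, hv.eq_add a y, hua, hva, zero_add, zero_add]
      refine (add_le_add (intervalIntegral.norm_integral_le_integral_norm hy.1)
        (intervalIntegral.norm_integral_le_integral_norm hy.1)).trans ?_
      rw [← intervalIntegral.integral_add (hu.1 a y).norm (hv.1 a y).norm]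
      refine intervalIntegral.integral_mono_on hy.1 ((hu.1 a y).norm.add (hv.1 a y).norm)
        ((hm a y).mul_continuousOn hN.continuousOn) fun s _ => ?_
      rw [norm_mul]
      nlinarith [norm_nonneg (u s), mul_nonneg (norm_nonneg (V s)) (norm_nonneg (v s))]
  intro x
  rcases le_total a x with hx | hx
  · exact right hV hu hv hua hva x hx
  · have hu' := hu.comp_neg
    have hv' : IsPrim (fun x => -v (-x)) fun x => V (-x) * u (-x) := by
      simpa using hv.comp_neg.const_mul (-1)
    have hV' : ∀ c d : ℝ, IntervalIntegrable (fun x => V (-x)) volume c d := fun c d => by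
      simpa using (hV (-c) (-d)).comp_mul_left (c := -1)
    simpa using right hV' hu' hv' (a := -a) (by simpa using hua) (by simpa using hva) (-x)
      (by linarith)

/-! ### Holomorphic dependence on a parameter -/

/-- A dominated integral of holomorphic functions is holomorphic; Cauchy's estimate supplies the
bound of the derivative. -/
lemma differentiableOn_integral_of_dominated {α : Type*} [MeasurableSpace α] {μ : Measure α}
    {F : ℂ → α → ℂ} {U : Set ℂ} {b : α → ℝ} (hU : IsOpen U)
    (hm : ∀ z ∈ U, AEStronglyMeasurable (F z) μ)
    (hd : ∀ᵐ a ∂μ, DifferentiableOn ℂ (fun z => F z a) U)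
    (hb : ∀ᵐ a ∂μ, ∀ z ∈ U, ‖F z a‖ ≤ b a) (hbi : Integrable b μ) :
    DifferentiableOn ℂ (fun z => ∫ a, F z a ∂μ) U := by
  intro z₀ hz₀
  obtain ⟨r, hr, hrU⟩ := Metric.isOpen_iff.1 hU z₀ hz₀
  have hsub : ∀ z ∈ Metric.ball z₀ (r / 2), Metric.closedBall z (r / 3) ⊆ U := by
    intro z hz w hw
    refine hrU ?_
    rw [Metric.mem_ball] at hz ⊢
    rw [Metric.mem_closedBall] at hw
    linarith [dist_triangle w z z₀]
  have hint : ∀ z ∈ U, Integrable (F z) μ := fun z hz =>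
    hbi.mono' (hm z hz) (by filter_upwards [hb] with a ha using ha z hz)
  have hder : AEStronglyMeasurable (fun a => deriv (fun z => F z a) z₀) μ := by
    have hseq : Tendsto (fun n : ℕ => z₀ + ((r / 2 : ℝ) : ℂ) / (n + 1)) atTop (𝓝[≠] z₀) := by
      refine tendsto_nhdsWithin_iff.2 ⟨?_, ?_⟩
      · have h := (tendsto_one_div_add_atTop_nhds_zero_nat (𝕜 := ℂ)).const_mul ((r / 2 : ℝ) : ℂ)
        have h' := h.const_add z₀
        simpa [div_eq_mul_inv] using h'
      · refine Eventually.of_forall fun n => ?_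
        have h1 : ((r / 2 : ℝ) : ℂ) ≠ 0 := by exact_mod_cast (by positivity : r / 2 ≠ 0)
        have h2 : (n + 1 : ℂ) ≠ 0 := Nat.cast_add_one_ne_zero n
        simp only [Set.mem_compl_iff, Set.mem_singleton_iff, add_eq_left]
        exact div_ne_zero h1 h2
    have hmem : ∀ n : ℕ, z₀ + ((r / 2 : ℝ) : ℂ) / (n + 1) ∈ U := by
      intro n
      refine hrU ?_
      rw [Metric.mem_ball, dist_eq_norm, add_sub_cancel_left, norm_div, Complex.norm_real,
        Real.norm_of_nonneg (by positivity)]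
      have h2 : ‖(n + 1 : ℂ)‖ = n + 1 := by
        rw [← Nat.cast_add_one, Complex.norm_natCast]; push_cast; ring
      rw [h2]
      have h3 : r / 2 / ((n : ℝ) + 1) ≤ r / 2 := div_le_self (by positivity) (by simp)
      linarith
    refine aestronglyMeasurable_of_tendsto_ae (u := atTop)
      (f := fun (n : ℕ) a => slope (fun z => F z a) z₀ (z₀ + ((r / 2 : ℝ) : ℂ) / (n + 1)))
      (fun n => ?_) ?_
    · simp only [slope_def_field]
      simp only [div_eq_mul_inv]
      exact AEStronglyMeasurable.mul_const (AEStronglyMeasurable.sub (hm _ (hmem n)) (hm _ hz₀)) _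
    · filter_upwards [hd] with a ha
      exact (hasDerivAt_iff_tendsto_slope.1
        ((ha.differentiableAt (hU.mem_nhds hz₀)).hasDerivAt)).comp hseq
  refine (hasDerivAt_integral_of_dominated_loc_of_deriv_le (F := F)
    (F' := fun z a => deriv (fun z => F z a) z) (bound := fun a => b a / (r / 3))
    (s := Metric.ball z₀ (r / 2)) (Metric.ball_mem_nhds z₀ (by positivity)) ?_ (hint z₀ hz₀) hder
    ?_ (hbi.div_const _) ?_).2.differentiableAt.differentiableWithinAt
  · filter_upwards [hU.mem_nhds hz₀] with z hz using hm z hz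
  · filter_upwards [hd, hb] with a ha hba z hz
    refine norm_deriv_le_of_forall_mem_sphere_norm_le (by positivity) ?_ fun w hw =>
      hba w (hsub z hz (Metric.sphere_subset_closedBall hw))
    refine DifferentiableOn.diffContOnCl_ball (U := U) ha (hsub z hz)
  · filter_upwards [hd] with a ha z hz
    exact (ha.differentiableAt (hU.mem_nhds
      (hsub z hz (Metric.mem_closedBall_self (by positivity))))).hasDerivAt

/-! ### The Volterra kernel -/

/-- The kernel `∫₀ˢ e^{2ikr} dr = (e^{2iks} - 1) / (2ik)` of the Volterra equation, written through
the difference quotient of `exp` at `0` so that it is visibly entire in `k`. -/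
def ker (k : ℂ) (s : ℝ) : ℂ := s * dslope exp 0 (2 * I * k * s)

lemma differentiable_dslope_exp : Differentiable ℂ (dslope exp 0) := by
  have h := (Complex.differentiableOn_dslope (f := exp) (s := Set.univ) (c := 0) univ_mem).2
    differentiable_exp.differentiableOn
  exact fun z => h.differentiableAt univ_mem

lemma mul_ker (k : ℂ) (s : ℝ) : 2 * I * k * ker k s = exp (2 * I * k * s) - 1 := by
  have h := sub_smul_dslope exp 0 (2 * I * k * s)
  simp only [sub_zero, smul_eq_mul, exp_zero] at h
  rw [← h, ker]; ring

@[simp] lemma ker_zero_right (k : ℂ) : ker k 0 = 0 := by simp [ker]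

lemma ker_zero_left (s : ℝ) : ker 0 s = s := by simp [ker]

lemma continuous_ker_uncurry : Continuous fun p : ℂ × ℝ => ker p.1 p.2 := by
  unfold ker
  have := differentiable_dslope_exp.continuous
  fun_prop

lemma differentiable_ker (s : ℝ) : Differentiable ℂ fun k => ker k s := by
  unfold ker
  exact (differentiable_dslope_exp.comp (by fun_prop)).const_mul _

lemma hasDerivAt_ker (k : ℂ) (s : ℝ) : HasDerivAt (ker k) (exp (2 * I * k * s)) s := by
  rcases eq_or_ne k 0 with rfl | hk
  · have : ker 0 = fun s : ℝ => (s : ℂ) := funext ker_zero_left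
    rw [this]
    simpa using (hasDerivAt_id s).ofReal_comp
  · have hk2 : 2 * I * k ≠ 0 := by simp [hk]
    have e : ker k = fun s : ℝ => (exp (2 * I * k * s) - 1) / (2 * I * k) := by
      funext s
      rw [← mul_ker]; field_simp
    rw [e]
    have h1 : HasDerivAt (fun s : ℝ => 2 * I * k * (s : ℂ)) (2 * I * k) s := by
      simpa using ((hasDerivAt_id s).ofReal_comp).const_mul (2 * I * k)
    have h2 := (h1.cexp.sub_const 1).div_const (2 * I * k)
    simpa [hk2] using h2

lemma norm_exp_two_le {k : ℂ} (hk : 0 ≤ k.im) {s : ℝ} (hs : 0 ≤ s) :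
    ‖exp (2 * I * k * s)‖ ≤ 1 := by
  rw [norm_exp, Real.exp_le_one_iff]
  have : (2 * I * k * s).re = -(2 * (k.im * s)) := by
    simp; ring
  rw [this]
  have := mul_nonneg hk hs
  linarith

lemma norm_ker_sub_le {k : ℂ} (hk : 0 ≤ k.im) {s r : ℝ} (hs : 0 ≤ s) (hr : 0 ≤ r) :
    ‖ker k s - ker k r‖ ≤ |s - r| := by
  have h := (convex_Ici (0 : ℝ)).norm_image_sub_le_of_norm_hasDerivWithin_le (f := ker k)
    (f' := fun s => exp (2 * I * k * s)) (C := 1)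
    (fun x _ => (hasDerivAt_ker k x).hasDerivWithinAt) (fun x hx => norm_exp_two_le hk hx) hr hs
  simpa using h

lemma norm_ker_le {k : ℂ} (hk : 0 ≤ k.im) {s : ℝ} (hs : 0 ≤ s) : ‖ker k s‖ ≤ s := by
  have h := norm_ker_sub_le hk hs le_rfl
  simpa [abs_of_nonneg hs] using h

lemma norm_ker_le_inv {k : ℂ} (hk : 0 ≤ k.im) (hk0 : k ≠ 0) {s : ℝ} (hs : 0 ≤ s) :
    ‖ker k s‖ ≤ ‖k‖⁻¹ := by
  have h := congrArg norm (mul_ker k s)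
  have h2 : ‖exp (2 * I * k * s) - 1‖ ≤ 2 :=
    (norm_sub_le _ _).trans (by rw [norm_one]; linarith [norm_exp_two_le hk hs])
  rw [norm_mul, norm_mul, norm_mul, norm_I, mul_one, Complex.norm_ofNat] at h
  have hkp : 0 < ‖k‖ := norm_pos_iff.2 hk0
  rw [← one_div, le_div_iff₀ hkp]
  nlinarith

/-! ### The Volterra operator -/

section Volterra

variable {q : ℝ → ℝ}

lemma ShortRange.integrable (hq : ShortRange q) : Integrable q := by
  have hm : AEStronglyMeasurable q volume := by
    have h := hq.aestronglyMeasurable.mul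
      (f := fun x : ℝ => (1 + |x|) * q x) (g := fun x : ℝ => (1 + |x|)⁻¹) (by
        have : Continuous fun x : ℝ => (1 + |x|)⁻¹ :=
          Continuous.inv₀ (by fun_prop) fun x => by positivity
        exact this.aestronglyMeasurable)
    refine h.congr (ae_of_all _ fun x => ?_)
    have : 1 + |x| ≠ 0 := by positivity
    simp only [Pi.mul_apply]
    field_simp
  refine hq.norm.mono' hm (ae_of_all _ fun x => ?_)
  rw [norm_mul, Real.norm_of_nonneg (by positivity : 0 ≤ 1 + |x|)]
  nlinarith [abs_nonneg x, norm_nonneg (q x)]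

lemma ShortRange.integrable_weight (hq : ShortRange q) (a : ℝ) :
    Integrable fun y : ℝ => |y - a| * |q y| := by
  refine (hq.norm.const_mul (1 + |a|)).mono'
    ((by fun_prop : Continuous fun y : ℝ => |y - a|).aestronglyMeasurable.mul
      hq.integrable.aestronglyMeasurable.norm) (ae_of_all _ fun y => ?_)
  rw [norm_mul, norm_mul, Real.norm_of_nonneg (by positivity : 0 ≤ 1 + |y|), Real.norm_eq_abs,
    Real.norm_eq_abs, Real.norm_eq_abs, abs_abs, abs_abs, ← mul_assoc]
  refine mul_le_mul_of_nonneg_right ?_ (abs_nonneg _)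
  have := abs_sub y a
  nlinarith [abs_nonneg a, abs_nonneg y, mul_nonneg (abs_nonneg a) (abs_nonneg y)]

lemma ShortRange.intervalIntegrable_coe (hq : ShortRange q) (a b : ℝ) :
    IntervalIntegrable (fun s => (q s : ℂ)) volume a b :=
  hq.integrable.ofReal.intervalIntegrable

/-- The tail `∫ₓ^∞ |y - a| |q(y)| dy` of the first moment. -/
def moment (q : ℝ → ℝ) (a x : ℝ) : ℝ := ∫ y in Set.Ioi x, |y - a| * |q y|

lemma moment_nonneg (q : ℝ → ℝ) (a x : ℝ) : 0 ≤ moment q a x :=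
  integral_nonneg fun y => by positivity

lemma isPrim_tail {𝕜 : Type*} [RCLike 𝕜] {g : ℝ → 𝕜} (hg : ∀ x, IntegrableOn g (Set.Ioi x)) :
    IsPrim (fun x => ∫ y in Set.Ioi x, g y) (fun y => -g y) := by
  refine ⟨fun a b => IntervalIntegrable.neg ?_, fun a b => ?_⟩
  · exact ⟨(hg a).mono_set Set.Ioc_subset_Ioi_self, (hg b).mono_set Set.Ioc_subset_Ioi_self⟩
  · rw [intervalIntegral.integral_neg, ← intervalIntegral.integral_Ioi_sub_Ioi' (hg a) (hg b)]
    ring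

lemma tendsto_tail {𝕜 : Type*} [RCLike 𝕜] {g : ℝ → 𝕜} (hg : Integrable g) :
    Tendsto (fun x => ∫ y in Set.Ioi x, g y) atTop (𝓝 0) := by
  have h := (intervalIntegral_tendsto_integral_Ioi 0 hg.integrableOn tendsto_id).const_sub
    (∫ y in Set.Ioi 0, g y)
  rw [sub_self] at h
  refine h.congr fun x => ?_
  rw [id, ← intervalIntegral.integral_Ioi_sub_Ioi' hg.integrableOn hg.integrableOn]
  ring

lemma ShortRange.tendsto_moment (hq : ShortRange q) (a : ℝ) :
    Tendsto (moment q a) atTop (𝓝 0) := tendsto_tail (hq.integrable_weight a)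

lemma ShortRange.continuous_moment (hq : ShortRange q) (a : ℝ) : Continuous (moment q a) :=
  (isPrim_tail fun _ => (hq.integrable_weight a).integrableOn).continuous

lemma moment_antitone (hq : ShortRange q) (a : ℝ) : Antitone (moment q a) := fun _ _ hxy =>
  setIntegral_mono_set (hq.integrable_weight a).integrableOn
    (ae_of_all _ fun y => by positivity) (Set.Ioi_subset_Ioi hxy).eventuallyLE

lemma ShortRange.integrable_weight_mul_moment_pow (hq : ShortRange q) (a : ℝ) (n : ℕ) :
    Integrable fun y => |y - a| * |q y| * moment q a y ^ n := by
  refine (hq.integrable_weight a).mul_bdd (c := (∫ y, |y - a| * |q y|) ^ n)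
    ((hq.continuous_moment a).pow n).aestronglyMeasurable (ae_of_all _ fun y => ?_)
  rw [norm_pow, Real.norm_of_nonneg (moment_nonneg q a y)]
  exact pow_le_pow_left₀ (moment_nonneg q a y) (setIntegral_le_integral (hq.integrable_weight a)
    (ae_of_all _ fun y => by positivity)) n

lemma integral_weight_mul_moment_pow (hq : ShortRange q) (a x : ℝ) (n : ℕ) :
    ∫ y in Set.Ioi x, |y - a| * |q y| * moment q a y ^ n = moment q a x ^ (n + 1) / (n + 1) := by
  have h1 := intervalIntegral_tendsto_integral_Ioi x
    (hq.integrable_weight_mul_moment_pow a n).integrableOn tendsto_id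
  refine tendsto_nhds_unique h1 ?_
  have h2 := (((hq.tendsto_moment a).pow (n + 1)).const_sub (moment q a x ^ (n + 1))).div_const
    ((n : ℝ) + 1)
  rw [zero_pow (Nat.succ_ne_zero n), sub_zero] at h2
  refine h2.congr fun R => ?_
  have h3 := ((isPrim_tail fun _ => (hq.integrable_weight a).integrableOn).pow n).2 x R
  have e : ∀ y, ((n : ℝ) + 1) * (-(|y - a| * |q y|) * moment q a y ^ n)
      = -((n : ℝ) + 1) * (|y - a| * |q y| * moment q a y ^ n) := fun y => by ring
  change moment q a R ^ (n + 1) - moment q a x ^ (n + 1)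
    = ∫ y in x..R, ((n : ℝ) + 1) * (-(|y - a| * |q y|) * moment q a y ^ n) at h3
  simp_rw [e] at h3
  rw [intervalIntegral.integral_const_mul] at h3
  have hn : (n : ℝ) + 1 ≠ 0 := by positivity
  rw [id]
  field_simp
  linarith

/-- `φ` is continuous, and bounded on every right half-line. -/
def TailBounded (φ : ℝ → ℂ) : Prop :=
  Continuous φ ∧ ∀ a : ℝ, ∃ C : ℝ, 0 ≤ C ∧ ∀ y, a ≤ y → ‖φ y‖ ≤ C

/-- The Volterra operator `φ ↦ ∫ₓ^∞ (e^{2ik(y-x)} - 1) / (2ik) q(y) φ(y) dy`. -/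
def volterra (q : ℝ → ℝ) (k : ℂ) (φ : ℝ → ℂ) (x : ℝ) : ℂ :=
  ∫ y in Set.Ioi x, ker k (y - x) * q y * φ y

/-- The derivative `-∫ₓ^∞ e^{2ik(y-x)} q(y) φ(y) dy` of `volterra q k φ`. -/
def volterraDeriv (q : ℝ → ℝ) (k : ℂ) (φ : ℝ → ℂ) (x : ℝ) : ℂ :=
  -∫ y in Set.Ioi x, exp (2 * I * k * (y - x : ℝ)) * q y * φ y

lemma aestronglyMeasurable_coe (hq : ShortRange q) (μ : Measure ℝ) (hμ : μ ≪ volume) :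
    AEStronglyMeasurable (fun y => (q y : ℂ)) μ :=
  (continuous_ofReal.comp_aestronglyMeasurable hq.integrable.aestronglyMeasurable).mono_ac hμ

lemma continuous_ker (k : ℂ) : Continuous (ker k) :=
  continuous_ker_uncurry.comp (by fun_prop : Continuous fun s : ℝ => (k, s))

lemma integrableOn_volterra (hq : ShortRange q) {k : ℂ} (hk : 0 ≤ k.im) {φ : ℝ → ℂ}
    (hφ : TailBounded φ) (x : ℝ) :
    IntegrableOn (fun y => ker k (y - x) * q y * φ y) (Set.Ioi x) := by
  obtain ⟨C, hC, h⟩ := hφ.2 x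
  refine ((hq.integrable_weight x).const_mul C).integrableOn.mono'
    ((((continuous_ker k).comp (by fun_prop : Continuous fun y : ℝ => y - x)).aestronglyMeasurable.mul
      (aestronglyMeasurable_coe hq _ Measure.absolutelyContinuous_restrict)).mul
      hφ.1.aestronglyMeasurable) ?_
  filter_upwards [ae_restrict_mem measurableSet_Ioi] with y hy
  have hy' : 0 ≤ y - x := sub_nonneg.2 (le_of_lt hy)
  rw [norm_mul, norm_mul, Complex.norm_real, abs_of_nonneg hy', mul_comm C, Real.norm_eq_abs]
  have h1 := norm_ker_le hk hy'
  have h2 := h y (le_of_lt hy)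
  gcongr

lemma integrableOn_volterraDeriv (hq : ShortRange q) {k : ℂ} (hk : 0 ≤ k.im) {φ : ℝ → ℂ}
    (hφ : TailBounded φ) (x : ℝ) :
    IntegrableOn (fun y => exp (2 * I * k * (y - x : ℝ)) * q y * φ y) (Set.Ioi x) := by
  obtain ⟨C, hC, h⟩ := hφ.2 x
  refine (hq.integrable.norm.const_mul C).integrableOn.mono'
    (((by fun_prop : Continuous fun y : ℝ => exp (2 * I * k * (y - x : ℝ))).aestronglyMeasurable.mul
      (aestronglyMeasurable_coe hq _ Measure.absolutelyContinuous_restrict)).mul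
      hφ.1.aestronglyMeasurable) ?_
  filter_upwards [ae_restrict_mem measurableSet_Ioi] with y hy
  have hy' : 0 ≤ y - x := sub_nonneg.2 (le_of_lt hy)
  rw [norm_mul, norm_mul, Complex.norm_real, mul_comm C]
  have h1 := norm_exp_two_le hk hy'
  have h2 := h y (le_of_lt hy)
  calc _ ≤ 1 * ‖q y‖ * C := by gcongr
    _ = _ := by ring

lemma norm_volterraDeriv_le (hq : ShortRange q) {k : ℂ} (hk : 0 ≤ k.im) {φ : ℝ → ℂ} {x C : ℝ}
    (h : ∀ y, x ≤ y → ‖φ y‖ ≤ C) :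
    ‖volterraDeriv q k φ x‖ ≤ C * ∫ y in Set.Ioi x, |q y| := by
  rw [volterraDeriv, norm_neg, ← integral_const_mul]
  refine norm_integral_le_of_norm_le (hq.integrable.norm.const_mul C).integrableOn ?_
  filter_upwards [ae_restrict_mem measurableSet_Ioi] with y hy
  have hy' : 0 ≤ y - x := sub_nonneg.2 (le_of_lt hy)
  rw [norm_mul, norm_mul, Complex.norm_real, mul_comm C]
  have h1 := norm_exp_two_le hk hy'
  have h2 := h y (le_of_lt hy)
  calc _ ≤ 1 * ‖q y‖ * C := by gcongr
    _ = _ := by rw [Real.norm_eq_abs]; ring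

lemma hasDerivAt_volterra (hq : ShortRange q) {k : ℂ} (hk : 0 ≤ k.im) {φ : ℝ → ℂ}
    (hφ : TailBounded φ) (x₀ : ℝ) :
    HasDerivAt (volterra q k φ) (volterraDeriv q k φ x₀) x₀ := by
  obtain ⟨C, hC, hb⟩ := hφ.2 (x₀ - 1)
  set μ := (volume : Measure ℝ).restrict (Set.Ioi (x₀ - 1)) with hμ
  have hμac : μ ≪ volume := Measure.absolutelyContinuous_restrict
  set F : ℝ → ℝ → ℂ := fun x y => ker k (max (y - x) 0) * q y * φ y with hF
  set F' : ℝ → ℂ := fun y => (Set.Ioi x₀).indicator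
    (fun y => -(exp (2 * I * k * (y - x₀ : ℝ)) * q y * φ y)) y with hF'
  have hFzero : ∀ x y, y ≤ x → F x y = 0 := fun x y hxy => by
    simp [hF, max_eq_right (sub_nonpos.2 hxy)]
  have hFeq : ∀ x ∈ Metric.ball x₀ 1, volterra q k φ x = ∫ y, F x y ∂μ := by
    intro x hx
    rw [Metric.mem_ball, Real.dist_eq, abs_lt] at hx
    rw [hμ, setIntegral_eq_of_subset_of_forall_sdiff_eq_zero measurableSet_Ioi
      (Set.Ioi_subset_Ioi (by linarith : x₀ - 1 ≤ x)) (fun y hy => hFzero x y (not_lt.1 hy.2))]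
    refine setIntegral_congr_fun measurableSet_Ioi fun y hy => ?_
    simp only [hF, max_eq_left (sub_nonneg.2 (Set.mem_Ioi.1 hy).le)]
  have hmeas : ∀ x, AEStronglyMeasurable (F x) μ := fun x =>
    (((continuous_ker k).comp (by fun_prop : Continuous fun y : ℝ => max (y - x) 0)).aestronglyMeasurable.mul
      (aestronglyMeasurable_coe hq _ hμac)).mul hφ.1.aestronglyMeasurable
  have key := hasDerivAt_integral_of_dominated_loc_of_lip (μ := μ) (F := F) (F' := F') (x₀ := x₀)
    (bound := fun y => C * |q y|) (s := Metric.ball x₀ 1) (Metric.ball_mem_nhds x₀ one_pos)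
    (Eventually.of_forall hmeas) ?_ ?_ ?_ (hq.integrable.norm.const_mul C).integrableOn ?_
  · refine (key.2.congr_of_eventuallyEq (Filter.eventually_of_mem
      (Metric.ball_mem_nhds x₀ one_pos) hFeq)).congr_deriv ?_
    rw [hF', integral_indicator measurableSet_Ioi, hμ, Measure.restrict_restrict measurableSet_Ioi,
      Set.inter_eq_left.2 (Set.Ioi_subset_Ioi (by linarith)), integral_neg]
    rfl
  · refine ((integrable_indicator_iff (f := F x₀) (s := Set.Ioi x₀) measurableSet_Ioi).2
      ?_).congr ?_
    · rw [hμ, IntegrableOn, Measure.restrict_restrict measurableSet_Ioi,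
        Set.inter_eq_left.2 (Set.Ioi_subset_Ioi (by linarith))]
      refine (integrableOn_volterra hq hk hφ x₀).congr_fun (fun y hy => ?_) measurableSet_Ioi
      simp only [hF, max_eq_left (sub_nonneg.2 (Set.mem_Ioi.1 hy).le)]
    · refine ae_of_all _ fun y => ?_
      by_cases hy : y ∈ Set.Ioi x₀
      · rw [Set.indicator_of_mem hy]
      · rw [Set.indicator_of_notMem hy, hFzero x₀ y (not_lt.1 hy)]
  · refine AEStronglyMeasurable.indicator ?_ measurableSet_Ioi
    exact (((by fun_prop : Continuous fun y : ℝ =>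
      exp (2 * I * k * (y - x₀ : ℝ))).aestronglyMeasurable.mul
      (aestronglyMeasurable_coe hq _ hμac)).mul hφ.1.aestronglyMeasurable).neg
  · filter_upwards [ae_restrict_mem measurableSet_Ioi] with y hy
    refine LipschitzOnWith.of_dist_le_mul fun x _ x' _ => ?_
    have h1 := norm_ker_sub_le hk (le_max_right (y - x) 0) (le_max_right (y - x') 0)
    have h2 : |max (y - x) 0 - max (y - x') 0| ≤ |x - x'| := by
      refine (abs_max_sub_max_le_abs _ _ _).trans (le_of_eq ?_)
      rw [show y - x - (y - x') = -(x - x') by ring, abs_neg]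
    rw [Real.coe_nnabs, abs_of_nonneg (by positivity), Real.dist_eq, dist_eq_norm]
    simp only [hF]
    rw [← sub_mul, ← sub_mul, norm_mul, norm_mul, Complex.norm_real, Real.norm_eq_abs]
    calc _ ≤ |x - x'| * |q y| * C := by
          have := hb y (le_of_lt hy)
          gcongr
          exact h1.trans h2
      _ = _ := by ring
  · have hne : ∀ᵐ y ∂μ, y ≠ x₀ := 
      hμac.ae_le (compl_mem_ae_iff.2 (measure_singleton x₀))
    filter_upwards [hne] with y hy
    rcases lt_or_gt_of_ne hy with hlt | hgt
    · simp only [hF']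
      rw [Set.indicator_of_notMem (Set.notMem_Ioi.2 hlt.le)]
      refine (hasDerivAt_const x₀ (0 : ℂ)).congr_of_eventuallyEq ?_
      filter_upwards [lt_mem_nhds hlt] with x hx using hFzero x y hx.le
    · simp only [hF']
      rw [Set.indicator_of_mem (Set.mem_Ioi.2 hgt)]
      have h1 : HasDerivAt (fun x : ℝ => ker k (y - x)) (-exp (2 * I * k * (y - x₀ : ℝ))) x₀ := by
        have h := (hasDerivAt_ker k (y - x₀)).scomp x₀ ((hasDerivAt_id x₀).const_sub y)
        simpa [Function.comp_def] using h
      have h2 := (h1.mul_const (q y : ℂ)).mul_const (φ y)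
      refine (h2.congr_of_eventuallyEq ?_).congr_deriv (by ring)
      filter_upwards [gt_mem_nhds hgt] with x hx
      simp only [hF, max_eq_left (sub_nonneg.2 hx.le)]

end Volterra

/-! ### Dependence of the Volterra operator on `k` -/

section VolterraParameter

variable {q : ℝ → ℝ}

lemma isOpen_upper : IsOpen {k : ℂ | 0 < k.im} := isOpen_lt continuous_const continuous_im

/-- Uniform domination of the two Volterra integrands for `k` in the closed upper half-plane. -/
lemma norm_volterra_integrand_le {k : ℂ} (hk : 0 ≤ k.im) {φ : ℝ → ℂ} {x C : ℝ}
    (h : ∀ y, x ≤ y → ‖φ y‖ ≤ C) {y : ℝ} (hy : x < y) :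
    ‖ker k (y - x) * q y * φ y‖ ≤ C * (|y - x| * |q y|) ∧
      ‖exp (2 * I * k * (y - x : ℝ)) * q y * φ y‖ ≤ C * |q y| := by
  have hy' : 0 ≤ y - x := sub_nonneg.2 hy.le
  have h2 := h y hy.le
  rw [norm_mul, norm_mul, norm_mul, norm_mul, Complex.norm_real, Real.norm_eq_abs]
  constructor
  · have h1 := norm_ker_le hk hy'
    calc _ ≤ (y - x) * |q y| * C := by gcongr
      _ = _ := by rw [abs_of_nonneg hy']; ring
  · have h1 := norm_exp_two_le hk hy'
    calc _ ≤ 1 * |q y| * C := by gcongr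
      _ = _ := by ring

lemma continuousOn_volterra (hq : ShortRange q) {φ : ℂ → ℝ → ℂ} {x C : ℝ}
    (hφ : ∀ k : ℂ, 0 ≤ k.im → TailBounded (φ k))
    (hC : ∀ k : ℂ, 0 ≤ k.im → ∀ y, x ≤ y → ‖φ k y‖ ≤ C)
    (hc : ∀ y, x ≤ y → ContinuousOn (fun k => φ k y) {k | 0 ≤ k.im}) :
    ContinuousOn (fun k => volterra q k (φ k) x) {k | 0 ≤ k.im} ∧
      ContinuousOn (fun k => volterraDeriv q k (φ k) x) {k | 0 ≤ k.im} := by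
  constructor
  · refine continuousOn_of_dominated (bound := fun y => C * (|y - x| * |q y|))
      (fun k hk => (integrableOn_volterra hq hk (hφ k hk) x).aestronglyMeasurable)
      (fun k hk => ?_) ((hq.integrable_weight x).const_mul C).integrableOn ?_
    · filter_upwards [ae_restrict_mem measurableSet_Ioi] with y hy
      exact (norm_volterra_integrand_le hk (hC k hk) hy).1
    · filter_upwards [ae_restrict_mem measurableSet_Ioi] with y hy
      exact ((differentiable_ker (y - x)).continuous.continuousOn.mul continuousOn_const).mul
        (hc y (Set.mem_Ioi.1 hy).le)
  · refine (continuousOn_of_dominated (bound := fun y => C * |q y|)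
      (fun k hk => (integrableOn_volterraDeriv hq hk (hφ k hk) x).aestronglyMeasurable)
      (fun k hk => ?_) (hq.integrable.norm.const_mul C).integrableOn ?_).neg
    · filter_upwards [ae_restrict_mem measurableSet_Ioi] with y hy
      exact (norm_volterra_integrand_le hk (hC k hk) hy).2
    · filter_upwards [ae_restrict_mem measurableSet_Ioi] with y hy
      exact ((by fun_prop : Continuous fun k : ℂ =>
        exp (2 * I * k * (y - x : ℝ))).continuousOn.mul continuousOn_const).mul
        (hc y (Set.mem_Ioi.1 hy).le)

lemma differentiableOn_volterra (hq : ShortRange q) {φ : ℂ → ℝ → ℂ} {x C : ℝ}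
    (hφ : ∀ k : ℂ, 0 ≤ k.im → TailBounded (φ k))
    (hC : ∀ k : ℂ, 0 ≤ k.im → ∀ y, x ≤ y → ‖φ k y‖ ≤ C)
    (hd : ∀ y, x ≤ y → DifferentiableOn ℂ (fun k => φ k y) {k | 0 < k.im}) :
    DifferentiableOn ℂ (fun k => volterra q k (φ k) x) {k | 0 < k.im} ∧
      DifferentiableOn ℂ (fun k => volterraDeriv q k (φ k) x) {k | 0 < k.im} := by
  constructor
  · refine differentiableOn_integral_of_dominated (b := fun y => C * (|y - x| * |q y|))
      isOpen_upper (fun k hk => (integrableOn_volterra hq (le_of_lt hk)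
        (hφ k (le_of_lt hk)) x).aestronglyMeasurable)
      ?_ ?_ ((hq.integrable_weight x).const_mul C).integrableOn
    · filter_upwards [ae_restrict_mem measurableSet_Ioi] with y hy
      exact ((differentiable_ker (y - x)).differentiableOn.mul (differentiableOn_const _)).mul
        (hd y (Set.mem_Ioi.1 hy).le)
    · filter_upwards [ae_restrict_mem measurableSet_Ioi] with y hy k hk
      exact (norm_volterra_integrand_le (le_of_lt hk) (hC k (le_of_lt hk)) hy).1
  · refine (differentiableOn_integral_of_dominated (b := fun y => C * |q y|)
      isOpen_upper (fun k hk => (integrableOn_volterraDeriv hq (le_of_lt hk)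
        (hφ k (le_of_lt hk)) x).aestronglyMeasurable)
      ?_ ?_ (hq.integrable.norm.const_mul C).integrableOn).neg
    · filter_upwards [ae_restrict_mem measurableSet_Ioi] with y hy
      exact ((by fun_prop : Differentiable ℂ fun k : ℂ =>
        exp (2 * I * k * (y - x : ℝ))).differentiableOn.mul (differentiableOn_const _)).mul
        (hd y (Set.mem_Ioi.1 hy).le)
    · filter_upwards [ae_restrict_mem measurableSet_Ioi] with y hy k hk
      exact (norm_volterra_integrand_le (le_of_lt hk) (hC k (le_of_lt hk)) hy).2

end VolterraParameter

/-! ### The Neumann series -/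

section Neumann

variable {q : ℝ → ℝ}

/-- The iterates of the Volterra operator applied to the constant `1`. -/
def volterraIter (q : ℝ → ℝ) (k : ℂ) : ℕ → ℝ → ℂ
  | 0 => fun _ => 1
  | n + 1 => volterra q k (volterraIter q k n)

/-- The Faddeev function `f(x, k) = e^{-ikx} ψ₊(x, k)`, as the Neumann series of the Volterra
equation `f = 1 + volterra q k f`. -/
def faddeev (q : ℝ → ℝ) (k : ℂ) (x : ℝ) : ℂ := ∑' n, volterraIter q k n x

/-- The `x`-derivative of the Faddeev function. -/
def faddeevDeriv (q : ℝ → ℝ) (k : ℂ) (x : ℝ) : ℂ := volterraDeriv q k (faddeev q k) x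

lemma volterraIter_bound (hq : ShortRange q) {k : ℂ} (hk : 0 ≤ k.im) (n : ℕ) :
    TailBounded (volterraIter q k n) ∧
      ∀ a x, a ≤ x → ‖volterraIter q k n x‖ ≤ moment q a x ^ n / n.factorial := by
  induction n with
  | zero => exact ⟨⟨continuous_const, fun _ => ⟨1, by simp, fun _ _ => by simp [volterraIter]⟩⟩,
      fun a x _ => by simp [volterraIter]⟩
  | succ n ih =>
    have hb : ∀ a x, a ≤ x →
        ‖volterraIter q k (n + 1) x‖ ≤ moment q a x ^ (n + 1) / (n + 1).factorial := by
      intro a x hax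
      have hi : IntegrableOn (fun y => |y - a| * |q y| * moment q a y ^ n / n.factorial)
          (Set.Ioi x) :=
        ((hq.integrable_weight_mul_moment_pow a n).div_const _).integrableOn
      calc ‖volterraIter q k (n + 1) x‖
          ≤ ∫ y in Set.Ioi x, |y - a| * |q y| * moment q a y ^ n / n.factorial := by
            refine norm_integral_le_of_norm_le hi ?_
            filter_upwards [ae_restrict_mem measurableSet_Ioi] with y hy
            have hxy : x < y := hy
            rw [norm_mul, norm_mul, Complex.norm_real, Real.norm_eq_abs, mul_div_assoc]
            have h1 := norm_ker_le hk (sub_nonneg.2 hxy.le)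
            have h2 := ih.2 a y (hax.trans hxy.le)
            have h3 : y - x ≤ |y - a| := (by linarith : y - x ≤ y - a).trans (le_abs_self _)
            have := h1.trans h3
            gcongr
        _ = _ := by
            rw [integral_div, integral_weight_mul_moment_pow hq, Nat.factorial_succ]
            have := Nat.factorial_ne_zero n
            push_cast
            field_simp
    refine ⟨⟨continuous_iff_continuousAt.2 fun x =>
      (hasDerivAt_volterra hq hk ih.1 x).continuousAt, fun a => ⟨_, ?_, fun y hy => (hb a y hy).trans
        (div_le_div_of_nonneg_right (pow_le_pow_left₀ (moment_nonneg q a y)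
          (moment_antitone hq a hy) _) (Nat.cast_nonneg _))⟩⟩, hb⟩
    have := moment_nonneg q a a
    positivity

lemma norm_volterraIter_le (hq : ShortRange q) {k : ℂ} (hk : 0 ≤ k.im) (n : ℕ) {a x : ℝ}
    (hax : a ≤ x) : ‖volterraIter q k n x‖ ≤ moment q a a ^ n / n.factorial :=
  ((volterraIter_bound hq hk n).2 a x hax).trans
    (div_le_div_of_nonneg_right (pow_le_pow_left₀ (moment_nonneg q a x)
      (moment_antitone hq a hax) _) (Nat.cast_nonneg _))

lemma norm_faddeev_le (hq : ShortRange q) {k : ℂ} (hk : 0 ≤ k.im) {a x : ℝ} (hax : a ≤ x) :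
    ‖faddeev q k x‖ ≤ Real.exp (moment q a a) := by
  have hs := Real.summable_pow_div_factorial (moment q a a)
  rw [Real.exp_eq_exp_ℝ, NormedSpace.exp_eq_tsum_div]
  exact tsum_of_norm_bounded hs.hasSum fun n => norm_volterraIter_le hq hk n hax

lemma continuous_faddeev (hq : ShortRange q) {k : ℂ} (hk : 0 ≤ k.im) :
    Continuous (faddeev q k) := by
  refine continuous_iff_continuousAt.2 fun x => ?_
  have h : ContinuousOn (faddeev q k) (Set.Ici (x - 1)) :=
    continuousOn_tsum (fun n => (volterraIter_bound hq hk n).1.1.continuousOn)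
      (Real.summable_pow_div_factorial (moment q (x - 1) (x - 1)))
      fun n y hy => norm_volterraIter_le hq hk n hy
  exact h.continuousAt (Ici_mem_nhds (by linarith))

lemma tailBounded_faddeev (hq : ShortRange q) {k : ℂ} (hk : 0 ≤ k.im) :
    TailBounded (faddeev q k) :=
  ⟨continuous_faddeev hq hk, fun a => ⟨_, (Real.exp_pos (moment q a a)).le,
    fun _ hy => norm_faddeev_le hq hk hy⟩⟩

lemma continuousOn_faddeev (hq : ShortRange q) (x : ℝ) :
    ContinuousOn (fun k => faddeev q k x) {k | 0 ≤ k.im} := by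
  have hn : ∀ n x, ContinuousOn (fun k => volterraIter q k n x) {k | 0 ≤ k.im} := by
    intro n
    induction n with
    | zero => exact fun x => continuousOn_const
    | succ n ih => exact fun x => (continuousOn_volterra hq
        (fun k hk => (volterraIter_bound hq hk n).1)
        (fun k hk y hy => norm_volterraIter_le hq hk n hy) fun y _ => ih y).1
  exact continuousOn_tsum (fun n => hn n x) (Real.summable_pow_div_factorial (moment q x x))
    fun n k hk => norm_volterraIter_le hq hk n le_rfl

lemma differentiableOn_faddeev (hq : ShortRange q) (x : ℝ) :
    DifferentiableOn ℂ (fun k => faddeev q k x) {k | 0 < k.im} := by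
  have hn : ∀ n x, DifferentiableOn ℂ (fun k => volterraIter q k n x) {k | 0 < k.im} := by
    intro n
    induction n with
    | zero => exact fun x => differentiableOn_const _
    | succ n ih => exact fun x => (differentiableOn_volterra hq
        (fun k hk => (volterraIter_bound hq hk n).1)
        (fun k hk y hy => norm_volterraIter_le hq hk n hy) fun y _ => ih y).1
  exact differentiableOn_tsum_of_summable_norm (Real.summable_pow_div_factorial (moment q x x))
    (fun n => hn n x) isOpen_upper fun n k hk => norm_volterraIter_le hq (le_of_lt hk) n le_rfl

lemma continuousOn_faddeevDeriv (hq : ShortRange q) (x : ℝ) :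
    ContinuousOn (fun k => faddeevDeriv q k x) {k | 0 ≤ k.im} :=
  (continuousOn_volterra hq (fun _ hk => tailBounded_faddeev hq hk)
    (fun _ hk _ hy => norm_faddeev_le hq hk hy) fun y _ => continuousOn_faddeev hq y).2

lemma differentiableOn_faddeevDeriv (hq : ShortRange q) (x : ℝ) :
    DifferentiableOn ℂ (fun k => faddeevDeriv q k x) {k | 0 < k.im} :=
  (differentiableOn_volterra hq (fun _ hk => tailBounded_faddeev hq hk)
    (fun _ hk _ hy => norm_faddeev_le hq hk hy) fun y _ => differentiableOn_faddeev hq y).2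

/-- The Volterra equation. -/
lemma faddeev_eq (hq : ShortRange q) {k : ℂ} (hk : 0 ≤ k.im) (x : ℝ) :
    faddeev q k x = 1 + volterra q k (faddeev q k) x := by
  have hs : Summable fun n => volterraIter q k n x :=
    Summable.of_norm_bounded (Real.summable_pow_div_factorial (moment q x x))
      fun n => norm_volterraIter_le hq hk n le_rfl
  rw [faddeev, hs.tsum_eq_zero_add]
  congr 1
  set g : ℕ → ℝ → ℂ := fun n y => ker k (y - x) * q y * volterraIter q k n y
  have hgi : ∀ n, IntegrableOn (g n) (Set.Ioi x) := fun n =>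
    integrableOn_volterra hq hk (volterraIter_bound hq hk n).1 x
  have hgs : Summable fun n => ∫ y in Set.Ioi x, ‖g n y‖ := by
    refine Summable.of_nonneg_of_le (fun n => integral_nonneg fun _ => norm_nonneg _) (fun n => ?_)
      ((Real.summable_pow_div_factorial (moment q x x)).mul_right (moment q x x))
    rw [moment, ← integral_const_mul, ← moment]
    refine setIntegral_mono_on (hgi n).norm
      ((hq.integrable_weight x).const_mul _).integrableOn measurableSet_Ioi fun y hy => ?_
    exact (norm_volterra_integrand_le hk (fun z hz => norm_volterraIter_le hq hk n hz) hy).1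
  have h := (hasSum_integral_of_summable_integral_norm hgi hgs).tsum_eq
  refine h.trans (setIntegral_congr_fun measurableSet_Ioi fun y _ => ?_)
  simp only [g, tsum_mul_left, faddeev]

lemma hasDerivAt_faddeev (hq : ShortRange q) {k : ℂ} (hk : 0 ≤ k.im) (x : ℝ) :
    HasDerivAt (faddeev q k) (faddeevDeriv q k x) x := by
  have h : faddeev q k = fun x => 1 + volterra q k (faddeev q k) x := funext (faddeev_eq hq hk)
  rw [h]
  refine ((hasDerivAt_volterra hq hk (tailBounded_faddeev hq hk) x).const_add 1).congr_deriv ?_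
  rfl

lemma norm_faddeevDeriv_le (hq : ShortRange q) {k : ℂ} (hk : 0 ≤ k.im) {a x : ℝ} (hax : a ≤ x) :
    ‖faddeevDeriv q k x‖ ≤ Real.exp (moment q a a) * ∫ y in Set.Ioi x, |q y| :=
  norm_volterraDeriv_le hq hk fun _ hy => norm_faddeev_le hq hk (hax.trans hy)

lemma norm_faddeev_sub_one_le (hq : ShortRange q) {k : ℂ} (hk : 0 ≤ k.im) {a x : ℝ}
    (hax : a ≤ x) : ‖faddeev q k x - 1‖ ≤ Real.exp (moment q a a) * moment q a x := by
  rw [faddeev_eq hq hk, add_sub_cancel_left, volterra, moment.eq_def q a x, ← integral_const_mul]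
  refine norm_integral_le_of_norm_le ((hq.integrable_weight a).const_mul _).integrableOn ?_
  filter_upwards [ae_restrict_mem measurableSet_Ioi] with y hy
  have hxy : x < y := hy
  refine (norm_volterra_integrand_le hk
    (fun z hz => norm_faddeev_le hq hk (hax.trans hz)) hxy).1.trans ?_
  have h3 : |y - x| ≤ |y - a| := by
    rw [abs_of_nonneg (by linarith), abs_of_nonneg (by linarith)]; linarith
  gcongr

/-- High-energy bound `f = 1 + O(1/k)`. -/
lemma norm_faddeev_sub_one_le_inv (hq : ShortRange q) {k : ℂ} (hk : 0 ≤ k.im) (hk0 : k ≠ 0)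
    (x : ℝ) : ‖faddeev q k x - 1‖ ≤ Real.exp (moment q x x) * (∫ y, |q y|) * ‖k‖⁻¹ := by
  have h : ‖faddeev q k x - 1‖ ≤ ∫ y in Set.Ioi x, Real.exp (moment q x x) * ‖k‖⁻¹ * |q y| := by
    rw [faddeev_eq hq hk, add_sub_cancel_left, volterra]
    refine norm_integral_le_of_norm_le (hq.integrable.norm.const_mul _).integrableOn ?_
    filter_upwards [ae_restrict_mem measurableSet_Ioi] with y hy
    have hxy : x < y := hy
    have h1 := norm_ker_le_inv hk hk0 (sub_nonneg.2 hxy.le)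
    have h2 := norm_faddeev_le hq hk hxy.le
    rw [norm_mul, norm_mul, Complex.norm_real, Real.norm_eq_abs]
    calc _ ≤ ‖k‖⁻¹ * |q y| * Real.exp (moment q x x) := by gcongr
      _ = _ := by ring
  rw [integral_const_mul] at h
  refine h.trans ?_
  have h4 := setIntegral_le_integral (s := Set.Ioi x) hq.integrable.norm
    (ae_of_all _ fun y => norm_nonneg (q y))
  have h5 : Real.exp (moment q x x) * (∫ y, |q y|) * ‖k‖⁻¹
    = Real.exp (moment q x x) * ‖k‖⁻¹ * (∫ y, |q y|) := by ring
  rw [h5]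
  exact mul_le_mul_of_nonneg_left h4 (by positivity)

lemma tendsto_faddeev (hq : ShortRange q) {k : ℂ} (hk : 0 ≤ k.im) :
    Tendsto (faddeev q k) atTop (𝓝 1) := by
  rw [tendsto_iff_norm_sub_tendsto_zero]
  have h := (hq.tendsto_moment 0).const_mul (Real.exp (moment q 0 0))
  rw [mul_zero] at h
  refine squeeze_zero' (Eventually.of_forall fun _ => norm_nonneg _) ?_ h
  filter_upwards [eventually_ge_atTop 0] with x hx using norm_faddeev_sub_one_le hq hk hx

lemma tendsto_faddeevDeriv (hq : ShortRange q) {k : ℂ} (hk : 0 ≤ k.im) :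
    Tendsto (faddeevDeriv q k) atTop (𝓝 0) := by
  have h := (tendsto_tail hq.integrable.norm).const_mul (Real.exp (moment q 0 0))
  rw [mul_zero] at h
  refine squeeze_zero_norm' ?_ h
  filter_upwards [eventually_ge_atTop 0] with x hx using norm_faddeevDeriv_le hq hk hx

/-- The Faddeev function at `x` depends only on the potential to the right of `x`. -/
lemma faddeev_congr {q' : ℝ → ℝ} {x₀ : ℝ} (h : ∀ y, x₀ < y → q y = q' y) (k : ℂ) {x : ℝ}
    (hx : x₀ ≤ x) : faddeev q k x = faddeev q' k x ∧ faddeevDeriv q k x = faddeevDeriv q' k x := by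
  have hn : ∀ n x, x₀ ≤ x → volterraIter q k n x = volterraIter q' k n x := by
    intro n
    induction n with
    | zero => exact fun _ _ => rfl
    | succ n ih =>
      refine fun x hx => setIntegral_congr_fun measurableSet_Ioi fun y hy => ?_
      have hxy : x < y := hy
      simp only [h y (hx.trans_lt hxy), ih y (hx.trans hxy.le)]
  have hf : ∀ x, x₀ ≤ x → faddeev q k x = faddeev q' k x := fun x hx =>
    tsum_congr fun n => hn n x hx
  refine ⟨hf x hx, congrArg Neg.neg (setIntegral_congr_fun measurableSet_Ioi fun y hy => ?_)⟩
  have hxy : x < y := hy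
  simp only [h y (hx.trans_lt hxy), hf y (hx.trans hxy.le)]

end Neumann

/-! ### Solutions of the Schrödinger equation -/

/-- `ψ` solves `-ψ'' + q ψ = k² ψ`, with its derivative `ψ'` as part of the data. -/
structure IsSol (q : ℝ → ℝ) (k : ℂ) (ψ ψ' : ℝ → ℂ) : Prop where
  hasDerivAt : ∀ x, HasDerivAt ψ (ψ' x) x
  prim : IsPrim ψ' fun s => ((q s : ℂ) - k ^ 2) * ψ s

lemma IsPrim.conj {u g : ℝ → ℂ} (hu : IsPrim u g) :
    IsPrim (fun x => (starRingEnd ℂ) (u x)) (fun x => (starRingEnd ℂ) (g x)) := by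
  have h : ∀ a b : ℝ, IntervalIntegrable (fun x => (starRingEnd ℂ) (g x)) volume a b := fun a b =>
    ⟨(conjCLE.toContinuousLinearMap.integrable_comp (hu.1 a b).1),
      (conjCLE.toContinuousLinearMap.integrable_comp (hu.1 a b).2)⟩
  refine ⟨h, fun a b => ?_⟩
  rw [← map_sub, hu.2]
  simp only [intervalIntegral, map_sub, integral_conj]

namespace IsSol

variable {q : ℝ → ℝ} {k l : ℂ} {ψ ψ' φ φ' : ℝ → ℂ}

lemma prim₀ (h : IsSol q k ψ ψ') : IsPrim ψ ψ' := .of_hasDerivAt h.hasDerivAt h.prim.continuous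

lemma continuous (h : IsSol q k ψ ψ') : Continuous ψ := h.prim₀.continuous

lemma isSolution (h : IsSol q k ψ ψ') : IsSolution q k ψ := by
  have hd : deriv ψ = ψ' := funext fun x => (h.hasDerivAt x).deriv
  exact ⟨fun x => (h.hasDerivAt x).differentiableAt, fun a b => by rw [hd]; exact h.prim.2 a b⟩

lemma add (h : IsSol q k ψ ψ') (h' : IsSol q k φ φ') :
    IsSol q k (fun x => ψ x + φ x) (fun x => ψ' x + φ' x) :=
  ⟨fun x => (h.hasDerivAt x).add (h'.hasDerivAt x),
    (h.prim.add h'.prim).congr (ae_of_all _ fun x => by ring)⟩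

lemma const_mul (h : IsSol q k ψ ψ') (c : ℂ) :
    IsSol q k (fun x => c * ψ x) (fun x => c * ψ' x) :=
  ⟨fun x => (h.hasDerivAt x).const_mul c,
    (h.prim.const_mul c).congr (ae_of_all _ fun x => by ring)⟩

lemma sub (h : IsSol q k ψ ψ') (h' : IsSol q k φ φ') :
    IsSol q k (fun x => ψ x - φ x) (fun x => ψ' x - φ' x) :=
  ⟨fun x => (h.hasDerivAt x).sub (h'.hasDerivAt x),
    (h.prim.sub h'.prim).congr (ae_of_all _ fun x => by ring)⟩

lemma conj (h : IsSol q k ψ ψ') : IsSol q ((starRingEnd ℂ) k)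
    (fun x => (starRingEnd ℂ) (ψ x)) (fun x => (starRingEnd ℂ) (ψ' x)) := by
  refine ⟨fun x => ?_, h.prim.conj.congr (ae_of_all _ fun x => by simp)⟩
  simpa using (h.hasDerivAt x).star

lemma comp_neg (h : IsSol q k ψ ψ') :
    IsSol (fun x => q (-x)) k (fun x => ψ (-x)) (fun x => -ψ' (-x)) := by
  refine ⟨fun x => ?_, by simpa only [neg_one_mul, neg_neg] using h.prim.comp_neg.const_mul (-1)⟩
  simpa [Function.comp_def] using (h.hasDerivAt (-x)).scomp x (hasDerivAt_neg x)

/-- The Wronskian of two solutions is an indefinite integral of `(k² - l²) ψ φ`. -/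
lemma wronskian (h : IsSol q k ψ ψ') (h' : IsSol q l φ φ') :
    IsPrim (fun x => ψ x * φ' x - ψ' x * φ x) (fun x => (k ^ 2 - l ^ 2) * (ψ x * φ x)) :=
  ((h.prim₀.mul h'.prim).sub (h.prim.mul h'.prim₀)).congr (ae_of_all _ fun x => by ring)

lemma wronskian_const (h : IsSol q k ψ ψ') (h' : IsSol q k φ φ') (x y : ℝ) :
    ψ x * φ' x - ψ' x * φ x = ψ y * φ' y - ψ' y * φ y :=
  (h.wronskian h').eq_of_density_zero fun _ _ => by simp

lemma eq_zero (hq : ShortRange q) (h : IsSol q k ψ ψ') {a : ℝ} (h0 : ψ a = 0) (h1 : ψ' a = 0)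
    (x : ℝ) : ψ x = 0 :=
  eq_zero_of_cauchy_data_zero (V := fun s => (q s : ℂ) - k ^ 2)
    (fun a b => (hq.intervalIntegrable_coe a b).sub intervalIntegrable_const) h.prim₀ h.prim h0 h1 x

lemma deriv_eq_zero (h : IsSol q k ψ ψ') (h0 : ∀ x, ψ x = 0) (x : ℝ) : ψ' x = 0 := by
  have h1 : ψ = fun _ => 0 := funext h0
  have h2 := h.hasDerivAt x
  rw [h1] at h2
  exact h2.unique (hasDerivAt_const x 0)

lemma proportional (hq : ShortRange q) (h : IsSol q k ψ ψ') (h' : IsSol q k φ φ') {a : ℝ}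
    (hne : ∃ x, φ x ≠ 0) (hw : ψ a * φ' a - ψ' a * φ a = 0) :
    ∃ c : ℂ, (∀ x, ψ x = c * φ x) ∧ ∀ x, ψ' x = c * φ' x := by
  obtain ⟨b, hb⟩ := hne
  rw [h.wronskian_const h' a b] at hw
  have hs := h.sub (h'.const_mul (ψ b / φ b))
  have hz := hs.eq_zero hq (a := b) (by field_simp; ring) (by
    field_simp
    linear_combination -hw)
  exact ⟨ψ b / φ b, fun x => sub_eq_zero.1 (hz x),
    fun x => sub_eq_zero.1 (hs.deriv_eq_zero hz x)⟩

end IsSol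

lemma IsSolution.isSol {q : ℝ → ℝ} (hq : ShortRange q) {k : ℂ} {ψ : ℝ → ℂ}
    (h : IsSolution q k ψ) : IsSol q k ψ (deriv ψ) :=
  ⟨fun x => (h.1 x).hasDerivAt, fun a b =>
    ((hq.intervalIntegrable_coe a b).sub intervalIntegrable_const).mul_continuousOn
      h.1.continuous.continuousOn, h.2⟩

/-! ### The Jost solutions -/

/-- The right Jost solution `e^{ikx} f(x, k)`. -/
def jost (q : ℝ → ℝ) (k : ℂ) (x : ℝ) : ℂ := exp (I * k * x) * faddeev q k x

/-- The `x`-derivative of the right Jost solution. -/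
def jostDeriv (q : ℝ → ℝ) (k : ℂ) (x : ℝ) : ℂ :=
  exp (I * k * x) * (I * k * faddeev q k x + faddeevDeriv q k x)

section Jost

variable {q : ℝ → ℝ} {k : ℂ}

lemma hasDerivAt_exp_mul (c : ℂ) (x : ℝ) :
    HasDerivAt (fun x : ℝ => exp (c * x)) (c * exp (c * x)) x := by
  have h1 : HasDerivAt (fun s : ℝ => c * (s : ℂ)) c x := by
    simpa using ((hasDerivAt_id x).ofReal_comp).const_mul c
  simpa [mul_comm] using h1.cexp

lemma isPrim_exp_mul (c : ℂ) : IsPrim (fun x : ℝ => exp (c * x)) (fun x => c * exp (c * x)) :=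
  .of_hasDerivAt (hasDerivAt_exp_mul c) (by fun_prop)

/-- The Faddeev function solves `f'' = q f - 2 i k f'`. -/
lemma isPrim_faddeevDeriv (hq : ShortRange q) (hk : 0 ≤ k.im) :
    IsPrim (faddeevDeriv q k)
      fun x => q x * faddeev q k x - 2 * I * k * faddeevDeriv q k x := by
  set g : ℝ → ℂ := fun y => exp (2 * I * k * y) * q y * faddeev q k y with hg
  have he : ∀ x y : ℝ, exp (2 * I * k * (y - x : ℝ))
      = exp (-(2 * I * k) * x) * exp (2 * I * k * y) := fun x y => by
    rw [← exp_add]; congr 1; push_cast; ring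
  have hgi : ∀ x, IntegrableOn g (Set.Ioi x) := by
    intro x
    have h := (integrableOn_volterraDeriv hq hk (tailBounded_faddeev hq hk) x).const_mul
      (exp (2 * I * k * x))
    refine h.congr (ae_of_all _ fun y => ?_)
    simp only [hg, he x y]
    have h1 : exp (2 * I * k * x) * exp (-(2 * I * k) * x) = 1 := by
      rw [← exp_add]; simp
    linear_combination (exp (2 * I * k * y) * q y * faddeev q k y) * h1
  have hfd : faddeevDeriv q k
      = fun x : ℝ => -1 * (exp (-(2 * I * k) * x) * ∫ y in Set.Ioi x, g y) := by
    funext x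
    rw [faddeevDeriv, volterraDeriv, ← integral_const_mul, neg_one_mul]
    congr 2
    funext y
    rw [he x y]; simp only [hg]; ring
  have hp := ((isPrim_exp_mul (-(2 * I * k))).mul (isPrim_tail hgi)).const_mul (-1)
  rw [hfd]
  refine hp.congr (ae_of_all _ fun x => ?_)
  have h1 : exp (-(2 * I * k) * x) * exp (2 * I * k * x) = 1 := by
    rw [← exp_add]; simp
  simp only [hg]
  linear_combination (q x * faddeev q k x) * h1

lemma isSol_jost (hq : ShortRange q) (hk : 0 ≤ k.im) :
    IsSol q k (jost q k) (jostDeriv q k) := by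
  have hf : IsPrim (faddeev q k) (faddeevDeriv q k) :=
    .of_hasDerivAt (hasDerivAt_faddeev hq hk) (isPrim_faddeevDeriv hq hk).continuous
  refine ⟨fun x => ?_, ?_⟩
  · refine ((hasDerivAt_exp_mul (I * k) x).mul (hasDerivAt_faddeev hq hk x)).congr_deriv ?_
    rw [jostDeriv]; ring
  · refine ((isPrim_exp_mul (I * k)).mul
      ((hf.const_mul (I * k)).add (isPrim_faddeevDeriv hq hk))).congr (ae_of_all _ fun x => ?_)
    simp only [jost]
    linear_combination (k ^ 2 * exp (I * k * x) * faddeev q k x) * I_sq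

lemma exp_neg_mul_exp (c : ℂ) : exp (-c) * exp c = 1 := by rw [← exp_add]; simp

lemma isJostRight_jost (hq : ShortRange q) (hk : 0 ≤ k.im) : IsJostRight q k (jost q k) := by
  have hs := isSol_jost hq hk
  refine ⟨hs.isSolution, ?_, ?_⟩
  · refine (tendsto_faddeev hq hk).congr fun x => ?_
    rw [jost, ← mul_assoc, exp_neg_mul_exp, one_mul]
  · refine (tendsto_faddeevDeriv hq hk).congr fun x => ?_
    rw [(hs.hasDerivAt x).deriv, jost, jostDeriv]
    linear_combination (-faddeevDeriv q k x) * exp_neg_mul_exp (I * k * x)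

lemma jost_ne_zero (hq : ShortRange q) (hk : 0 ≤ k.im) : ∃ x, jost q k x ≠ 0 := by
  obtain ⟨x, hx⟩ := ((tendsto_faddeev hq hk).eventually_ne one_ne_zero).exists
  exact ⟨x, mul_ne_zero (exp_ne_zero _) hx⟩

lemma norm_exp_I_mul (k : ℂ) (x : ℝ) : ‖exp (I * k * x)‖ = Real.exp (-k.im * x) := by
  rw [norm_exp]; simp

/-- Uniqueness of the right Jost solution: the Wronskian of the difference of two of them with one
of them vanishes at `+∞`. -/
lemma IsJostRight.eq_jost (hq : ShortRange q) (hk : 0 ≤ k.im) {ψ : ℝ → ℂ}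
    (h : IsJostRight q k ψ) : ψ = jost q k := by
  have hs := isSol_jost hq hk
  have hd := (h.1.isSol hq).sub hs
  have hj := isJostRight_jost hq hk
  have hu : Tendsto (fun x : ℝ => exp (-(I * k * x)) * (ψ x - jost q k x)) atTop (𝓝 0) := by
    have := h.2.1.sub hj.2.1
    rw [sub_self] at this
    exact this.congr fun x => by ring
  have hv : Tendsto (fun x : ℝ => exp (-(I * k * x)) *
      (deriv ψ x - jostDeriv q k x - I * k * (ψ x - jost q k x))) atTop (𝓝 0) := by
    have := h.2.2.sub hj.2.2
    rw [sub_self] at this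
    refine this.congr fun x => ?_
    rw [(hs.hasDerivAt x).deriv]; ring
  -- the terms `ik` cancel in the Wronskian, which leaves `e^{2ikx} o(1)`
  have hw : Tendsto (fun x : ℝ => (ψ x - jost q k x) * jostDeriv q k x
      - (deriv ψ x - jostDeriv q k x) * jost q k x) atTop (𝓝 0) := by
    have h1 : Tendsto (fun x : ℝ => (exp (-(I * k * x)) * (ψ x - jost q k x)) * faddeevDeriv q k x
        - exp (-(I * k * x)) * (deriv ψ x - jostDeriv q k x - I * k * (ψ x - jost q k x))
          * faddeev q k x) atTop (𝓝 0) := by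
      simpa using (hu.mul (tendsto_faddeevDeriv hq hk)).sub (hv.mul (tendsto_faddeev hq hk))
    refine squeeze_zero_norm' ?_ (by simpa using h1.norm)
    filter_upwards [eventually_ge_atTop 0] with x hx
    have e : (ψ x - jost q k x) * jostDeriv q k x - (deriv ψ x - jostDeriv q k x) * jost q k x
        = exp (2 * I * k * x) * ((exp (-(I * k * x)) * (ψ x - jost q k x)) * faddeevDeriv q k x
        - exp (-(I * k * x)) * (deriv ψ x - jostDeriv q k x - I * k * (ψ x - jost q k x))
          * faddeev q k x) := by
      have e2 : exp (2 * I * k * x) = exp (I * k * x) * exp (I * k * x) := by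
        rw [← exp_add]; congr 1; ring
      have e1 := exp_neg_mul_exp (I * k * x)
      rw [e2, jost, jostDeriv]
      set E := exp (I * k * x)
      set E' := exp (-(I * k * x))
      set f := faddeev q k x
      set f' := faddeevDeriv q k x
      linear_combination (-E * ((ψ x - E * f) * f' - (deriv ψ x - E * (I * k * f + f')
        - I * k * (ψ x - E * f)) * f)) * e1
    rw [e, norm_mul]
    exact mul_le_of_le_one_left (norm_nonneg _) (norm_exp_two_le hk hx)
  have hw0 : (ψ 0 - jost q k 0) * jostDeriv q k 0
      - (deriv ψ 0 - jostDeriv q k 0) * jost q k 0 = 0 :=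
    tendsto_nhds_unique (tendsto_const_nhds.congr fun x => hd.wronskian_const hs 0 x) hw
  obtain ⟨c, hc, -⟩ := hd.proportional hq hs (jost_ne_zero hq hk) hw0
  -- the asymptotics at `+∞` leave no multiple of the Jost solution in the difference
  have hc0 : c = 0 := by
    have h1 := hj.2.1.const_mul c
    rw [mul_one] at h1
    exact tendsto_nhds_unique (h1.congr fun x => by rw [hc x]; ring) hu
  funext x
  have := hc x
  rw [hc0, zero_mul] at this
  exact sub_eq_zero.1 this

lemma jostRight_eq (hq : ShortRange q) (hk : 0 ≤ k.im) : jostRight q k = jost q k :=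
  IsJostRight.eq_jost hq hk (Classical.epsilon_spec ⟨_, isJostRight_jost hq hk⟩)

/-- The reflected potential `q(-x)`. -/
def reflect (q : ℝ → ℝ) : ℝ → ℝ := fun x => q (-x)

@[simp] lemma reflect_reflect (q : ℝ → ℝ) : reflect (reflect q) = q := by
  funext x; simp [reflect]

lemma ShortRange.reflect (hq : ShortRange q) : ShortRange (reflect q) := by
  have h := Integrable.comp_neg hq
  simpa [ShortRange, SepInf.reflect] using h

lemma IsJostRight.reflect {ψ : ℝ → ℂ} (h : IsJostRight q k ψ) (hq : ShortRange q) :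
    IsJostLeft (reflect q) k fun x => ψ (-x) := by
  have hs := (h.1.isSol hq).comp_neg
  refine ⟨hs.isSolution, ?_, ?_⟩
  · refine (h.2.1.comp tendsto_neg_atBot_atTop).congr fun x => ?_
    simp
  · have := (h.2.2.comp tendsto_neg_atBot_atTop).neg
    rw [neg_zero] at this
    refine this.congr fun x => ?_
    rw [(hs.hasDerivAt x).deriv]
    simp only [Function.comp_apply, ofReal_neg, mul_neg, neg_neg]
    ring

lemma IsJostLeft.reflect {ψ : ℝ → ℂ} (h : IsJostLeft q k ψ) (hq : ShortRange q) :
    IsJostRight (reflect q) k fun x => ψ (-x) := by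
  have hs := (h.1.isSol hq).comp_neg
  refine ⟨hs.isSolution, ?_, ?_⟩
  · refine (h.2.1.comp tendsto_neg_atTop_atBot).congr fun x => ?_
    simp
  · have := (h.2.2.comp tendsto_neg_atTop_atBot).neg
    rw [neg_zero] at this
    refine this.congr fun x => ?_
    rw [(hs.hasDerivAt x).deriv]
    simp only [Function.comp_apply, ofReal_neg, mul_neg]
    ring

/-- The left Jost solution is the reflected right Jost solution of the reflected potential. -/
lemma jostLeft_eq (hq : ShortRange q) (hk : 0 ≤ k.im) :
    jostLeft q k = fun x => jost (reflect q) k (-x) := by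
  have h : IsJostLeft q k (jostLeft q k) := by
    refine Classical.epsilon_spec (p := IsJostLeft q k) ⟨fun x => jost (reflect q) k (-x), ?_⟩
    simpa using (isJostRight_jost hq.reflect hk).reflect hq.reflect
  have h2 := IsJostRight.eq_jost hq.reflect hk (h.reflect hq)
  funext x
  have := congrFun h2 (-x)
  simpa using this

lemma isSol_jostLeft (hq : ShortRange q) (hk : 0 ≤ k.im) :
    IsSol q k (fun x => jost (reflect q) k (-x)) (fun x => -jostDeriv (reflect q) k (-x)) := by
  have h := (isSol_jost hq.reflect hk).comp_neg
  simpa [reflect] using h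

end Jost

/-! ### Jost data at the origin and the Wronskian -/

section JostData

variable {q : ℝ → ℝ} {k p : ℂ}

/-- The value `ψ₊(0, k)`. -/
def jostA (q : ℝ → ℝ) (k : ℂ) : ℂ := faddeev q k 0

/-- The derivative `ψ₊'(0, k)`. -/
def jostB (q : ℝ → ℝ) (k : ℂ) : ℂ := I * k * faddeev q k 0 + faddeevDeriv q k 0

/-- The Wronskian `ψ₋ ψ₊' - ψ₋' ψ₊`, expressed by the Cauchy data at the origin of the right Jost
solutions of `q` and of the reflected potential. -/
def wron (q : ℝ → ℝ) (k : ℂ) : ℂ :=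
  jostB q k * jostA (reflect q) k + jostA q k * jostB (reflect q) k

lemma jost_zero (q : ℝ → ℝ) (k : ℂ) : jost q k 0 = jostA q k := by simp [jost, jostA]

lemma jostDeriv_zero (q : ℝ → ℝ) (k : ℂ) : jostDeriv q k 0 = jostB q k := by
  simp [jostDeriv, jostB]

lemma wron_reflect (q : ℝ → ℝ) (k : ℂ) : wron (reflect q) k = wron q k := by
  rw [wron, wron, reflect_reflect]; ring

lemma continuousOn_jostA (hq : ShortRange q) : ContinuousOn (jostA q) {k | 0 ≤ k.im} :=
  continuousOn_faddeev hq 0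

lemma continuousOn_jostB (hq : ShortRange q) : ContinuousOn (jostB q) {k | 0 ≤ k.im} :=
  ((by fun_prop : Continuous fun k : ℂ => I * k).continuousOn.mul (continuousOn_faddeev hq 0)).add
    (continuousOn_faddeevDeriv hq 0)

lemma differentiableOn_jostA (hq : ShortRange q) :
    DifferentiableOn ℂ (jostA q) {k | 0 < k.im} := differentiableOn_faddeev hq 0

lemma differentiableOn_jostB (hq : ShortRange q) :
    DifferentiableOn ℂ (jostB q) {k | 0 < k.im} :=
  ((by fun_prop : Differentiable ℂ fun k : ℂ => I * k).differentiableOn.mul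
    (differentiableOn_faddeev hq 0)).add (differentiableOn_faddeevDeriv hq 0)

lemma continuousOn_wron (hq : ShortRange q) : ContinuousOn (wron q) {k | 0 ≤ k.im} :=
  ((continuousOn_jostB hq).mul (continuousOn_jostA hq.reflect)).add
    ((continuousOn_jostA hq).mul (continuousOn_jostB hq.reflect))

lemma differentiableOn_wron (hq : ShortRange q) :
    DifferentiableOn ℂ (wron q) {k | 0 < k.im} :=
  ((differentiableOn_jostB hq).mul (differentiableOn_jostA hq.reflect)).add
    ((differentiableOn_jostA hq).mul (differentiableOn_jostB hq.reflect))

lemma exists_jostA_bound (hq : ShortRange q) : ∃ C : ℝ, 0 ≤ C ∧ ∀ k : ℂ, 0 ≤ k.im →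
    ‖jostA q k‖ ≤ C ∧ ‖jostB q k - I * k * jostA q k‖ ≤ C ∧ ‖k‖ * ‖jostA q k - 1‖ ≤ C := by
  set c := Real.exp (moment q 0 0)
  set N := ∫ y, |q y|
  have hN : 0 ≤ N := integral_nonneg fun _ => abs_nonneg _
  have hc : 0 < c := Real.exp_pos _
  refine ⟨c + c * N, by positivity, fun k hk => ⟨?_, ?_, ?_⟩⟩
  · exact (norm_faddeev_le hq hk le_rfl).trans (by nlinarith)
  · have h := norm_faddeevDeriv_le hq hk (le_refl (0 : ℝ))
    have h4 := setIntegral_le_integral (s := Set.Ioi 0) hq.integrable.norm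
      (ae_of_all _ fun y => norm_nonneg (q y))
    rw [jostB, jostA, add_sub_cancel_left]
    exact h.trans ((mul_le_mul_of_nonneg_left h4 hc.le).trans (by simp only [N, Real.norm_eq_abs]; linarith))
  · rcases eq_or_ne k 0 with rfl | hk0
    · simp; positivity
    · have h := norm_faddeev_sub_one_le_inv hq hk hk0 0
      have hkp : 0 < ‖k‖ := norm_pos_iff.2 hk0
      calc ‖k‖ * ‖jostA q k - 1‖ ≤ ‖k‖ * (c * N * ‖k‖⁻¹) := by gcongr; exact h
        _ = c * N := by field_simp
        _ ≤ _ := by linarith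

/-- High-energy asymptotics `W = 2ik + O(1)`. -/
lemma exists_wron_bound (hq : ShortRange q) : ∃ C : ℝ, 0 ≤ C ∧ ∀ k : ℂ, 0 ≤ k.im →
    ‖wron q k - 2 * I * k‖ ≤ C := by
  obtain ⟨C₁, h₁, hb₁⟩ := exists_jostA_bound hq
  obtain ⟨C₂, h₂, hb₂⟩ := exists_jostA_bound hq.reflect
  refine ⟨2 * (C₁ * C₂) + 2 * C₂ + C₁ * C₂ + C₁ * C₂, by positivity, fun k hk => ?_⟩
  obtain ⟨a1, a2, a3⟩ := hb₁ k hk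
  obtain ⟨b1, b2, b3⟩ := hb₂ k hk
  set f := jostA q k
  set g := jostA (reflect q) k
  have e : wron q k - 2 * I * k = 2 * I * (k * (f - 1)) * g + 2 * I * (k * (g - 1))
      + (jostB q k - I * k * f) * g + f * (jostB (reflect q) k - I * k * g) := by
    rw [wron]; ring
  rw [e]
  refine (norm_add_le _ _).trans (add_le_add ((norm_add_le _ _).trans (add_le_add
    ((norm_add_le _ _).trans (add_le_add ?_ ?_)) ?_)) ?_)
  · rw [norm_mul, norm_mul, norm_mul, norm_mul, norm_I, Complex.norm_ofNat, mul_one, mul_assoc]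
    gcongr
  · rw [norm_mul, norm_mul, norm_mul, norm_I, Complex.norm_ofNat, mul_one]
    gcongr
  · rw [norm_mul]; gcongr
  · rw [norm_mul]; gcongr

lemma norm_jost_le (hq : ShortRange q) (hk : 0 ≤ k.im) {x : ℝ} (hx : 0 ≤ x) :
    ‖jost q k x‖ ≤ Real.exp (moment q 0 0) * Real.exp (-k.im * x) := by
  rw [jost, norm_mul, norm_exp_I_mul, mul_comm]
  gcongr
  exact norm_faddeev_le hq hk hx

lemma exists_jostDeriv_bound (hq : ShortRange q) (hk : 0 ≤ k.im) : ∃ C : ℝ, 0 ≤ C ∧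
    ∀ x : ℝ, 0 ≤ x → ‖jostDeriv q k x‖ ≤ C * Real.exp (-k.im * x) := by
  set c := Real.exp (moment q 0 0)
  set N := ∫ y, |q y|
  have hN : 0 ≤ N := integral_nonneg fun _ => abs_nonneg _
  have hc : 0 < c := Real.exp_pos _
  refine ⟨‖k‖ * c + c * N, by positivity, fun x hx => ?_⟩
  rw [jostDeriv, norm_mul, norm_exp_I_mul, mul_comm]
  gcongr
  refine (norm_add_le _ _).trans (add_le_add ?_ ?_)
  · rw [norm_mul, norm_mul, norm_I, one_mul]
    gcongr
    exact norm_faddeev_le hq hk hx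
  · refine (norm_faddeevDeriv_le hq hk hx).trans (mul_le_mul_of_nonneg_left ?_ hc.le)
    exact setIntegral_le_integral hq.integrable.norm (ae_of_all _ fun y => norm_nonneg (q y))

lemma tendsto_exp_neg_mul {a : ℝ} (ha : 0 < a) :
    Tendsto (fun x : ℝ => Real.exp (-a * x)) atTop (𝓝 0) :=
  Real.tendsto_exp_atBot.comp (tendsto_id.const_mul_atTop_of_neg (neg_neg_of_pos ha))

lemma tendsto_jost_zero (hq : ShortRange q) (hk : 0 < k.im) :
    Tendsto (jost q k) atTop (𝓝 0) ∧ Tendsto (jostDeriv q k) atTop (𝓝 0) := by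
  obtain ⟨C, -, hC⟩ := exists_jostDeriv_bound hq hk.le
  constructor
  · refine squeeze_zero_norm' ?_
      (mul_zero (Real.exp (moment q 0 0)) ▸ (tendsto_exp_neg_mul hk).const_mul _)
    filter_upwards [eventually_ge_atTop 0] with x hx using norm_jost_le hq hk.le hx
  · refine squeeze_zero_norm' ?_ (mul_zero C ▸ (tendsto_exp_neg_mul hk).const_mul C)
    filter_upwards [eventually_ge_atTop 0] with x hx using hC x hx

lemma continuous_jost (hq : ShortRange q) (hk : 0 ≤ k.im) : Continuous (jost q k) :=
  (isSol_jost hq hk).continuous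

/-- Domination of products of two Jost solutions on the positive half-line. -/
lemma norm_jost_mul_jost_le (hq : ShortRange q) (hk : 0 ≤ k.im) (hp : 0 ≤ p.im) {x : ℝ}
    (hx : 0 ≤ x) : ‖jost q k x * jost q p x‖
      ≤ Real.exp (moment q 0 0) ^ 2 * Real.exp (-p.im * x) := by
  have h1 := norm_jost_le hq hk hx
  have h2 := norm_jost_le hq hp hx
  have h3 : Real.exp (-k.im * x) ≤ 1 := Real.exp_le_one_iff.2 (by nlinarith)
  rw [norm_mul]
  calc _ ≤ (Real.exp (moment q 0 0) * 1) * (Real.exp (moment q 0 0) * Real.exp (-p.im * x)) := by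
        gcongr
        exact h1.trans (by gcongr)
    _ = _ := by ring

lemma integrableOn_exp_bound {a : ℝ} (ha : 0 < a) (C : ℝ) :
    IntegrableOn (fun x : ℝ => C * Real.exp (-a * x)) (Set.Ioi 0) :=
  (integrableOn_exp_mul_Ioi (neg_neg_of_pos ha) 0).const_mul C

lemma integrableOn_jost_mul_jost (hq : ShortRange q) (hk : 0 ≤ k.im) (hp : 0 < p.im) :
    IntegrableOn (fun x => jost q k x * jost q p x) (Set.Ioi 0) := by
  refine (integrableOn_exp_bound hp (Real.exp (moment q 0 0) ^ 2)).mono'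
    ((continuous_jost hq hk).mul (continuous_jost hq hp.le)).aestronglyMeasurable ?_
  filter_upwards [ae_restrict_mem measurableSet_Ioi] with x hx
  exact norm_jost_mul_jost_le hq hk hp.le (Set.mem_Ioi.1 hx).le

lemma integrableOn_norm_jost_sq (hq : ShortRange q) (hk : 0 < k.im) :
    IntegrableOn (fun x => ‖jost q k x‖ ^ 2) (Set.Ioi 0) := by
  refine (integrableOn_jost_mul_jost hq hk.le hk).norm.congr (ae_of_all _ fun x => ?_)
  simp only [norm_mul, sq]

/-- Green's identity on the half-line for two energies. -/
lemma jost_green (hq : ShortRange q) (hk : 0 < k.im) (hp : 0 < p.im) :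
    jostB q k * jostA q p - jostA q k * jostB q p
      = (k ^ 2 - p ^ 2) * ∫ x in Set.Ioi 0, jost q k x * jost q p x := by
  have hw := (isSol_jost hq hk.le).wronskian (isSol_jost hq hp.le)
  have h1 := intervalIntegral_tendsto_integral_Ioi 0
    ((integrableOn_jost_mul_jost hq hk.le hp).const_mul (k ^ 2 - p ^ 2)) tendsto_id
  have h2 : Tendsto (fun R : ℝ => (jost q k R * jostDeriv q p R - jostDeriv q k R * jost q p R)
      - (jost q k 0 * jostDeriv q p 0 - jostDeriv q k 0 * jost q p 0)) atTop
      (𝓝 (0 * 0 - 0 * 0 - (jost q k 0 * jostDeriv q p 0 - jostDeriv q k 0 * jost q p 0))) :=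
    (((tendsto_jost_zero hq hk).1.mul (tendsto_jost_zero hq hp).2).sub
      ((tendsto_jost_zero hq hk).2.mul (tendsto_jost_zero hq hp).1)).sub_const _
  have h3 := tendsto_nhds_unique h1 (h2.congr fun R => hw.2 0 R)
  rw [integral_const_mul] at h3
  rw [h3, jost_zero, jost_zero, jostDeriv_zero, jostDeriv_zero]
  ring

/-- A zero of the Wronskian makes the two Jost solutions proportional. -/
lemma exists_proportional (hq : ShortRange q) (hk : 0 ≤ k.im) (h0 : wron q k = 0) :
    ∃ μ : ℂ, μ ≠ 0 ∧ (∀ x, jost (reflect q) k (-x) = μ * jost q k x) ∧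
      jostA (reflect q) k = μ * jostA q k ∧ jostB (reflect q) k = -(μ * jostB q k) := by
  have hw : jost (reflect q) k (-0) * jostDeriv q k 0
      - -jostDeriv (reflect q) k (-0) * jost q k 0 = 0 := by
    rw [neg_zero, jost_zero, jost_zero, jostDeriv_zero, jostDeriv_zero, ← h0, wron]; ring
  obtain ⟨μ, h1, h2⟩ := (isSol_jostLeft hq hk).proportional hq (isSol_jost hq hk)
    (jost_ne_zero hq hk) hw
  refine ⟨μ, ?_, h1, ?_, ?_⟩
  · rintro rfl
    obtain ⟨x, hx⟩ := jost_ne_zero hq.reflect hk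
    have := h1 (-x)
    rw [neg_neg, zero_mul] at this
    exact hx this
  · have := h1 0
    rwa [neg_zero, jost_zero, jost_zero] at this
  · have := h2 0
    rw [neg_zero, jostDeriv_zero, jostDeriv_zero] at this
    linear_combination -this

lemma integrableOn_Iic_of_comp_neg {f : ℝ → ℝ} (h : IntegrableOn (fun x => f (-x)) (Set.Ioi 0)) :
    IntegrableOn f (Set.Iic 0) := by
  rw [integrableOn_Iic_iff_integrableOn_Iio]
  have h1 : IntegrableOn (fun x => f (-x)) (Set.Ioi (-0)) := by rwa [neg_zero]
  have h2 := IntegrableOn.comp_neg_Iio h1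
  simpa only [neg_neg] using h2

/-- At a zero of the Wronskian in the open half-plane the Jost solution is square integrable. -/
lemma integrable_norm_jost_sq (hq : ShortRange q) (hk : 0 < k.im) (h0 : wron q k = 0) :
    Integrable fun x => ‖jost q k x‖ ^ 2 := by
  obtain ⟨μ, hμ, h, -, -⟩ := exists_proportional hq hk.le h0
  rw [← integrableOn_univ, ← Set.Iic_union_Ioi (a := (0 : ℝ))]
  refine IntegrableOn.union (integrableOn_Iic_of_comp_neg ?_) (integrableOn_norm_jost_sq hq hk)
  refine ((integrableOn_norm_jost_sq hq.reflect hk).const_mul (‖μ‖⁻¹ ^ 2)).congr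
    (ae_of_all _ fun x => ?_)
  have h2 := h (-x)
  rw [neg_neg] at h2
  have hμ' : ‖μ‖ ≠ 0 := norm_ne_zero_iff.2 hμ
  simp only [h2, norm_mul]
  field_simp

lemma integral_norm_jost_sq_pos (hq : ShortRange q) (hk : 0 < k.im) (h0 : wron q k = 0) :
    0 < ∫ x, ‖jost q k x‖ ^ 2 := by
  refine (integral_pos_iff_support_of_nonneg (fun x => by positivity)
    (integrable_norm_jost_sq hq hk h0)).2 ?_
  have hc : Continuous fun x => ‖jost q k x‖ ^ 2 := (continuous_jost hq hk.le).norm.pow 2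
  refine hc.isOpen_support.measure_pos volume ?_
  obtain ⟨x, hx⟩ := jost_ne_zero hq hk.le
  exact ⟨x, by simpa using hx⟩

/-- The zeros of the Wronskian in the upper half-plane lie on the imaginary axis, because the
Schrödinger operator is symmetric. -/
lemma re_eq_zero_of_wron_eq_zero (hq : ShortRange q) (hk : 0 < k.im) (h0 : wron q k = 0) :
    k.re = 0 := by
  obtain ⟨μ, hμ, h, -, -⟩ := exists_proportional hq hk.le h0
  have hs := isSol_jost hq hk.le
  have hw := hs.wronskian hs.conj
  have hi := integrable_norm_jost_sq hq hk h0
  have e : ∀ x, jost q k x * (starRingEnd ℂ) (jost q k x) = ((‖jost q k x‖ ^ 2 : ℝ) : ℂ) :=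
    fun x => by rw [mul_conj, normSq_eq_norm_sq]
  simp only [e] at hw
  have h1 := intervalIntegral_tendsto_integral (hi.ofReal (𝕜 := ℂ) |>.const_mul
    (k ^ 2 - (starRingEnd ℂ) k ^ 2)) tendsto_neg_atTop_atBot tendsto_id
  have t1 := tendsto_jost_zero hq hk
  have t2 := tendsto_jost_zero hq.reflect hk
  have hneg : Tendsto (fun R => jost q k (-R)) atTop (𝓝 0) := by
    have := t2.1.const_mul μ⁻¹
    rw [mul_zero] at this
    refine this.congr fun R => ?_
    have h2 := h (-R)
    rw [neg_neg] at h2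
    rw [h2]; field_simp
  have hnegd : Tendsto (fun R => jostDeriv q k (-R)) atTop (𝓝 0) := by
    have := t2.2.const_mul (-μ⁻¹)
    rw [mul_zero] at this
    refine this.congr fun R => ?_
    have h2 := ((isSol_jostLeft hq hk.le).sub (hs.const_mul μ)).deriv_eq_zero
      (fun x => sub_eq_zero.2 (h x)) (-R)
    rw [neg_neg] at h2
    field_simp
    linear_combination h2
  have hstar : Tendsto (fun z : ℂ => (starRingEnd ℂ) z) (𝓝 0) (𝓝 0) := by
    simpa using (continuous_conj.tendsto (0 : ℂ))
  have h2 := ((t1.1.mul (hstar.comp t1.2)).sub (t1.2.mul (hstar.comp t1.1))).sub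
    ((hneg.mul (hstar.comp hnegd)).sub (hnegd.mul (hstar.comp hneg)))
  simp only [mul_zero, sub_zero] at h2
  have h3 := tendsto_nhds_unique h1 (h2.congr fun R => hw.2 (-R) R)
  rw [integral_const_mul, integral_ofReal] at h3
  have h4 : k ^ 2 - (starRingEnd ℂ) k ^ 2 = 0 :=
    (mul_eq_zero.1 h3).resolve_right
      (RCLike.ofReal_ne_zero.2 (integral_norm_jost_sq_pos hq hk h0).ne')
  have h5 := congrArg Complex.im h4
  simp [sq] at h5
  rcases (by nlinarith : k.re * k.im = 0) |> mul_eq_zero.1 with h6 | h6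
  · exact h6
  · exact absurd h6 hk.ne'

lemma memLp_two_of_integrable_sq {ψ : ℝ → ℂ} (hc : Continuous ψ)
    (h : Integrable fun x => ‖ψ x‖ ^ 2) : MemLp ψ 2 volume :=
  (memLp_two_iff_integrable_sq_norm hc.aestronglyMeasurable).2 h

/-- A square integrable solution is proportional to the right Jost solution: its Wronskian with `ψ₊`
is a constant `c`, and integrating it bounds `|c| y` at every `y > 0` with `|ψ(y)| ≤ 1`. Such `y`
are unbounded, so `c = 0`. -/
lemma exists_eq_jost_of_memLp (hq : ShortRange q) (hk : 0 < k.im) {ψ ψ' : ℝ → ℂ}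
    (hψ : IsSol q k ψ ψ') (h2 : MemLp ψ 2 volume) : ∃ c : ℂ, (∀ x, ψ x = c * jost q k x) ∧
      ∀ x, ψ' x = c * jostDeriv q k x := by
  have hs := isSol_jost hq hk.le
  have hsq : Integrable fun x => ‖ψ x‖ ^ 2 :=
    (memLp_two_iff_integrable_sq_norm hψ.continuous.aestronglyMeasurable).1 h2
  obtain ⟨C, hC0, hC⟩ := exists_jostDeriv_bound hq hk.le
  set c := ψ 0 * jostDeriv q k 0 - ψ' 0 * jost q k 0 with hc
  have hconst : ∀ x, ψ x * jostDeriv q k x - ψ' x * jost q k x = c := fun x =>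
    hψ.wronskian_const hs x 0
  suffices hc0 : c = 0 from hψ.proportional hq hs (jost_ne_zero hq hk.le) hc0
  set g : ℝ → ℝ := fun x => ‖ψ x‖ ^ 2 + C ^ 2 * Real.exp (-(2 * k.im) * x) with hg
  have hgi : IntegrableOn g (Set.Ioi 0) :=
    hsq.integrableOn.add (integrableOn_exp_bound (by linarith) _)
  set M := ∫ x in Set.Ioi 0, g x
  -- up to the constant `c`, twice `ψ ψ₊'` is the derivative of `ψ ψ₊`
  have hlin : ∀ y : ℝ, 0 ≤ y → ‖ψ y‖ ≤ 1 →
      ‖c‖ * y ≤ Real.exp (moment q 0 0) + ‖ψ 0 * jost q k 0‖ + M := by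
    intro y hy hψy
    have hp := (hψ.prim₀.mul hs.prim₀).2 0 y
    have hi1 : IntervalIntegrable (fun x => 2 * (ψ x * jostDeriv q k x)) volume 0 y :=
      ((hψ.continuous.mul hs.prim.continuous).const_mul 2).intervalIntegrable _ _
    have e : (fun x => ψ' x * jost q k x + ψ x * jostDeriv q k x)
        = fun x => 2 * (ψ x * jostDeriv q k x) - c := by
      funext x; rw [← hconst x]; ring
    rw [e, intervalIntegral.integral_sub hi1 intervalIntegrable_const,
      intervalIntegral.integral_const, sub_zero] at hp
    have e2 : (y : ℂ) * c = (∫ x in (0 : ℝ)..y, 2 * (ψ x * jostDeriv q k x))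
        - (ψ y * jost q k y - ψ 0 * jost q k 0) := by
      rw [hp]; simp
    have e3 : ‖c‖ * y = ‖(y : ℂ) * c‖ := by
      rw [norm_mul, Complex.norm_real, Real.norm_of_nonneg hy, mul_comm]
    rw [e3, e2]
    have b1 : ‖∫ x in (0 : ℝ)..y, 2 * (ψ x * jostDeriv q k x)‖ ≤ M := by
      refine (intervalIntegral.norm_integral_le_integral_norm hy).trans ?_
      rw [intervalIntegral.integral_of_le hy]
      refine (setIntegral_mono_on ?_ (hgi.mono_set Set.Ioc_subset_Ioi_self) measurableSet_Ioc
        fun x hx => ?_).trans (setIntegral_mono_set hgi (ae_of_all _ fun x => by positivity)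
          Set.Ioc_subset_Ioi_self.eventuallyLE)
      · exact (intervalIntegrable_iff_integrableOn_Ioc_of_le hy).1 hi1.norm
      · have h1 := hC x hx.1.le
        have h3 : Real.exp (-(2 * k.im) * x) = Real.exp (-k.im * x) ^ 2 := by
          rw [← Real.exp_nat_mul]; congr 1; push_cast; ring
        rw [norm_mul, norm_mul, Complex.norm_ofNat]
        simp only [hg]
        rw [h3, ← mul_pow]
        have h4 : ‖ψ x‖ * ‖jostDeriv q k x‖ ≤ ‖ψ x‖ * (C * Real.exp (-k.im * x)) := by gcongr
        nlinarith [sq_nonneg (‖ψ x‖ - C * Real.exp (-k.im * x))]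
    have b2 : ‖ψ y * jost q k y‖ ≤ Real.exp (moment q 0 0) := by
      rw [norm_mul]
      have h1 := norm_jost_le hq hk.le hy
      have h3 : Real.exp (-k.im * y) ≤ 1 := Real.exp_le_one_iff.2 (by nlinarith)
      calc _ ≤ 1 * (Real.exp (moment q 0 0) * 1) := by
            gcongr
            exact h1.trans (by gcongr)
        _ = _ := by ring
    calc _ ≤ _ := norm_sub_le _ _
      _ ≤ M + (Real.exp (moment q 0 0) + ‖ψ 0 * jost q k 0‖) :=
        add_le_add b1 ((norm_sub_le _ _).trans (add_le_add b2 le_rfl))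
      _ = _ := by ring
  by_contra hne
  have hcp : 0 < ‖c‖ := norm_pos_iff.2 hne
  set Y := (Real.exp (moment q 0 0) + ‖ψ 0 * jost q k 0‖ + M) / ‖c‖ with hY
  -- beyond `Y` the solution would have modulus larger than one
  have hbig : ∀ y ∈ Set.Ioi (max Y 0), 1 ≤ ‖ψ y‖ ^ 2 := by
    intro y hy
    have hy' := max_lt_iff.1 (Set.mem_Ioi.1 hy)
    by_contra hlt
    have h1 : ‖ψ y‖ ≤ 1 := by nlinarith [norm_nonneg (ψ y)]
    have h3 := hlin y hy'.2.le h1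
    rw [hY, div_lt_iff₀ hcp] at hy'
    linarith [hy'.1]
  have hfin : IntegrableOn (fun _ : ℝ => (1 : ℝ)) (Set.Ioi (max Y 0)) := by
    refine hsq.integrableOn.mono' aestronglyMeasurable_const ?_
    filter_upwards [ae_restrict_mem measurableSet_Ioi] with y hy
    simpa using hbig y hy
  rw [integrableOn_const_iff] at hfin
  simp at hfin

end JostData

/-! ### Bound states -/

section BoundStates

variable {q : ℝ → ℝ} {k p : ℂ}

lemma I_mul_im (κ : ℝ) : (I * (κ : ℂ)).im = κ := by simp

/-- The bound states are the zeros of the Wronskian on the positive imaginary axis. -/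
lemma mem_boundStates_iff (hq : ShortRange q) {κ : ℝ} :
    κ ∈ boundStates q ↔ 0 < κ ∧ wron q (I * κ) = 0 := by
  refine and_congr_right fun hκ => ?_
  have hk : 0 < (I * (κ : ℂ)).im := by rwa [I_mul_im]
  constructor
  · rintro ⟨ψ, hψ, h2, hne⟩
    have hs := hψ.isSol hq
    obtain ⟨c, hc, hc'⟩ := exists_eq_jost_of_memLp hq hk hs h2
    have h2' : MemLp (fun x => ψ (-x)) 2 volume :=
      h2.comp_measurePreserving (Measure.measurePreserving_neg _)
    obtain ⟨d, hd, hd'⟩ := exists_eq_jost_of_memLp hq.reflect hk hs.comp_neg h2'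
    have hc0 : c ≠ 0 := by
      rintro rfl
      exact hne (funext fun x => by simp [hc x])
    have hd0 : d ≠ 0 := by
      rintro rfl
      refine hne (funext fun x => ?_)
      have := hd (-x)
      simpa using this
    have e1 := hc 0
    have e2 := hc' 0
    have e3 := hd 0
    have e4 := hd' 0
    rw [jost_zero] at e1 e3
    rw [jostDeriv_zero] at e2 e4
    simp only [neg_zero] at e3 e4
    -- the solution decays at both ends, so it is a multiple of both Jost solutions
    have : c * d * wron q (I * κ) = 0 := by
      rw [wron]
      linear_combination (-(d * jostA (reflect q) (I * κ))) * e2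
        - (d * jostB (reflect q) (I * κ)) * e1 - deriv ψ 0 * e3 - ψ 0 * e4
    exact (mul_eq_zero.1 this).resolve_left (mul_ne_zero hc0 hd0)
  · intro h0
    refine ⟨jost q (I * κ), (isSol_jost hq hk.le).isSolution,
      memLp_two_of_integrable_sq (continuous_jost hq hk.le) (integrable_norm_jost_sq hq hk h0), ?_⟩
    intro h
    obtain ⟨x, hx⟩ := jost_ne_zero hq hk.le
    exact hx (congrFun h x)

/-- On the imaginary axis the Jost solution is real. -/
lemma conj_jost (hq : ShortRange q) {κ : ℝ} (hκ : 0 ≤ κ) (x : ℝ) :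
    (starRingEnd ℂ) (jost q (I * κ) x) = jost q (I * κ) x := by
  have hk : 0 ≤ (I * (κ : ℂ)).im := by rwa [I_mul_im]
  have hs := (isSol_jost hq hk)
  have hj := isJostRight_jost hq hk
  have hkc : (starRingEnd ℂ) (I * κ) = -(I * κ) := by simp
  have hs' : IsSol q (I * κ) (fun x => (starRingEnd ℂ) (jost q (I * κ) x))
      (fun x => (starRingEnd ℂ) (jostDeriv q (I * κ) x)) := by
    have h := hs.conj
    rw [hkc] at h
    exact ⟨h.hasDerivAt, h.prim.congr (ae_of_all _ fun x => by ring)⟩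
  have hexp : ∀ x : ℝ, (starRingEnd ℂ) (exp (-(I * (I * κ) * x))) = exp (-(I * (I * κ) * x)) := by
    intro x
    rw [← exp_conj]; congr 1; simp
  have h : IsJostRight q (I * κ) fun x => (starRingEnd ℂ) (jost q (I * κ) x) := by
    refine ⟨hs'.isSolution, ?_, ?_⟩
    · have h1 := (continuous_conj.tendsto (1 : ℂ)).comp hj.2.1
      rw [map_one] at h1
      refine h1.congr fun x => ?_
      simp only [Function.comp_apply, map_mul (starRingEnd ℂ) (exp _), hexp]
    · have h1 := (continuous_conj.tendsto (0 : ℂ)).comp hj.2.2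
      rw [map_zero] at h1
      refine h1.congr fun x => ?_
      rw [(hs'.hasDerivAt x).deriv, Function.comp_apply, (hs.hasDerivAt x).deriv,
        map_mul (starRingEnd ℂ) (exp _), hexp, map_sub]
      simp
  exact congrFun (h.eq_jost hq hk) x

lemma jost_sq_eq (hq : ShortRange q) {κ : ℝ} (hκ : 0 ≤ κ) (x : ℝ) :
    jost q (I * κ) x * jost q (I * κ) x = ((‖jost q (I * κ) x‖ ^ 2 : ℝ) : ℂ) := by
  conv_lhs => rw [← conj_jost hq hκ x]
  rw [conj_jost hq hκ x]
  nth_rw 2 [← conj_jost hq hκ x]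
  rw [mul_conj, normSq_eq_norm_sq]

/-! ### Residues at the bound states -/

/-- The function `2ik (α ψ₋(0) + β ψ₋'(0)) / ((α ψ₊(0) + β ψ₊'(0)) W)`. On the real line it differs
from the reflection coefficient by a term that involves only `ψ₊(0)` and `ψ₊'(0)`, which are the
same for `q` and `q₊`. The parameters `α, β` are chosen near each point so that
`α ψ₊(0) + β ψ₊'(0)` does not vanish; the only poles are then zeros of the Wronskian. -/
def chart (q : ℝ → ℝ) (α β k : ℂ) : ℂ :=
  2 * I * k * (α * jostA (reflect q) k - β * jostB (reflect q) k)
    / ((α * jostA q k + β * jostB q k) * wron q k)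

/-- Expansion of the Wronskian near a zero `p`, in terms of the differences of the Cauchy data of
the two Jost solutions. -/
lemma wron_expand {A B A' B' Ap Bp A'p B'p μ α β : ℂ} (hμ : μ ≠ 0) (hA : A'p = μ * Ap)
    (hB : B'p = -(μ * Bp)) :
    (α * Ap + β * Bp) * (B * A' + A * B')
      = (B * Ap - A * Bp) * (α * A' - β * B')
        + (B' * A'p - A' * B'p) / μ * (α * A + β * B) := by
  subst hA hB
  field_simp
  ring

/-- The half-line inner product `∫₀^∞ ψ₊(x, k) ψ₊(x, p) dx`. -/
def jostInner (q : ℝ → ℝ) (k p : ℂ) : ℂ := ∫ x in Set.Ioi 0, jost q k x * jost q p x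

lemma continuousOn_jost (hq : ShortRange q) (x : ℝ) :
    ContinuousOn (fun k => jost q k x) {k | 0 ≤ k.im} :=
  ((by fun_prop : Continuous fun k : ℂ => exp (I * k * x)).continuousOn).mul
    (continuousOn_faddeev hq x)

lemma continuousOn_jostInner (hq : ShortRange q) (hp : 0 < p.im) :
    ContinuousOn (fun k => jostInner q k p) {k | 0 ≤ k.im} := by
  refine continuousOn_of_dominated
    (bound := fun x => Real.exp (moment q 0 0) ^ 2 * Real.exp (-p.im * x))
    (fun k hk => (integrableOn_jost_mul_jost hq hk hp).aestronglyMeasurable)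
    (fun k hk => ?_) (integrableOn_exp_bound hp _) ?_
  · filter_upwards [ae_restrict_mem measurableSet_Ioi] with x hx
    exact norm_jost_mul_jost_le hq hk hp.le (Set.mem_Ioi.1 hx).le
  · exact ae_of_all _ fun x => (continuousOn_jost hq x).mul continuousOn_const

lemma upper_mem_nhds (hp : 0 < p.im) : {k : ℂ | 0 ≤ k.im} ∈ 𝓝 p :=
  mem_of_superset (isOpen_upper.mem_nhds hp) fun k hk => le_of_lt (show 0 < k.im from hk)

lemma continuousAt_jostA (hq : ShortRange q) (hp : 0 < p.im) : ContinuousAt (jostA q) p :=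
  (continuousOn_jostA hq).continuousAt (upper_mem_nhds hp)

lemma continuousAt_jostB (hq : ShortRange q) (hp : 0 < p.im) : ContinuousAt (jostB q) p :=
  (continuousOn_jostB hq).continuousAt (upper_mem_nhds hp)

lemma continuousAt_wron (hq : ShortRange q) (hp : 0 < p.im) : ContinuousAt (wron q) p :=
  (continuousOn_wron hq).continuousAt (upper_mem_nhds hp)

/-- At a bound state the two half-line inner products add up to the full norm. -/
lemma jostInner_add (hq : ShortRange q) {κ : ℝ} (hκ : 0 < κ) {μ : ℂ} (hμ : μ ≠ 0)
    (h0 : wron q (I * κ) = 0)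
    (h : ∀ x, jost (reflect q) (I * κ) (-x) = μ * jost q (I * κ) x) :
    jostInner q (I * κ) (I * κ) + jostInner (reflect q) (I * κ) (I * κ) / μ ^ 2
      = ((∫ x, ‖jost q (I * κ) x‖ ^ 2 : ℝ) : ℂ) := by
  have hk : 0 < (I * (κ : ℂ)).im := by rwa [I_mul_im]
  have hi := integrable_norm_jost_sq hq hk h0
  have e1 : jostInner q (I * κ) (I * κ)
      = ((∫ x in Set.Ioi 0, ‖jost q (I * κ) x‖ ^ 2 : ℝ) : ℂ) := by
    rw [jostInner, ← integral_complex_ofReal]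
    simp only [jost_sq_eq hq hκ.le]
  have e2 : jostInner (reflect q) (I * κ) (I * κ) / μ ^ 2
      = ((∫ x in Set.Iic 0, ‖jost q (I * κ) x‖ ^ 2 : ℝ) : ℂ) := by
    have e3 : ∀ x, jost (reflect q) (I * κ) x * jost (reflect q) (I * κ) x
        = μ ^ 2 * ((‖jost q (I * κ) (-x)‖ ^ 2 : ℝ) : ℂ) := by
      intro x
      have := h (-x)
      rw [neg_neg] at this
      rw [this, ← jost_sq_eq hq hκ.le]; ring
    have e4 := integral_comp_neg_Ioi (0 : ℝ) fun x => ‖jost q (I * κ) x‖ ^ 2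
    rw [neg_zero] at e4
    rw [← e4, jostInner, ← integral_complex_ofReal]
    simp only [e3]
    rw [integral_const_mul]
    field_simp
  rw [e1, e2, ← ofReal_add, add_comm, ← intervalIntegral.integral_Iic_add_Ioi hi.integrableOn
    hi.integrableOn]

/-- The residue of `chart q α β` at `iκ` is `i c` if `-κ²` is a bound state with norming constant
`c`, and `0` otherwise. -/
lemma tendsto_residue (hq : ShortRange q) {κ : ℝ} (hκ : 0 < κ) {α β : ℂ}
    (hc : α * jostA q (I * κ) + β * jostB q (I * κ) ≠ 0) :
    Tendsto (fun k => (k - I * κ) * chart q α β k) (𝓝[≠] (I * κ : ℂ))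
      (𝓝 (I * ((boundStates q).indicator (normingConst q) κ : ℝ))) := by
  set p : ℂ := I * κ with hpdef
  have hp : 0 < p.im := by rwa [hpdef, I_mul_im]
  have cA := continuousAt_jostA hq hp
  have cB := continuousAt_jostB hq hp
  have cA' := continuousAt_jostA hq.reflect hp
  have cB' := continuousAt_jostB hq.reflect hp
  have cW := continuousAt_wron hq hp
  by_cases h0 : wron q p = 0
  · have hmem : κ ∈ boundStates q := (mem_boundStates_iff hq).2 ⟨hκ, h0⟩
    rw [Set.indicator_of_mem hmem]
    obtain ⟨μ, hμ, hprop, hA, hB⟩ := exists_proportional hq hp.le h0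
    set c := α * jostA q p + β * jostB q p with hcdef
    set Q : ℂ → ℂ := fun k => jostInner q k p * (α * jostA (reflect q) k - β * jostB (reflect q) k)
      + jostInner (reflect q) k p / μ * (α * jostA q k + β * jostB q k) with hQ
    have cJ : ContinuousAt (fun k => jostInner q k p) p :=
      (continuousOn_jostInner hq hp).continuousAt (upper_mem_nhds hp)
    have cJ' : ContinuousAt (fun k => jostInner (reflect q) k p) p :=
      (continuousOn_jostInner hq.reflect hp).continuousAt (upper_mem_nhds hp)
    have cQ : ContinuousAt Q p :=
      (cJ.mul ((cA'.const_mul α).sub (cB'.const_mul β))).add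
        ((cJ'.div_const μ).mul ((cA.const_mul α).add (cB.const_mul β)))
    -- Green's identity exhibits the factor `k - p` of the Wronskian; the cofactor is nonzero at `p`,
    -- so the zero is simple
    have hexp : ∀ k : ℂ, 0 < k.im → c * wron q k = (k - p) * ((k + p) * Q k) := by
      intro k hk
      have h1 := jost_green hq hk hp
      have h2 := jost_green hq.reflect hk hp
      rw [wron, hcdef, wron_expand hμ hA hB, h1, h2, ← jostInner, ← jostInner, hQ]
      ring
    set N : ℂ := ((∫ x, ‖jost q p x‖ ^ 2 : ℝ) : ℂ) with hN
    have hN0 : N ≠ 0 := by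
      rw [hN]; exact ofReal_ne_zero.2 (integral_norm_jost_sq_pos hq hp h0).ne'
    have hQp : Q p = μ * c * N := by
      rw [hN, ← jostInner_add hq hκ hμ h0 hprop]
      simp only [hQ]
      rw [hA, hB, ← hpdef, hcdef]
      field_simp
      ring
    have hp0 : p ≠ 0 := fun h => by rw [h] at hp; simp at hp
    have hev : ∀ᶠ k in 𝓝[≠] p, (k - p) * chart q α β k
        = 2 * I * k * (α * jostA (reflect q) k - β * jostB (reflect q) k) * c
          / ((α * jostA q k + β * jostB q k) * ((k + p) * Q k)) := by
      have hQne : ∀ᶠ k in 𝓝 p, (k + p) * Q k ≠ 0 := by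
        refine ((continuousAt_id.add continuousAt_const).mul cQ).eventually_ne ?_
        change (p + p) * Q p ≠ 0
        rw [hQp]
        exact mul_ne_zero (by rw [← two_mul]; exact mul_ne_zero two_ne_zero hp0)
          (mul_ne_zero (mul_ne_zero hμ hc) hN0)
      filter_upwards [self_mem_nhdsWithin, nhdsWithin_le_nhds hQne,
        nhdsWithin_le_nhds (isOpen_upper.mem_nhds hp)] with k hkp hk1 hk2
      have hkp' : k - p ≠ 0 := sub_ne_zero.2 hkp
      have hw : wron q k = (k - p) * ((k + p) * Q k) / c := by
        rw [← hexp k hk2]; field_simp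
      rw [chart, hw]
      by_cases hden : α * jostA q k + β * jostB q k = 0
      · simp [hden]
      · field_simp
    refine Tendsto.congr' (EventuallyEq.symm hev) ?_
    have hlim : ContinuousAt (fun k =>
        2 * I * k * (α * jostA (reflect q) k - β * jostB (reflect q) k) * c
          / ((α * jostA q k + β * jostB q k) * ((k + p) * Q k))) p := by
      refine ContinuousAt.div ?_ ?_ ?_
      · exact ((continuousAt_const.mul continuousAt_id).mul
          ((cA'.const_mul α).sub (cB'.const_mul β))).mul continuousAt_const
      · exact ((cA.const_mul α).add (cB.const_mul β)).mul
          ((continuousAt_id.add continuousAt_const).mul cQ)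
      · rw [hQp]
        exact mul_ne_zero hc (mul_ne_zero (by rw [← two_mul]; exact mul_ne_zero two_ne_zero hp0)
          (mul_ne_zero (mul_ne_zero hμ hc) hN0))
    -- `2 i p · μ c · c / (c · 2 p · μ c N) = i / N`
    have hval : 2 * I * p * (α * jostA (reflect q) p - β * jostB (reflect q) p) * c
          / ((α * jostA q p + β * jostB q p) * ((p + p) * Q p)) = I * (normingConst q κ : ℝ) := by
      rw [hQp, hA, hB, normingConst, ← hpdef, jostRight_eq hq hp.le, ofReal_inv, ← hN]
      have e : α * (μ * jostA q p) - β * -(μ * jostB q p) = μ * c := by rw [hcdef]; ring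
      rw [e, ← hcdef]
      field_simp
      ring
    have := hlim.tendsto
    rw [hval] at this
    exact this.mono_left nhdsWithin_le_nhds
  · have hmem : κ ∉ boundStates q := fun h => h0 ((mem_boundStates_iff hq).1 h).2
    rw [Set.indicator_of_notMem hmem]
    have hlim : ContinuousAt (fun k => (k - p) * chart q α β k) p := by
      refine (continuousAt_id.sub continuousAt_const).mul (ContinuousAt.div ?_ ?_ ?_)
      · exact (continuousAt_const.mul continuousAt_id).mul
          ((cA'.const_mul α).sub (cB'.const_mul β))
      · exact ((cA.const_mul α).add (cB.const_mul β)).mul cW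
      · exact mul_ne_zero hc h0
    have := hlim.tendsto
    simp only [sub_self, zero_mul] at this
    rw [ofReal_zero, mul_zero]
    exact this.mono_left nhdsWithin_le_nhds

/-! ### Low energies -/

/-- The tail `∫ₓ^∞ |q|` is integrable on the positive half-line. -/
lemma integrableOn_tail (hq : ShortRange q) :
    IntegrableOn (fun x => ∫ y in Set.Ioi x, |q y|) (Set.Ioi 0) := by
  set N : ℝ → ℝ := fun x => ∫ y in Set.Ioi x, |q y| with hN
  have hNp : IsPrim N fun y => -|q y| := isPrim_tail fun _ => hq.integrable.norm.integrableOn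
  have hN0 : ∀ x, 0 ≤ N x := fun x => integral_nonneg fun _ => abs_nonneg _
  refine integrableOn_Ioi_of_intervalIntegral_norm_bounded (2 * moment q 0 0) 0
    (fun R => (hNp.continuous.integrableOn_Icc (a := 0) (b := R)).mono_set Set.Ioc_subset_Icc_self)
    tendsto_id ?_
  filter_upwards [eventually_ge_atTop 0] with R hR
  have hid : IsPrim (fun x : ℝ => x) fun _ => 1 := .of_hasDerivAt (fun x => hasDerivAt_id x)
    continuous_const
  have h1 := (hid.mul hNp).2 0 R
  have hi2 : IntervalIntegrable (fun x => x * |q x|) volume 0 R :=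
    hq.integrable.norm.intervalIntegrable.continuousOn_mul continuous_id.continuousOn
  have e : ∀ x, 1 * N x + x * -|q x| = N x - x * |q x| := fun x => by ring
  simp only [e] at h1
  rw [intervalIntegral.integral_sub (hNp.continuous.intervalIntegrable _ _) hi2, zero_mul,
    sub_zero] at h1
  have e2 : ∀ x, ‖N x‖ = N x := fun x => Real.norm_of_nonneg (hN0 x)
  simp only [e2]
  have b1 : R * N R ≤ moment q 0 0 := by
    rw [hN, ← integral_const_mul]
    refine (setIntegral_mono_on (hq.integrable.norm.const_mul R).integrableOn
      (hq.integrable_weight 0).integrableOn measurableSet_Ioi fun y hy => ?_).trans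
      (moment_antitone hq 0 hR)
    have : R < y := hy
    rw [sub_zero, abs_of_pos (by linarith : 0 < y), Real.norm_eq_abs]
    gcongr
  have b2 : ∫ x in (0 : ℝ)..R, x * |q x| ≤ moment q 0 0 := by
    rw [intervalIntegral.integral_of_le hR]
    refine (setIntegral_mono_on ((intervalIntegrable_iff_integrableOn_Ioc_of_le hR).1 hi2)
      (hq.integrable_weight 0).integrableOn measurableSet_Ioc fun x hx => ?_).trans
      (setIntegral_mono_set (hq.integrable_weight 0).integrableOn
        (ae_of_all _ fun y => by positivity) Set.Ioc_subset_Ioi_self.eventuallyLE)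
    rw [sub_zero, abs_of_pos hx.1]
  linarith

lemma isPrim_faddeev (hq : ShortRange q) (hk : 0 ≤ k.im) :
    IsPrim (faddeev q k) (faddeevDeriv q k) :=
  .of_hasDerivAt (hasDerivAt_faddeev hq hk) (isPrim_faddeevDeriv hq hk).continuous

/-- The derivative of `f(x, k) f(x, 0)` is dominated by the integrable tail of `q`. -/
lemma norm_deriv_prod_le (hq : ShortRange q) (hk : 0 ≤ k.im) {x : ℝ} (hx : 0 ≤ x) :
    ‖exp (I * k * x) * (faddeevDeriv q k x * faddeev q 0 x
      + faddeev q k x * faddeevDeriv q 0 x)‖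
      ≤ 2 * Real.exp (moment q 0 0) ^ 2 * ∫ y in Set.Ioi x, |q y| := by
  have h0 : (0 : ℝ) ≤ (0 : ℂ).im := by simp
  have a1 := norm_faddeev_le hq hk hx
  have a2 := norm_faddeev_le hq h0 hx
  have b1 := norm_faddeevDeriv_le hq hk hx
  have b2 := norm_faddeevDeriv_le hq h0 hx
  have c1 : ‖exp (I * k * x)‖ ≤ 1 := by
    rw [norm_exp_I_mul]
    exact Real.exp_le_one_iff.2 (by nlinarith)
  set c := Real.exp (moment q 0 0)
  have hN : 0 ≤ ∫ y in Set.Ioi x, |q y| := integral_nonneg fun _ => abs_nonneg _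
  set N := ∫ y in Set.Ioi x, |q y|
  have hc : 0 < c := Real.exp_pos _
  rw [norm_mul]
  calc _ ≤ 1 * (c * N * c + c * (c * N)) := by
        gcongr
        refine (norm_add_le _ _).trans ?_
        rw [norm_mul, norm_mul]
        gcongr
    _ = _ := by ring

lemma integrableOn_deriv_prod (hq : ShortRange q) (hk : 0 ≤ k.im) :
    IntegrableOn (fun x : ℝ => exp (I * k * x) * (faddeevDeriv q k x * faddeev q 0 x
      + faddeev q k x * faddeevDeriv q 0 x)) (Set.Ioi 0) := by
  have h0 : (0 : ℝ) ≤ (0 : ℂ).im := by simp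
  refine ((integrableOn_tail hq).const_mul (2 * Real.exp (moment q 0 0) ^ 2)).mono' ?_ ?_
  · have c1 := (isPrim_faddeevDeriv hq hk).continuous
    have c2 := (isPrim_faddeevDeriv hq h0).continuous
    have c3 := continuous_faddeev hq hk
    have c4 := continuous_faddeev hq h0
    exact (by fun_prop : Continuous fun x : ℝ => exp (I * k * x) * (faddeevDeriv q k x *
      faddeev q 0 x + faddeev q k x * faddeevDeriv q 0 x)).aestronglyMeasurable
  · filter_upwards [ae_restrict_mem measurableSet_Ioi] with x hx
    exact norm_deriv_prod_le hq hk (Set.mem_Ioi.1 hx).le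

/-- The Wronskian of `ψ₊(·, 0)` and `ψ₊(·, k)` at the origin, integrated by parts so that the
remaining integrand is dominated uniformly in `k`. -/
lemma jost_green_zero (hq : ShortRange q) (hk : 0 ≤ k.im) :
    jostB q k * jostA q 0 - jostA q k * jostB q 0
      = I * k * (faddeev q k 0 * faddeev q 0 0
        + ∫ x : ℝ in Set.Ioi 0, exp (I * k * x) * (faddeevDeriv q k x * faddeev q 0 x
          + faddeev q k x * faddeevDeriv q 0 x)) := by
  have h0 : (0 : ℝ) ≤ (0 : ℂ).im := by simp
  have hp : IsPrim (fun x : ℝ => exp (I * k * x) * (faddeevDeriv q k x * faddeev q 0 x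
      - faddeev q k x * faddeevDeriv q 0 x))
      (fun x => -(I * k) * (exp (I * k * x) * (faddeevDeriv q k x * faddeev q 0 x
        + faddeev q k x * faddeevDeriv q 0 x))) := by
    refine ((isPrim_exp_mul (I * k)).mul (((isPrim_faddeevDeriv hq hk).mul
      (isPrim_faddeev hq h0)).sub ((isPrim_faddeev hq hk).mul
        (isPrim_faddeevDeriv hq h0)))).congr (ae_of_all _ fun x => ?_)
    ring
  have h1 := intervalIntegral_tendsto_integral_Ioi 0
    ((integrableOn_deriv_prod hq hk).const_mul (-(I * k))) tendsto_id
  have h2 : Tendsto (fun x : ℝ => exp (I * k * x) * (faddeevDeriv q k x * faddeev q 0 x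
      - faddeev q k x * faddeevDeriv q 0 x)) atTop (𝓝 0) := by
    have h3 := ((tendsto_faddeevDeriv hq hk).mul (tendsto_faddeev hq h0)).sub
      ((tendsto_faddeev hq hk).mul (tendsto_faddeevDeriv hq h0))
    simp only [zero_mul, mul_zero, sub_zero] at h3
    refine squeeze_zero_norm' ?_ (by simpa using h3.norm)
    filter_upwards [eventually_ge_atTop 0] with x hx
    rw [norm_mul]
    refine mul_le_of_le_one_left (norm_nonneg _) ?_
    rw [norm_exp_I_mul]
    exact Real.exp_le_one_iff.2 (by nlinarith)
  have h3 := tendsto_nhds_unique h1 ((h2.sub_const _).congr fun R => hp.2 0 R)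
  rw [integral_const_mul] at h3
  simp only [ofReal_zero, mul_zero, exp_zero, one_mul] at h3
  rw [jostA, jostA, jostB, jostB]
  linear_combination h3

/-- `W(ψ₊(·, 0), ψ₊(·, k)) = ik (1 + o(1))` as `k → 0` in the closed upper half-plane. -/
lemma tendsto_jost_green_zero (hq : ShortRange q) :
    Tendsto (fun k => (jostB q k * jostA q 0 - jostA q k * jostB q 0) / (I * k))
      (𝓝[{k : ℂ | 0 < k.im}] 0) (𝓝 1) := by
  have h0 : (0 : ℝ) ≤ (0 : ℂ).im := by simp
  set l := 𝓝[{k : ℂ | 0 < k.im}] (0 : ℂ)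
  have hle : l ≤ 𝓝[{k : ℂ | 0 ≤ k.im}] 0 :=
    nhdsWithin_mono _ fun k (hk : 0 < k.im) => hk.le
  have hmem : ∀ᶠ k in l, 0 < k.im := self_mem_nhdsWithin
  have hint : Tendsto (fun k : ℂ => ∫ x : ℝ in Set.Ioi 0, exp (I * k * x) * (faddeevDeriv q k x *
      faddeev q 0 x + faddeev q k x * faddeevDeriv q 0 x)) l
      (𝓝 (∫ x : ℝ in Set.Ioi 0, exp (I * 0 * x) * (faddeevDeriv q 0 x *
      faddeev q 0 x + faddeev q 0 x * faddeevDeriv q 0 x))) := by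
    refine tendsto_integral_filter_of_dominated_convergence
      (fun x => 2 * Real.exp (moment q 0 0) ^ 2 * ∫ y in Set.Ioi x, |q y|) ?_ ?_
      ((integrableOn_tail hq).const_mul _) ?_
    · filter_upwards [hmem] with k hk
      exact (integrableOn_deriv_prod hq hk.le).aestronglyMeasurable
    · filter_upwards [hmem] with k hk
      filter_upwards [ae_restrict_mem measurableSet_Ioi] with x hx
      exact norm_deriv_prod_le hq hk.le (Set.mem_Ioi.1 hx).le
    · refine ae_of_all _ fun x => ?_
      have c1 : Tendsto (fun k => faddeev q k x) l (𝓝 (faddeev q 0 x)) :=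
        (continuousOn_faddeev hq x 0 h0).tendsto.mono_left hle
      have c2 : Tendsto (fun k => faddeevDeriv q k x) l (𝓝 (faddeevDeriv q 0 x)) :=
        (continuousOn_faddeevDeriv hq x 0 h0).tendsto.mono_left hle
      have c3 : Tendsto (fun k : ℂ => exp (I * k * x)) l (𝓝 (exp (I * 0 * x))) :=
        ((by fun_prop : Continuous fun k : ℂ => exp (I * k * x)).tendsto 0).mono_left
          nhdsWithin_le_nhds
      exact c3.mul ((c2.mul_const _).add (c1.mul_const _))
  have hval : (∫ x : ℝ in Set.Ioi 0, exp (I * 0 * x) * (faddeevDeriv q 0 x *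
      faddeev q 0 x + faddeev q 0 x * faddeevDeriv q 0 x))
      = 1 - faddeev q 0 0 * faddeev q 0 0 := by
    have hlim : Tendsto (fun x => faddeev q 0 x * faddeev q 0 x) atTop (𝓝 1) := by
      simpa using (tendsto_faddeev hq h0).mul (tendsto_faddeev hq h0)
    refine integral_Ioi_of_hasDerivAt_of_tendsto
      (f := fun x => faddeev q 0 x * faddeev q 0 x)
      ((continuous_faddeev hq h0).mul (continuous_faddeev hq h0)).continuousWithinAt
      (fun x _ => ?_) (integrableOn_deriv_prod hq h0) hlim
    refine ((hasDerivAt_faddeev hq h0 x).mul (hasDerivAt_faddeev hq h0 x)).congr_deriv ?_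
    simp
  have c1 : Tendsto (fun k => faddeev q k 0) l (𝓝 (faddeev q 0 0)) :=
    (continuousOn_faddeev hq 0 0 h0).tendsto.mono_left hle
  have h := (c1.mul_const (faddeev q 0 0)).add hint
  rw [hval, add_sub_cancel] at h
  refine h.congr' ?_
  filter_upwards [hmem] with k hk
  have hk0 : k ≠ 0 := fun h => by rw [h] at hk; simp at hk
  rw [jost_green_zero hq hk.le]
  have : I * k ≠ 0 := mul_ne_zero I_ne_zero hk0
  field_simp

/-- At most one of the Cauchy data of a Jost solution vanishes. -/
lemma jostA_ne_zero_or (hq : ShortRange q) (hk : 0 ≤ k.im) : jostA q k ≠ 0 ∨ jostB q k ≠ 0 := by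
  by_contra! h
  obtain ⟨x, hx⟩ := jost_ne_zero hq hk
  exact hx ((isSol_jost hq hk).eq_zero hq (a := 0) (by rw [jost_zero, h.1])
    (by rw [jostDeriv_zero, h.2]) x)

/-- The linear functionals of the Cauchy data used as charts can be chosen nonzero. -/
lemma exists_chart_ne_zero (hq : ShortRange q) (hk : 0 ≤ k.im) :
    ∃ α β : ℂ, α * jostA q k + β * jostB q k ≠ 0 := by
  rcases jostA_ne_zero_or hq hk with h | h
  · exact ⟨1, 0, by simpa using h⟩
  · exact ⟨0, 1, by simpa using h⟩

/-- The Wronskian vanishes at most to first order at `k = 0`. -/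
lemma exists_wron_lower_bound (hq : ShortRange q) :
    ∃ c > 0, ∀ᶠ k in 𝓝[{k : ℂ | 0 < k.im}] 0, c * ‖k‖ ≤ ‖wron q k‖ := by
  have h0 : (0 : ℝ) ≤ (0 : ℂ).im := by simp
  set l := 𝓝[{k : ℂ | 0 < k.im}] (0 : ℂ) with hl
  have hle : l ≤ 𝓝[{k : ℂ | 0 ≤ k.im}] 0 :=
    nhdsWithin_mono _ fun k (hk : 0 < k.im) => hk.le
  have hmem : ∀ᶠ k in l, 0 < k.im := self_mem_nhdsWithin
  have hW : Tendsto (wron q) l (𝓝 (wron q 0)) :=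
    (continuousOn_wron hq 0 h0).tendsto.mono_left hle
  by_cases hw : wron q 0 = 0
  · obtain ⟨μ, hμ, hprop, hA, hB⟩ := exists_proportional hq h0 hw
    have hreal : ∀ {q : ℝ → ℝ}, ShortRange q → ∀ x,
        (starRingEnd ℂ) (jost q 0 x) = jost q 0 x := fun hq x => by
      simpa using conj_jost hq (le_refl (0 : ℝ)) x
    -- `μ` is real because the Jost solutions at `k = 0` are
    have hμr : (starRingEnd ℂ) μ = μ := by
      obtain ⟨x, hx⟩ := jost_ne_zero hq h0
      have h1 := congrArg (starRingEnd ℂ) (hprop x)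
      rw [map_mul, hreal hq, hreal hq.reflect, hprop x] at h1
      exact (mul_right_cancel₀ hx h1).symm
    obtain ⟨m, rfl⟩ := conj_eq_iff_real.1 hμr
    obtain ⟨α, β, hc⟩ := exists_chart_ne_zero hq h0
    set c := α * jostA q 0 + β * jostB q 0 with hcdef
    have tA : Tendsto (jostA q) l (𝓝 (jostA q 0)) :=
      (continuousOn_jostA hq 0 h0).tendsto.mono_left hle
    have tB : Tendsto (jostB q) l (𝓝 (jostB q 0)) :=
      (continuousOn_jostB hq 0 h0).tendsto.mono_left hle
    have tA' : Tendsto (jostA (reflect q)) l (𝓝 (jostA (reflect q) 0)) :=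
      (continuousOn_jostA hq.reflect 0 h0).tendsto.mono_left hle
    have tB' : Tendsto (jostB (reflect q)) l (𝓝 (jostB (reflect q) 0)) :=
      (continuousOn_jostB hq.reflect 0 h0).tendsto.mono_left hle
    -- `W(k) / (ik)` tends to `μ + 1 / μ`, which is not zero for real `μ`
    have t := ((tendsto_jost_green_zero hq).mul ((tA'.const_mul α).sub (tB'.const_mul β))).add
      (((tendsto_jost_green_zero hq.reflect).div_const (m : ℂ)).mul
        ((tA.const_mul α).add (tB.const_mul β)))
    have t' := t.div_const c
    have hval : (1 * (α * jostA (reflect q) 0 - β * jostB (reflect q) 0)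
        + 1 / (m : ℂ) * (α * jostA q 0 + β * jostB q 0)) / c = m + 1 / m := by
      rw [hA, hB, ← hcdef, show α * (m * jostA q 0) - β * -(m * jostB q 0) = m * c by
        rw [hcdef]; ring]
      field_simp
    rw [hval] at t'
    have hm0 : m ≠ 0 := by exact_mod_cast hμ
    have hne : (m : ℂ) + 1 / m ≠ 0 := by
      have : m + 1 / m ≠ 0 := by
        have h2 : 0 < m * m := mul_self_pos.2 hm0
        intro h
        field_simp at h
        nlinarith
      exact_mod_cast this
    have hpos : 0 < ‖(m : ℂ) + 1 / m‖ := norm_pos_iff.2 hne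
    refine ⟨‖(m : ℂ) + 1 / m‖ / 2, by positivity, ?_⟩
    filter_upwards [hmem, t'.norm.eventually (lt_mem_nhds (half_lt_self hpos))] with k hk hk2
    have hk0 : k ≠ 0 := fun h => by rw [h] at hk; simp at hk
    have hIk : I * k ≠ 0 := mul_ne_zero I_ne_zero hk0
    have e : ((jostB q k * jostA q 0 - jostA q k * jostB q 0) / (I * k)
          * (α * jostA (reflect q) k - β * jostB (reflect q) k)
        + (jostB (reflect q) k * jostA (reflect q) 0 - jostA (reflect q) k * jostB (reflect q) 0)
          / (I * k) / m * (α * jostA q k + β * jostB q k)) / c = wron q k / (I * k) := by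
      rw [wron]
      have h3 := wron_expand (A := jostA q k) (B := jostB q k) (A' := jostA (reflect q) k)
        (B' := jostB (reflect q) k) (α := α) (β := β) hμ hA hB
      rw [← hcdef] at h3
      rw [div_eq_div_iff hc hIk, mul_comm _ c, h3]
      field_simp
    rw [e, norm_div, norm_mul, norm_I, one_mul] at hk2
    have hkp : 0 < ‖k‖ := norm_pos_iff.2 hk0
    rw [lt_div_iff₀ hkp] at hk2
    exact hk2.le
  · have hpos : 0 < ‖wron q 0‖ := norm_pos_iff.2 hw
    refine ⟨‖wron q 0‖ / 2, by positivity, ?_⟩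
    have h1 : ∀ᶠ k : ℂ in l, ‖k‖ < 1 := by
      refine nhdsWithin_le_nhds ?_
      filter_upwards [Metric.ball_mem_nhds (0 : ℂ) one_pos] with k hk using by simpa using hk
    filter_upwards [h1, hW.norm.eventually (lt_mem_nhds (half_lt_self hpos))] with k hk hk2
    nlinarith [norm_nonneg k]

/-- There are finitely many bound states: zeros of the Wronskian stay away from `0` and `∞`, and do
not accumulate in between. -/
lemma boundStates_finite (hq : ShortRange q) : (boundStates q).Finite := by
  obtain ⟨C, hC0, hC⟩ := exists_wron_bound hq
  obtain ⟨c, hc, hlow⟩ := exists_wron_lower_bound hq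
  rw [eventually_nhdsWithin_iff, Metric.eventually_nhds_iff] at hlow
  obtain ⟨ε, hε, hlow⟩ := hlow
  by_contra hinf
  set S : Set ℂ := (fun κ : ℝ => I * (κ : ℂ)) '' boundStates q with hS
  have hinj : Function.Injective fun κ : ℝ => I * (κ : ℂ) := fun a b h => by
    simpa using h
  have hSinf : S.Infinite := (Set.Infinite.image hinj.injOn hinf)
  set K : Set ℂ := (fun κ : ℝ => I * (κ : ℂ)) '' Set.Icc ε C with hK
  have hKc : IsCompact K := isCompact_Icc.image (by fun_prop)
  have hSK : S ⊆ K := by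
    rintro _ ⟨κ, hκ, rfl⟩
    obtain ⟨hκ0, hw⟩ := (mem_boundStates_iff hq).1 hκ
    have him : (0 : ℝ) < (I * (κ : ℂ)).im := by rwa [I_mul_im]
    have hn : ‖I * (κ : ℂ)‖ = κ := by simp [abs_of_pos hκ0]
    refine ⟨κ, ⟨?_, ?_⟩, rfl⟩
    · by_contra hlt
      have h1 := hlow (y := I * κ) (by rw [dist_zero_right, hn]; exact not_le.1 hlt) him
      rw [hw, norm_zero, hn] at h1
      nlinarith
    · have h1 := hC (I * κ) him.le
      rw [hw, zero_sub, norm_neg, mul_assoc, norm_mul, norm_mul, norm_I, hn, Complex.norm_ofNat] at h1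
      linarith
  obtain ⟨p, hpK, hacc⟩ := hSinf.exists_accPt_of_subset_isCompact hKc hSK
  have hp : 0 < p.im := by
    obtain ⟨κ, hκ, rfl⟩ := hpK
    show 0 < (I * (κ : ℂ)).im
    rw [I_mul_im]; exact hε.trans_le hκ.1
  have hfreq : ∃ᶠ z in 𝓝[≠] p, wron q z = 0 := by
    refine (accPt_iff_frequently_nhdsNE.1 hacc).mono fun z hz => ?_
    obtain ⟨κ, hκ, rfl⟩ := hz
    exact ((mem_boundStates_iff hq).1 hκ).2
  have han : AnalyticOnNhd ℂ (wron q) {k | 0 < k.im} :=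
    (differentiableOn_wron hq).analyticOnNhd isOpen_upper
  have hz := han.eqOn_zero_of_preconnected_of_frequently_eq_zero
    (convex_halfSpace_im_gt 0).isPreconnected hp hfreq
  -- the Wronskian would vanish identically, against its behaviour at high energy
  have hbig : (0 : ℝ) < (I * ((C + 1 : ℝ) : ℂ)).im := by rw [I_mul_im]; linarith
  have h1 := hC _ hbig.le
  have h2 : wron q (I * ((C + 1 : ℝ) : ℂ)) = 0 := hz hbig
  rw [h2, zero_sub, norm_neg, mul_assoc, norm_mul, norm_mul, norm_mul, norm_I, Complex.norm_ofNat,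
    Complex.norm_real, Real.norm_of_nonneg (by linarith)] at h1
  linarith

end BoundStates

/-! ### Half-line potentials -/

section HalfLine

variable {q : ℝ → ℝ} {k : ℂ}

lemma ShortRange.posPart (hq : ShortRange q) : ShortRange (posPart q) := by
  have h := Integrable.indicator hq (measurableSet_Ioi (a := (0 : ℝ)))
  refine h.congr (ae_of_all _ fun x => ?_)
  by_cases hx : x ∈ Set.Ioi (0 : ℝ) <;> simp [SepInf.posPart, hx]

lemma ShortRange.negPart (hq : ShortRange q) : ShortRange (negPart q) := by
  have h := Integrable.indicator hq (measurableSet_Iio (a := (0 : ℝ)))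
  refine h.congr (ae_of_all _ fun x => ?_)
  by_cases hx : x ∈ Set.Iio (0 : ℝ) <;> simp [SepInf.negPart, hx]

lemma reflect_negPart (q : ℝ → ℝ) : reflect (negPart q) = posPart (reflect q) := by
  funext x
  simp only [reflect, negPart, posPart, Set.indicator, Set.mem_Iio, Set.mem_Ioi, Left.neg_neg_iff]

lemma jost_data_posPart (q : ℝ → ℝ) (k : ℂ) :
    jostA (posPart q) k = jostA q k ∧ jostB (posPart q) k = jostB q k := by
  obtain ⟨h1, h2⟩ := faddeev_congr (q := posPart q) (q' := q) (x₀ := 0)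
    (fun y hy => by simp [posPart, hy]) k le_rfl
  exact ⟨h1, by rw [jostB, jostB, h1, h2]⟩

lemma jost_data_reflect_posPart (q : ℝ → ℝ) (hk : 0 ≤ k.im) :
    jostA (reflect (posPart q)) k = 1 ∧ jostB (reflect (posPart q)) k = I * k := by
  obtain ⟨h1, h2⟩ := faddeev_congr (q := reflect (posPart q)) (q' := fun _ => 0) (x₀ := 0)
    (fun y hy => by simp [posPart, reflect, hy.le]) k le_rfl
  have h0 : ShortRange fun _ => 0 := by simp [ShortRange]
  have h3 : faddeev (fun _ => 0) k 0 = 1 := by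
    rw [faddeev_eq h0 hk]; simp [volterra]
  have h4 : faddeevDeriv (fun _ => 0) k 0 = 0 := by simp [faddeevDeriv, volterraDeriv]
  constructor
  · rw [jostA, h1, h3]
  · rw [jostB, h1, h2, h3, h4]; ring

lemma wron_posPart (q : ℝ → ℝ) (hk : 0 ≤ k.im) :
    wron (posPart q) k = jostB q k + I * k * jostA q k := by
  obtain ⟨h1, h2⟩ := jost_data_reflect_posPart q hk
  obtain ⟨h3, h4⟩ := jost_data_posPart q k
  rw [wron, h1, h2, h3, h4]; ring

lemma wron_negPart (q : ℝ → ℝ) (hk : 0 ≤ k.im) :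
    wron (negPart q) k = jostB (reflect q) k + I * k * jostA (reflect q) k := by
  rw [← wron_reflect, reflect_negPart, wron_posPart _ hk]

/-- Left of the support of the potential the right Jost solution is a combination of plane waves. -/
lemma jost_posPart_of_nonpos (hq : ShortRange q) (hk : 0 ≤ k.im) {x : ℝ} (hx : x ≤ 0) :
    2 * I * k * jost (posPart q) k x = (jostB q k + I * k * jostA q k) * exp (I * k * x)
      - (jostB q k - I * k * jostA q k) * exp (-(I * k * x)) := by
  have hs := isSol_jost hq.posPart hk
  have hvan : ∀ y ∈ Set.uIoc x 0, posPart q y = 0 := by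
    intro y hy
    rw [Set.uIoc_of_le hx] at hy
    simp [posPart, hy.2]
  obtain ⟨h3, h4⟩ := jost_data_posPart q k
  have key : ∀ c : ℂ, c ^ 2 = -k ^ 2 →
      exp (c * x) * (jostDeriv (posPart q) k x - c * jost (posPart q) k x)
        = jostB q k - c * jostA q k := by
    intro c hc
    have hp : IsPrim (fun x : ℝ => exp (c * x) *
        (jostDeriv (posPart q) k x - c * jost (posPart q) k x))
        (fun x : ℝ => exp (c * x) * (posPart q x * jost (posPart q) k x)) := by
      refine ((isPrim_exp_mul c).mul (hs.prim.sub (hs.prim₀.const_mul c))).congr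
        (ae_of_all _ fun x => ?_)
      linear_combination (-exp (c * x) * jost (posPart q) k x) * hc
    have h := hp.eq_of_density_zero (a := x) (b := 0) fun y hy => by simp [hvan y hy]
    simp only [ofReal_zero, mul_zero, exp_zero, one_mul] at h
    rw [← h, jost_zero, jostDeriv_zero, h3, h4]
  have k1 := key (I * k) (by rw [mul_pow, I_sq]; ring)
  have k2 := key (-(I * k)) (by rw [neg_sq, mul_pow, I_sq]; ring)
  have e := exp_neg_mul_exp (I * k * x)
  rw [neg_mul] at k2
  set E := exp (I * k * x)
  set E' := exp (-(I * k * x))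
  linear_combination (-E') * k1 + E * k2 - (2 * I * k * jost (posPart q) k x) * e

end HalfLine

/-! ### Transmission and reflection coefficients -/

section Scattering

variable {q : ℝ → ℝ} {k : ℂ}

/-- Matching of plane waves on a half-line determines the scattering coefficients. -/
lemma plane_wave_matching (hk : 0 < k.im) {ψ : ℝ → ℂ} {a b : ℂ} (ha : a ≠ 0)
    (hψ : ∀ x : ℝ, x ≤ 0 → 2 * I * k * ψ x = a * exp (I * k * x) - b * exp (-(I * k * x)))
    (p : ℂ × ℂ) :
    (∀ x : ℝ, x ≤ 0 → p.1 * ψ x = exp (I * k * x) + p.2 * exp (-(I * k * x)))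
      ↔ p = (2 * I * k / a, -b / a) := by
  have hk0 : k ≠ 0 := fun h => by rw [h] at hk; simp at hk
  have hIk : 2 * I * k ≠ 0 := by simp [hk0]
  constructor
  · intro h
    -- compare the points `0` and `-1`
    have h1 := h 0 le_rfl
    have h2 := h (-1) (by norm_num)
    have g1 := hψ 0 le_rfl
    have g2 := hψ (-1) (by norm_num)
    simp only [ofReal_zero, mul_zero, neg_zero, exp_zero, mul_one] at h1 g1
    have e := exp_neg_mul_exp (I * k * ((-1 : ℝ) : ℂ))
    set E := exp (I * k * ((-1 : ℝ) : ℂ)) with hE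
    set E' := exp (-(I * k * ((-1 : ℝ) : ℂ))) with hE'
    have hne : E ^ 2 - 1 ≠ 0 := by
      intro h0
      have h3 : ‖E ^ 2‖ = 1 := by rw [sub_eq_zero.1 h0, norm_one]
      rw [norm_pow, hE, norm_exp_I_mul, mul_neg_one, neg_neg] at h3
      have h4 : 1 < Real.exp k.im := Real.one_lt_exp_iff.2 hk
      nlinarith
    have hkey : (p.1 * a - 2 * I * k) * (E ^ 2 - 1) = 0 := by
      linear_combination (2 * I * k) * (E * h2 - h1) + p.1 * (g1 - E * g2)
        + (2 * I * k * p.2 + p.1 * b) * e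
    have hT : p.1 * a = 2 * I * k := sub_eq_zero.1 ((mul_eq_zero.1 hkey).resolve_right hne)
    have hT' : p.1 = 2 * I * k / a := by rw [← hT]; field_simp
    have hR : p.2 = -b / a := by
      have h5 : 2 * I * k * (p.2 * a + b) = 0 := by
        linear_combination (-(2 * I * k * a)) * h1 + a * p.1 * g1 + (a - b) * hT
      have h6 := (mul_eq_zero.1 h5).resolve_left hIk
      rw [eq_div_iff ha]; linear_combination h6
    exact Prod.ext hT' hR
  · rintro rfl x hx
    have g := hψ x hx
    have e : ψ x = (a * exp (I * k * x) - b * exp (-(I * k * x))) / (2 * I * k) := by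
      rw [← g]; field_simp
    simp only [e]
    field_simp
    ring

lemma epsilon_eq_of_iff {α : Type*} [Nonempty α] {P : α → Prop} {a : α} (h : ∀ p, P p ↔ p = a) :
    Classical.epsilon P = a :=
  (h _).1 (Classical.epsilon_spec ⟨a, (h a).2 rfl⟩)

lemma leftScatteringOfPos_eq (hq : ShortRange q) (hk : 0 < k.im) (hW : wron (posPart q) k ≠ 0) :
    leftScatteringOfPos (posPart q) k = (2 * I * k / wron (posPart q) k,
      -(jostB q k - I * k * jostA q k) / wron (posPart q) k) := by
  refine epsilon_eq_of_iff fun p => ?_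
  rw [jostRight_eq hq.posPart hk.le]
  refine plane_wave_matching hk hW (fun x hx => ?_) p
  rw [wron_posPart q hk.le]
  exact jost_posPart_of_nonpos hq hk.le hx

lemma rightScatteringOfNeg_eq (hq : ShortRange q) (hk : 0 < k.im) (hW : wron (negPart q) k ≠ 0) :
    rightScatteringOfNeg (negPart q) k = (2 * I * k / wron (negPart q) k,
      -(jostB (reflect q) k - I * k * jostA (reflect q) k) / wron (negPart q) k) := by
  refine epsilon_eq_of_iff fun p => ?_
  rw [jostLeft_eq hq.negPart hk.le, reflect_negPart]
  have h := plane_wave_matching hk hW (ψ := jost (posPart (reflect q)) k) (fun x hx => by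
    rw [wron_negPart q hk.le]
    exact jost_posPart_of_nonpos hq.reflect hk.le hx) p
  rw [← h]
  constructor
  · intro H x hx
    have := H (-x) (neg_nonneg.2 hx)
    simpa using this
  · intro H x hx
    have := H (-x) (neg_nonpos.2 hx)
    simpa using this

/-- The explicit form `2ik (ik ψ₋(0) + ψ₋'(0)) / (W₊ W)` of `G`. -/
def Gfun (q : ℝ → ℝ) (k : ℂ) : ℂ :=
  2 * I * k * (I * k * jostA (reflect q) k - jostB (reflect q) k)
    / (wron (posPart q) k * wron q k)

lemma G_eq_Gfun (hq : ShortRange q) (hk : 0 < k.im) (hp : wron (posPart q) k ≠ 0)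
    (hm : wron (negPart q) k ≠ 0) (hw : wron q k ≠ 0) : G q k = Gfun q k := by
  have hk0 : k ≠ 0 := fun h => by rw [h] at hk; simp at hk
  simp only [G, leftScatteringOfPos_eq hq hk hp, rightScatteringOfNeg_eq hq hk hm]
  have e : 1 - -(jostB q k - I * k * jostA q k) / wron (posPart q) k *
      (-(jostB (reflect q) k - I * k * jostA (reflect q) k) / wron (negPart q) k)
      = 2 * I * k * wron q k / (wron (posPart q) k * wron (negPart q) k) := by
    field_simp
    rw [wron_posPart q hk.le, wron_negPart q hk.le, wron]
    ring
  rw [e, Gfun]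
  have h1 : (I : ℂ) ≠ 0 := I_ne_zero
  field_simp
  ring

/-- In terms of the charts, `G` is the difference of the two reflection coefficients. -/
lemma Gfun_eq_chart_sub (hk : 0 ≤ k.im) {α β : ℂ}
    (hc : α * jostA q k + β * jostB q k ≠ 0) (hp : wron (posPart q) k ≠ 0) (hw : wron q k ≠ 0) :
    Gfun q k = chart q α β k - chart (posPart q) α β k := by
  obtain ⟨h1, h2⟩ := jost_data_reflect_posPart q hk
  obtain ⟨h3, h4⟩ := jost_data_posPart q k
  have hWp := wron_posPart q hk
  rw [Gfun, chart, chart, h1, h2, h3, h4, mul_one]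
  field_simp
  rw [hWp, wron]
  ring

/-! ### The real line -/

/-- The Wronskian of `conj ψ₊` and `ψ₊` on the real line. -/
lemma conj_jost_wronskian (hq : ShortRange q) (k : ℝ) :
    (starRingEnd ℂ) (jostA q k) * jostB q k - jostA q k * (starRingEnd ℂ) (jostB q k)
      = 2 * I * k := by
  have hk : 0 ≤ (k : ℂ).im := by simp
  have hs := isSol_jost hq hk
  have hsc := hs.conj
  rw [conj_ofReal] at hsc
  have hlim : Tendsto (fun x => (starRingEnd ℂ) (jost q k x) * jostDeriv q k x
      - (starRingEnd ℂ) (jostDeriv q k x) * jost q k x) atTop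
      (𝓝 ((starRingEnd ℂ) 1 * (I * k * 1 + 0) - (starRingEnd ℂ) (I * k * 1 + 0) * 1)) := by
    have t1 := tendsto_faddeev hq hk
    have t2 := tendsto_faddeevDeriv hq hk
    have t3 := (t1.const_mul (I * k)).add t2
    refine Tendsto.congr (fun x => ?_)
      ((((continuous_conj.tendsto _).comp t1).mul t3).sub
        (((continuous_conj.tendsto _).comp t3).mul t1))
    have e : (starRingEnd ℂ) (exp (I * k * x)) * exp (I * k * x) = 1 := by
      rw [← exp_conj, ← exp_add]
      simp
    simp only [Function.comp_apply, jost, jostDeriv, map_mul (starRingEnd ℂ) (exp _)]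
    linear_combination (-((starRingEnd ℂ) (faddeev q k x) * (I * k * faddeev q k x
      + faddeevDeriv q k x) - (starRingEnd ℂ) (I * k * faddeev q k x
      + faddeevDeriv q k x) * faddeev q k x)) * e
  have h0 := tendsto_nhds_unique
    (tendsto_const_nhds.congr fun x => hsc.wronskian_const hs 0 x) hlim
  rw [jost_zero, jostDeriv_zero] at h0
  simp at h0
  linear_combination h0

/-- `|W|² = 4k² + |V|²` for real `k`, the conservation law behind `|T|² + |R|² = 1`. -/
lemma norm_sq_wron_real (hq : ShortRange q) (k : ℝ) :
    ‖wron q k‖ ^ 2 = 4 * k ^ 2 + ‖(starRingEnd ℂ) (jostA q k) * jostB (reflect q) k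
      + (starRingEnd ℂ) (jostB q k) * jostA (reflect q) k‖ ^ 2 := by
  have h1 := conj_jost_wronskian hq k
  have h2 := conj_jost_wronskian hq.reflect k
  set A := jostA q k
  set B := jostB q k
  set A' := jostA (reflect q) k
  set B' := jostB (reflect q) k
  set V := (starRingEnd ℂ) A * B' + (starRingEnd ℂ) B * A' with hV
  have h3 : wron q k * (starRingEnd ℂ) (wron q k) = 4 * (k : ℂ) ^ 2 + V * (starRingEnd ℂ) V := by
    have hw : wron q k = B * A' + A * B' := rfl
    rw [hw, hV]
    simp only [map_add, map_mul, conj_conj]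
    linear_combination (-((starRingEnd ℂ) A' * B' - A' * (starRingEnd ℂ) B')) * h1
      - (2 * I * k) * h2 - 4 * (k : ℂ) ^ 2 * I_sq
  rw [mul_conj, mul_conj, normSq_eq_norm_sq, normSq_eq_norm_sq] at h3
  exact_mod_cast h3

lemma wron_real_ne_zero (hq : ShortRange q) {k : ℝ} (hk : k ≠ 0) : wron q k ≠ 0 := by
  intro h
  have h1 := norm_sq_wron_real hq k
  rw [h, norm_zero] at h1
  have : 0 < k ^ 2 := by positivity
  nlinarith [sq_nonneg ‖(starRingEnd ℂ) (jostA q k) * jostB (reflect q) k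
      + (starRingEnd ℂ) (jostB q k) * jostA (reflect q) k‖]

/-- The explicit form of the right reflection coefficient on the real line. -/
def Rfun (q : ℝ → ℝ) (k : ℝ) : ℂ :=
  -((starRingEnd ℂ) (jostA q k) * jostB (reflect q) k
      + (starRingEnd ℂ) (jostB q k) * jostA (reflect q) k) / wron q k

lemma norm_Rfun_le (hq : ShortRange q) (k : ℝ) : ‖Rfun q k‖ ≤ 1 := by
  rw [Rfun, norm_div, norm_neg]
  refine div_le_one_of_le₀ ?_ (norm_nonneg _)
  have h1 := norm_sq_wron_real hq k
  refine le_of_sq_le_sq ?_ (norm_nonneg _)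
  nlinarith [sq_nonneg k]

lemma rightReflection_eq (hq : ShortRange q) {k : ℝ} (hk : k ≠ 0) :
    rightReflection q k = Rfun q k := by
  have hk0 : 0 ≤ (k : ℂ).im := by simp
  have hw := wron_real_ne_zero hq hk
  have hs := isSol_jost hq hk0
  have hsc := hs.conj
  rw [conj_ofReal] at hsc
  have hsl := isSol_jostLeft hq hk0
  have h1 := conj_jost_wronskian hq k
  have key : rightScattering q k = (2 * I * k / wron q k, Rfun q k) := by
    refine epsilon_eq_of_iff fun p => ?_
    rw [jostRight_eq hq hk0, jostLeft_eq hq hk0]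
    have hcomb := (hsl.const_mul p.1).sub (hsc.add (hs.const_mul p.2))
    have hv : wron q k = jostB q k * jostA (reflect q) k + jostA q k * jostB (reflect q) k := rfl
    constructor
    · intro h
      have hz : ∀ x, p.1 * jost (reflect q) k (-x) - ((starRingEnd ℂ) (jost q k x)
          + p.2 * jost q k x) = 0 := fun x => sub_eq_zero.2 (h x)
      have e1 := hz 0
      have e2 := hcomb.deriv_eq_zero hz 0
      simp only [neg_zero, jost_zero, jostDeriv_zero] at e1 e2
      refine Prod.ext ?_ ?_
      · rw [eq_div_iff hw, hv]
        linear_combination jostB q k * e1 - jostA q k * e2 + h1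
      · rw [Rfun, eq_div_iff hw, hv]
        linear_combination (-jostB (reflect q) k) * e1 - jostA (reflect q) k * e2
    · rintro rfl x
      refine sub_eq_zero.1 (hcomb.eq_zero hq (a := 0) ?_ ?_ x)
      · simp only [neg_zero, jost_zero, Rfun]
        field_simp
        rw [hv]
        linear_combination (-jostA (reflect q) k) * h1
      · simp only [neg_zero, jostDeriv_zero, Rfun]
        field_simp
        rw [hv]
        linear_combination (jostB (reflect q) k) * h1
  rw [rightReflection, key]

/-- On the real line `R - R₊ = G`: the common Cauchy data of `ψ₊` at the origin enter the difference
only through the Wronskian of `conj ψ₊` and `ψ₊`. -/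
lemma Rfun_sub (hq : ShortRange q) {k : ℝ} (hk : k ≠ 0) :
    Rfun q k - Rfun (posPart q) k = Gfun q k := by
  have hk0 : 0 ≤ (k : ℂ).im := by simp
  have hw := wron_real_ne_zero hq hk
  have hp := wron_real_ne_zero hq.posPart hk
  have h1 := conj_jost_wronskian hq k
  obtain ⟨a1, a2⟩ := jost_data_reflect_posPart q hk0
  obtain ⟨a3, a4⟩ := jost_data_posPart q k
  have hWp := wron_posPart q hk0
  rw [Rfun, Rfun, Gfun, a1, a2, a3, a4, div_sub_div _ _ hw hp, mul_comm (wron (posPart q) k)]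
  congr 1
  rw [hWp, wron]
  linear_combination (I * k * jostA (reflect q) k - jostB (reflect q) k) * h1

lemma continuousOn_Rfun (hq : ShortRange q) : ContinuousOn (Rfun q) {k | k ≠ 0} := by
  have hc : ∀ {f : ℂ → ℂ}, ContinuousOn f {k | 0 ≤ k.im} → Continuous fun k : ℝ => f k :=
    fun hf => hf.comp_continuous continuous_ofReal fun k => by simp
  refine ContinuousOn.div ?_ (hc (continuousOn_wron hq)).continuousOn
    fun k hk => wron_real_ne_zero hq hk
  have c1 := hc (continuousOn_jostA hq)
  have c2 := hc (continuousOn_jostB hq)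
  have c3 := hc (continuousOn_jostA hq.reflect)
  have c4 := hc (continuousOn_jostB hq.reflect)
  exact (((continuous_conj.comp c1).mul c4).add ((continuous_conj.comp c2).mul c3)).neg.continuousOn

end Scattering

/-! ### Integrals along horizontal lines -/

section Lines

lemma continuous_line {M : ℂ → ℂ} {s : Set ℝ} (hM : ContinuousOn M {z | z.im ∈ s}) {y : ℝ}
    (hy : y ∈ s) : Continuous fun u : ℝ => M (u + I * y) :=
  hM.comp_continuous (by fun_prop) fun u => by simpa using hy

lemma integrable_line {M : ℂ → ℂ} {s : Set ℝ} (hM : ContinuousOn M {z | z.im ∈ s}) {y : ℝ}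
    (hy : y ∈ s) {C : ℝ≥0∞} (hC : C ≠ ∞) (hb : ∫⁻ u : ℝ, ‖M (u + I * y)‖ₑ ≤ C) :
    Integrable fun u : ℝ => M (u + I * y) :=
  ⟨(continuous_line hM hy).aestronglyMeasurable, hb.trans_lt hC.lt_top⟩

/-- Cauchy's theorem on a horizontal strip, for a function that is uniformly integrable along
the horizontal lines: the integrals along the two edges agree. -/
lemma integral_line_eq {M : ℂ → ℂ} {a b : ℝ} (hab : a ≤ b)
    (hM : DifferentiableOn ℂ M {z | z.im ∈ Set.Icc a b}) {C : ℝ≥0∞} (hC : C ≠ ∞)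
    (hb : ∀ y ∈ Set.Icc a b, ∫⁻ u : ℝ, ‖M (u + I * y)‖ₑ ≤ C) :
    ∫ u : ℝ, M (u + I * a) = ∫ u : ℝ, M (u + I * b) := by
  have hMc := hM.continuousOn
  have ia := integrable_line hMc (Set.left_mem_Icc.2 hab) hC (hb a (Set.left_mem_Icc.2 hab))
  have ib := integrable_line hMc (Set.right_mem_Icc.2 hab) hC (hb b (Set.right_mem_Icc.2 hab))
  set D : ℝ → ℂ := fun R => (∫ u in (-R)..R, M (u + I * a)) - ∫ u in (-R)..R, M (u + I * b)
    with hD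
  set S : ℝ → ℝ≥0∞ := fun R => ∫⁻ y in Set.Icc a b, ‖M (R + I * y)‖ₑ with hS
  -- the two vertical sides of the rectangle control the difference of the horizontal ones
  have hDS : ∀ R : ℝ, ‖D R‖ₑ ≤ S R + S (-R) := by
    intro R
    have hrect := integral_boundary_rect_eq_zero_of_differentiableOn M
      ((-R : ℝ) + I * a) ((R : ℝ) + I * b) (hM.mono ?_)
    · have e : D R = I • (∫ y in a..b, M ((-R : ℝ) + I * y)) - I • ∫ y in a..b, M (R + I * y) := by
        simp only [add_re, ofReal_re, mul_re, I_re, zero_mul, I_im, ofReal_im, mul_zero, sub_zero,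
          add_zero, add_im, mul_im, one_mul, zero_add, mul_comm _ I] at hrect
        rw [hD]
        linear_combination hrect
      have hside : ∀ r : ℝ, ‖I • ∫ y in a..b, M ((r : ℝ) + I * y)‖ₑ ≤ S r := by
        intro r
        rw [enorm_smul, show ‖I‖ₑ = 1 by simp [enorm, nnnorm], one_mul,
          intervalIntegral.integral_of_le hab]
        refine (enorm_integral_le_lintegral_enorm _).trans ?_
        exact lintegral_mono_set Set.Ioc_subset_Icc_self
      rw [e, add_comm]
      exact (enorm_sub_le).trans (add_le_add (hside _) (hside _))
    · intro z hz
      have := hz.2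
      simpa [Set.uIcc_of_le hab] using this
  have hjoint : AEMeasurable (fun p : ℝ × ℝ => ‖M (p.1 + I * p.2)‖ₑ)
      (volume.prod (volume.restrict (Set.Icc a b))) := by
    have h1 : ContinuousOn (fun p : ℝ × ℝ => M (p.1 + I * p.2)) (Set.univ ×ˢ Set.Icc a b) :=
      hMc.comp (by fun_prop) fun p hp => by simpa using hp.2
    have h2 := h1.aestronglyMeasurable (μ := volume.prod volume)
      (MeasurableSet.univ.prod measurableSet_Icc)
    rw [← Measure.prod_restrict, Measure.restrict_univ] at h2
    exact h2.enorm
  have hSm : ∫⁻ R, S R ≤ C * ENNReal.ofReal (b - a) := by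
    rw [lintegral_lintegral_swap hjoint]
    calc ∫⁻ y in Set.Icc a b, ∫⁻ R : ℝ, ‖M (R + I * y)‖ₑ ≤ ∫⁻ _ in Set.Icc a b, C :=
          setLIntegral_mono measurable_const hb
      _ = C * ENNReal.ofReal (b - a) := by simp
  -- `S` is integrable, so the vertical sides are small along some sequence of rectangles
  have hlim : Tendsto D atTop (𝓝 ((∫ u : ℝ, M (u + I * a)) - ∫ u : ℝ, M (u + I * b))) :=
    (intervalIntegral_tendsto_integral ia tendsto_neg_atTop_atBot tendsto_id).sub
      (intervalIntegral_tendsto_integral ib tendsto_neg_atTop_atBot tendsto_id)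
  by_contra hne
  have hpos : 0 < ‖(∫ u : ℝ, M (u + I * a)) - ∫ u : ℝ, M (u + I * b)‖ₑ :=
    enorm_pos.2 (sub_ne_zero.2 hne)
  obtain ⟨c, hc0, hc1⟩ := exists_between hpos
  obtain ⟨R₀, hR₀⟩ := eventually_atTop.1 (hlim.enorm.eventually_const_lt hc1)
  have h1 : ∫⁻ _ in Set.Ioi R₀, c ≤ ∫⁻ R, (S R + S (-R)) :=
    (setLIntegral_mono' measurableSet_Ioi fun R hR =>
      (hR₀ R (Set.mem_Ioi.1 hR).le).le.trans (hDS R)).trans (setLIntegral_le_lintegral _ _)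
  have h2 : ∫⁻ R, (S R + S (-R)) = (∫⁻ R, S R) + ∫⁻ R, S R := by
    rw [lintegral_add_left' hjoint.lintegral_prod_right', lintegral_neg_eq_self S]
  have h3 : (∫⁻ R, S R) + ∫⁻ R, S R ≠ ∞ := by
    have : ∫⁻ R, S R ≠ ∞ :=
      (hSm.trans_lt (ENNReal.mul_lt_top hC.lt_top ENNReal.ofReal_lt_top)).ne
    exact ENNReal.add_ne_top.2 ⟨this, this⟩
  refine h3 (top_le_iff.1 (le_trans (le_of_eq ?_) (h1.trans h2.le)))
  simp [hc0.ne']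

lemma norm_exp_I_mul_line (α u y : ℝ) : ‖exp (I * α * (u + I * y))‖ = Real.exp (-(α * y)) := by
  rw [norm_exp]
  congr 1
  simp

/-- A function on a closed half-plane that is uniformly integrable along the horizontal lines
has vanishing integral along the edge. -/
lemma integral_line_eq_zero {M : ℂ → ℂ} {a : ℝ}
    (hM : DifferentiableOn ℂ M {z | z.im ∈ Set.Ici a}) {C : ℝ≥0∞} (hC : C ≠ ∞)
    (hb : ∀ y ∈ Set.Ici a, ∫⁻ u : ℝ, ‖M (u + I * y)‖ₑ ≤ C) :
    ∫ u : ℝ, M (u + I * a) = 0 := by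
  have ia := integrable_line hM.continuousOn Set.self_mem_Ici hC (hb a Set.self_mem_Ici)
  -- the damping factor `exp (iαz)` makes the integral along a high line small
  have hz : ∀ α : ℝ, 0 < α → ∫ u : ℝ, exp (I * α * (u + I * a)) * M (u + I * a) = 0 := by
    intro α hα
    set N : ℂ → ℂ := fun z => exp (I * α * z) * M z with hN
    have hNe : ∀ u y : ℝ, ‖N (u + I * y)‖ₑ
        = ENNReal.ofReal (Real.exp (-(α * y))) * ‖M (u + I * y)‖ₑ := by
      intro u y
      rw [hN, enorm_mul, ← ofReal_norm (exp _), norm_exp_I_mul_line]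
    have hNb : ∀ y ∈ Set.Ici a, ∫⁻ u : ℝ, ‖N (u + I * y)‖ₑ
        ≤ ENNReal.ofReal (Real.exp (-(α * y))) * C := by
      intro y hy
      simp_rw [hNe]
      rw [lintegral_const_mul' _ _ ENNReal.ofReal_ne_top]
      gcongr
      exact hb y hy
    have hlim : Tendsto (fun y : ℝ => ENNReal.ofReal (Real.exp (-(α * y))) * C) atTop (𝓝 0) := by
      have h1 : Tendsto (fun y : ℝ => Real.exp (-(α * y))) atTop (𝓝 0) :=
        Real.tendsto_exp_neg_atTop_nhds_zero.comp (tendsto_id.const_mul_atTop hα)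
      have h2 := ENNReal.Tendsto.mul_const (b := C) (ENNReal.tendsto_ofReal h1) (Or.inr hC)
      simpa using h2
    have hle : ∀ b ≥ a, ‖∫ u : ℝ, N (u + I * a)‖ₑ ≤ ENNReal.ofReal (Real.exp (-(α * b))) * C := by
      intro b hab
      rw [integral_line_eq hab (M := N) (C := ENNReal.ofReal (Real.exp (-(α * a))) * C)]
      · exact (enorm_integral_le_lintegral_enorm _).trans (hNb b hab)
      · exact ((by fun_prop : Differentiable ℂ fun z => exp (I * α * z)).differentiableOn).mul
          (hM.mono fun z hz => hz.1)
      · exact ENNReal.mul_ne_top ENNReal.ofReal_ne_top hC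
      · intro y hy
        refine (hNb y hy.1).trans ?_
        gcongr
        exact hy.1
    have h0 := ge_of_tendsto hlim (eventually_atTop.2 ⟨a, hle⟩)
    exact enorm_eq_zero.1 (le_antisymm h0 bot_le)
  have hlim : Tendsto (fun α : ℝ => ∫ u : ℝ, exp (I * α * (u + I * a)) * M (u + I * a)) (𝓝[>] 0)
      (𝓝 (∫ u : ℝ, M (u + I * a))) := by
    refine tendsto_integral_filter_of_dominated_convergence
      (fun u => Real.exp |a| * ‖M (u + I * a)‖) ?_ ?_ (ia.norm.const_mul _) ?_
    · exact Eventually.of_forall fun α =>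
        (by fun_prop : Continuous fun u : ℝ => exp (I * α * (u + I * a))).aestronglyMeasurable.mul
          ia.aestronglyMeasurable
    · filter_upwards [Ioo_mem_nhdsGT (one_pos)] with α hα
      refine ae_of_all _ fun u => ?_
      rw [norm_mul, norm_exp_I_mul_line]
      gcongr
      calc -(α * a) ≤ |α * a| := neg_le_abs _
        _ = α * |a| := by rw [abs_mul, abs_of_pos hα.1]
        _ ≤ 1 * |a| := by gcongr; exact hα.2.le
        _ = |a| := one_mul _
    · refine ae_of_all _ fun u => ?_
      have hc : Continuous fun α : ℝ => exp (I * α * (u + I * a)) * M (u + I * a) := by fun_prop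
      have := (hc.tendsto 0).mono_left (nhdsWithin_le_nhds (s := Set.Ioi 0))
      simpa using this
  refine tendsto_nhds_unique hlim (tendsto_const_nhds.congr' ?_)
  filter_upwards [self_mem_nhdsWithin] with α hα using (hz α hα).symm

end Lines

/-! ### Hankel operators with analytic symbol -/

section HankelVanishing

/-- A bounded sequence in `L²` that converges almost everywhere converges weakly. -/
lemma tendsto_integral_mul_of_tendsto_ae {F : ℕ → ℝ → ℂ} {f φ : ℝ → ℂ} {C : ℝ≥0∞} (hC : C ≠ ∞)
    (hF : ∀ n, AEStronglyMeasurable (F n)) (hFC : ∀ n, eLpNorm (F n) 2 volume ≤ C)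
    (hf : MemLp f 2) (hφ : MemLp φ 2)
    (hlim : ∀ᵐ u, Tendsto (fun n => F n u) atTop (𝓝 (f u))) :
    Tendsto (fun n => ∫ u, F n u * φ u) atTop (𝓝 (∫ u, f u * φ u)) := by
  have hF2 : ∀ n, MemLp (F n) 2 := fun n => ⟨hF n, (hFC n).trans_lt hC.lt_top⟩
  have hint : ∀ n, MemLp (fun u => F n u * φ u) 1 := fun n => (hφ.mul (hF2 n))
  -- the mass of `F n * φ` on a set is controlled by the mass of `φ` there
  have hind : ∀ n (s : Set ℝ), MeasurableSet s → eLpNorm (s.indicator fun u => F n u * φ u) 1 volume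
      ≤ C * eLpNorm (s.indicator φ) 2 volume := by
    intro n s hs
    have e : (s.indicator fun u => F n u * φ u) = F n • s.indicator φ := by
      funext u
      by_cases hu : u ∈ s <;> simp [hu]
    rw [e]
    refine (eLpNorm_smul_le_mul_eLpNorm (p := 2) (q := 2) (hφ.1.indicator hs) (hF n)).trans ?_
    gcongr
    exact hFC n
  have hdiv : ∀ ε : ℝ, 0 < ε → ∃ ε' : ℝ, 0 < ε' ∧ C * ENNReal.ofReal ε' ≤ ENNReal.ofReal ε := by
    intro ε hε
    refine ⟨ε / (C.toReal + 1), by positivity, ?_⟩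
    rw [← ENNReal.ofReal_toReal hC, ← ENNReal.ofReal_mul ENNReal.toReal_nonneg]
    refine ENNReal.ofReal_le_ofReal ?_
    rw [ENNReal.toReal_ofReal ENNReal.toReal_nonneg, ← mul_div_assoc, div_le_iff₀ (by positivity)]
    nlinarith [ENNReal.toReal_nonneg (a := C)]
  have hui : UnifIntegrable (fun n u => F n u * φ u) 1 volume := by
    intro ε hε
    obtain ⟨ε', hε', hle⟩ := hdiv ε hε
    obtain ⟨δ, hδ, h⟩ := hφ.eLpNorm_indicator_le one_le_two (by simp) hε'
    refine ⟨δ, hδ, fun n s hs hsδ => (hind n s hs).trans (le_trans ?_ hle)⟩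
    gcongr
    exact h s hs hsδ
  have hut : UnifTight (fun n u => F n u * φ u) 1 volume := by
    intro ε hε
    obtain ⟨ε', hε', hle⟩ := hdiv ε (by exact_mod_cast hε)
    obtain ⟨s, hs, hsf, h⟩ := hφ.exists_eLpNorm_indicator_compl_lt (by simp)
      (ENNReal.ofReal_pos.2 hε').ne'
    refine ⟨s, hsf.ne, fun n => (hind n _ hs.compl).trans (le_trans ?_ (hle.trans ?_))⟩
    · gcongr
    · simp
  have h1 := tendsto_Lp_of_tendsto_ae le_rfl ENNReal.one_ne_top
    (fun n => (hint n).1) (hφ.mul hf) hui hut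
    (by filter_upwards [hlim] with u hu using hu.mul_const _)
  refine tendsto_integral_of_L1 _ (memLp_one_iff_integrable.1 (hφ.mul hf)).1
    (Eventually.of_forall fun n => memLp_one_iff_integrable.1 (hint n)) ?_
  simpa [eLpNorm_one_eq_lintegral_enorm] using h1

lemma eLpNorm_two_line {F : ℂ → ℂ} {s y : ℝ} {C : ℝ≥0∞}
    (h : ∫⁻ u : ℝ, ‖F (u + I * (s * y : ℝ))‖ₑ ^ 2 ≤ C) :
    eLpNorm (fun u : ℝ => F (u + I * (s * y : ℝ))) 2 volume ≤ C ^ (1 / 2 : ℝ) := by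
  rw [eLpNorm_eq_lintegral_rpow_enorm_toReal two_ne_zero ENNReal.ofNat_ne_top]
  simp only [ENNReal.toReal_ofNat, ENNReal.rpow_ofNat]
  gcongr

/-- A function of the Hardy class of the upper half-plane converges weakly in `L²` to its
boundary value, here along the heights `1 / (n + 1)`. -/
lemma IsHardy.tendsto_integral_mul {F : ℂ → ℂ} (hF : IsHardy 1 F) {f φ : ℝ → ℂ}
    (hb : HasBoundaryValue 1 F f) (hf : MemLp f 2) (hφ : MemLp φ 2) :
    Tendsto (fun n : ℕ => ∫ u : ℝ, F (u + I * (1 / ((n : ℝ) + 1) : ℝ)) * φ u) atTop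
      (𝓝 (∫ u, f u * φ u)) := by
  obtain ⟨C, hC, hFC⟩ := hF.2
  have hpos : ∀ n : ℕ, 0 < 1 / ((n : ℝ) + 1) := fun n => Nat.one_div_pos_of_nat
  refine tendsto_integral_mul_of_tendsto_ae (C := C ^ (1 / 2 : ℝ))
    (ENNReal.rpow_ne_top_of_nonneg (by norm_num) hC) (fun n => ?_) (fun n => ?_) hf hφ ?_
  · exact (continuous_line (s := Set.Ioi 0) (hF.1.continuousOn.mono fun z hz => by simpa using hz)
      (hpos n)).aestronglyMeasurable
  · simpa only [one_mul] using eLpNorm_two_line (s := 1) (hFC _ (hpos n))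
  · filter_upwards [hb] with u hu
    have := hu.comp (tendsto_nhdsWithin_iff.2
      ⟨tendsto_one_div_add_atTop_nhds_zero_nat (𝕜 := ℝ), Eventually.of_forall hpos⟩)
    simpa only [one_mul, Function.comp_def] using this

/-- The function `g` is the boundary value almost everywhere, along vertical lines, of a bounded
holomorphic function on the upper half-plane. -/
def IsBoundedBoundaryValue (g : ℝ → ℂ) : Prop :=
  ∃ K : ℂ → ℂ, DifferentiableOn ℂ K {z | 0 < z.im} ∧ (∃ B : ℝ, ∀ z, 0 < z.im → ‖K z‖ ≤ B) ∧
    ∀ᵐ u : ℝ, Tendsto (fun y : ℝ => K (u + I * y)) (𝓝[>] 0) (𝓝 (g u))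

/-- The product of a bounded analytic function and two functions of the Hardy class has vanishing
integral. -/
lemma integral_mul_hardy_eq_zero {g f k : ℝ → ℂ} (hg : IsBoundedBoundaryValue g)
    (hgm : MemLp g ∞) {F K : ℂ → ℂ} (hF : IsHardy 1 F) (hK : IsHardy 1 K)
    (hFf : HasBoundaryValue 1 F f) (hKk : HasBoundaryValue 1 K k) (hf : MemLp f 2)
    (hk : MemLp k 2) : ∫ u, g u * f u * k u = 0 := by
  obtain ⟨Γ, hΓ, ⟨B, hB⟩, hΓg⟩ := hg
  obtain ⟨C₁, hC₁, hb₁⟩ := hF.2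
  obtain ⟨C₂, hC₂, hb₂⟩ := hK.2
  have hC₁' : C₁ ^ (1 / 2 : ℝ) ≠ ∞ := ENNReal.rpow_ne_top_of_nonneg (by norm_num) hC₁
  have hC₂' : C₂ ^ (1 / 2 : ℝ) ≠ ∞ := ENNReal.rpow_ne_top_of_nonneg (by norm_num) hC₂
  set e : ℕ → ℝ := fun n => 1 / ((n : ℝ) + 1) with he
  have hpos : ∀ n : ℕ, 0 < e n := fun n => Nat.one_div_pos_of_nat
  have he0 : Tendsto e atTop (𝓝[>] 0) := tendsto_nhdsWithin_iff.2
      ⟨tendsto_one_div_add_atTop_nhds_zero_nat (𝕜 := ℝ), Eventually.of_forall hpos⟩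
  have hline : ∀ {M : ℂ → ℂ} {y : ℝ}, DifferentiableOn ℂ M {z | 0 < z.im} → 0 < y →
      AEStronglyMeasurable fun u : ℝ => M (u + I * y) := fun hM hy =>
    (continuous_line (s := Set.Ioi 0) hM.continuousOn hy).aestronglyMeasurable
  have hF1 : DifferentiableOn ℂ F {z | 0 < z.im} := by simpa only [one_mul] using hF.1
  have hK1 : DifferentiableOn ℂ K {z | 0 < z.im} := by simpa only [one_mul] using hK.1
  have hFm : ∀ {y : ℝ}, 0 < y → eLpNorm (fun u : ℝ => F (u + I * y)) 2 volume ≤ C₁ ^ (1 / 2 : ℝ) :=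
    fun {y} hy => by simpa only [one_mul] using eLpNorm_two_line (s := 1) (hb₁ y hy)
  have hKm : ∀ {y : ℝ}, 0 < y → eLpNorm (fun u : ℝ => K (u + I * y)) 2 volume ≤ C₂ ^ (1 / 2 : ℝ) :=
    fun {y} hy => by simpa only [one_mul] using eLpNorm_two_line (s := 1) (hb₂ y hy)
  have hKl : ∀ n, MemLp (fun u : ℝ => K (u + I * e n)) 2 := fun n =>
    ⟨hline hK1 (hpos n), (hKm (hpos n)).trans_lt hC₂'.lt_top⟩
  have hFl : ∀ n, MemLp (fun u : ℝ => F (u + I * e n)) 2 := fun n =>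
    ⟨hline hF1 (hpos n), (hFm (hpos n)).trans_lt hC₁'.lt_top⟩
  -- at positive heights all three functions are analytic across the line of integration
  have h0 : ∀ l m n : ℕ,
      ∫ u : ℝ, Γ (u + I * e l) * (F (u + I * e m) * K (u + I * e n)) = 0 := by
    intro l m n
    have := integral_line_eq_zero (a := 0)
      (M := fun z => Γ (z + I * e l) * (F (z + I * e m) * K (z + I * e n)))
      (C := ENNReal.ofReal B * (C₁ ^ (1 / 2 : ℝ) * C₂ ^ (1 / 2 : ℝ))) ?_ ?_ ?_
    · simpa using this
    · have hs : ∀ {M : ℂ → ℂ} (j : ℕ), DifferentiableOn ℂ M {z | 0 < z.im} →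
          DifferentiableOn ℂ (fun z => M (z + I * e j)) {z | z.im ∈ Set.Ici (0 : ℝ)} := by
        intro M j hM
        refine hM.comp (by fun_prop) fun z hz => ?_
        have h1 : 0 ≤ z.im := hz
        simpa using add_pos_of_nonneg_of_pos h1 (hpos j)
      exact (hs l hΓ).mul ((hs m hF1).mul (hs n hK1))
    · exact ENNReal.mul_ne_top ENNReal.ofReal_ne_top (ENNReal.mul_ne_top hC₁' hC₂')
    · intro y hy
      have hy0 : 0 ≤ y := hy
      have hr : ∀ (u : ℝ) (j : ℕ), (u : ℂ) + I * y + I * e j = u + I * (y + e j : ℝ) := by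
        intro u j; push_cast; ring
      have hp : ∀ j, 0 < y + e j := fun j => add_pos_of_nonneg_of_pos hy0 (hpos j)
      simp_rw [hr]
      calc ∫⁻ u : ℝ, ‖Γ (u + I * (y + e l : ℝ)) *
            (F (u + I * (y + e m : ℝ)) * K (u + I * (y + e n : ℝ)))‖ₑ
          ≤ ∫⁻ u : ℝ, ENNReal.ofReal B *
            ‖F (u + I * (y + e m : ℝ)) * K (u + I * (y + e n : ℝ))‖ₑ := by
            refine lintegral_mono fun u => ?_
            rw [enorm_mul (Γ _)]
            gcongr
            rw [← ofReal_norm]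
            exact ENNReal.ofReal_le_ofReal (hB _ (by simpa using hp l))
        _ = ENNReal.ofReal B * eLpNorm ((fun u : ℝ => F (u + I * (y + e m : ℝ))) •
            fun u : ℝ => K (u + I * (y + e n : ℝ))) 1 volume := by
            rw [lintegral_const_mul' _ _ ENNReal.ofReal_ne_top, eLpNorm_one_eq_lintegral_enorm]
            rfl
        _ ≤ _ := by
            gcongr
            refine (eLpNorm_smul_le_mul_eLpNorm (p := 2) (q := 2) (hline hK1 (hp n))
              (hline hF1 (hp m))).trans ?_
            gcongr
            · exact hFm (hp m)
            · exact hKm (hp n)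
  have hFK : ∀ m n, Integrable fun u : ℝ => F (u + I * e m) * K (u + I * e n) := fun m n =>
    memLp_one_iff_integrable.1 ((hKl n).mul (hFl m))
  -- the heights tend to zero one after the other: first by dominated convergence, and then twice by
  -- weak convergence against a fixed function of `L²`
  have h1 : ∀ m n : ℕ, ∫ u : ℝ, g u * (F (u + I * e m) * K (u + I * e n)) = 0 := by
    intro m n
    have hlim : Tendsto (fun l : ℕ =>
        ∫ u : ℝ, Γ (u + I * e l) * (F (u + I * e m) * K (u + I * e n))) atTop
        (𝓝 (∫ u : ℝ, g u * (F (u + I * e m) * K (u + I * e n)))) := by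
      refine tendsto_integral_of_dominated_convergence
        (fun u => B * ‖F (u + I * e m) * K (u + I * e n)‖) (fun l => ?_)
        ((hFK m n).norm.const_mul _) (fun l => ae_of_all _ fun u => ?_) ?_
      · exact (hline hΓ (hpos l)).mul (hFK m n).1
      · rw [norm_mul]
        gcongr
        exact hB _ (by simpa using hpos l)
      · filter_upwards [hΓg] with u hu
        exact (hu.comp he0).mul_const _
    exact tendsto_nhds_unique hlim (by simp only [h0]; exact tendsto_const_nhds)
  have h2 : ∀ n : ℕ, ∫ u : ℝ, f u * (K (u + I * e n) * g u) = 0 := by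
    intro n
    have hlim := hF.tendsto_integral_mul hFf hf (φ := fun u : ℝ => K (u + I * e n) * g u)
      (hgm.mul (hKl n))
    refine tendsto_nhds_unique hlim ?_
    refine tendsto_const_nhds.congr fun m => ?_
    rw [← h1 m n]
    congr 1; ext u; ring
  have hlim := hK.tendsto_integral_mul hKk hk (φ := fun u : ℝ => f u * g u) (hgm.mul hf)
  have h3 : ∫ u, k u * (f u * g u) = 0 := by
    refine tendsto_nhds_unique hlim (tendsto_const_nhds.congr fun n => ?_)
    rw [← h2 n]
    congr 1; ext u; ring
  rw [← h3]
  congr 1; ext u; ring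

lemma IsHardy.conj_conj {F : ℂ → ℂ} (hF : IsHardy (-1) F) :
    IsHardy 1 fun z => (starRingEnd ℂ) (F ((starRingEnd ℂ) z)) := by
  refine ⟨fun z hz => ?_, ?_⟩
  · have hz' : (starRingEnd ℂ) z ∈ {z : ℂ | 0 < -1 * z.im} := by simpa using hz
    have hopen : IsOpen {z : ℂ | 0 < -1 * z.im} :=
      isOpen_lt continuous_const (by fun_prop)
    have := ((hF.1 _ hz').differentiableAt (hopen.mem_nhds hz')).conj_conj
    rw [Complex.conj_conj] at this
    exact this.differentiableWithinAt
  · obtain ⟨C, hC, hb⟩ := hF.2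
    refine ⟨C, hC, fun y hy => le_trans (le_of_eq ?_) (hb y hy)⟩
    congr 1
    ext u
    rw [← ofReal_norm, ← ofReal_norm, RCLike.norm_conj]
    simp

lemma HasBoundaryValue.conj_conj {F : ℂ → ℂ} {f : ℝ → ℂ} (hF : HasBoundaryValue (-1) F f) :
    HasBoundaryValue 1 (fun z => (starRingEnd ℂ) (F ((starRingEnd ℂ) z)))
      fun u => (starRingEnd ℂ) (f u) := by
  filter_upwards [hF] with u hu
  have := (continuous_conj.tendsto _).comp hu
  simpa [Function.comp_def] using this

lemma coeFn_mulOp (φ : Lp ℂ ∞ (volume : Measure ℝ)) (f : L2) :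
    mulOp φ f =ᵐ[volume] fun u => φ u * f u :=
  (ContinuousLinearMap.mul ℂ ℂ).coeFn_holder φ f

/-- Multiplication by a bounded analytic symbol maps `H²₊` into the orthogonal complement
of `H²₋`. -/
lemma mulOp_mem_orthogonal {g : Lp ℂ ∞ (volume : Measure ℝ)} (hg : IsBoundedBoundaryValue g)
    {f : L2} (hf : f ∈ hardyPlus) : mulOp g f ∈ hardyMinusᗮ := by
  have hcore : ∀ f ∈ hardyBoundary 1 one_ne_zero,
      ∀ k ∈ hardyBoundary (-1) (neg_ne_zero.2 one_ne_zero), inner ℂ k (mulOp g f) = 0 := by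
    rintro f ⟨F, hF, hFf⟩ k ⟨K, hK, hKk⟩
    rw [L2.inner_def, ← integral_mul_hardy_eq_zero hg (Lp.memLp g) hF hK.conj_conj hFf
      hKk.conj_conj (Lp.memLp f) (Lp.memLp k).star]
    refine integral_congr_ae ?_
    filter_upwards [coeFn_mulOp g f] with u hu
    rw [hu]
    simp [RCLike.inner_apply]
  have h1 : ∀ k ∈ hardyBoundary (-1) (neg_ne_zero.2 one_ne_zero),
      inner ℂ k (mulOp g f) = 0 := by
    intro k hk
    have hcl : IsClosed {f : L2 | inner ℂ k (mulOp g f) = 0} :=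
      isClosed_eq (by fun_prop) continuous_const
    exact closure_minimal (fun f hf => hcore f hf k hk) hcl hf
  rw [Submodule.mem_orthogonal]
  intro k hk
  have hcl : IsClosed {k : L2 | inner ℂ k (mulOp g f) = 0} :=
    isClosed_eq (by fun_prop) continuous_const
  exact closure_minimal (fun k hk => h1 k hk) hcl hk

/-- A Hankel operator does not see bounded analytic summands of its symbol. -/
lemma hankel_eq_zero {g : Lp ℂ ∞ (volume : Measure ℝ)} (hg : IsBoundedBoundaryValue g) :
    hankel g = 0 := by
  ext1 f
  apply Subtype.ext
  have h : rieszMinus (mulOp g f) = 0 :=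
    (Submodule.starProjection_apply_eq_zero_iff _).2 (mulOp_mem_orthogonal hg f.2)
  change reflection (rieszMinus (mulOp g f)) = 0
  rw [h, map_zero]

lemma hankel_add (φ ψ : Lp ℂ ∞ (volume : Measure ℝ)) :
    hankel (φ + ψ) = hankel φ + hankel ψ := by
  ext1 f
  apply Subtype.ext
  simp [hankel, mulOp]

end HankelVanishing

/-! ### Cauchy integrals along horizontal lines -/

section CauchyLine

lemma integrable_inv_sq_add_sq (x : ℝ) {d : ℝ} (hd : 0 < d) :
    Integrable fun u : ℝ => ((u - x) ^ 2 + d ^ 2)⁻¹ := by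
  have h := ((integrable_inv_one_add_sq.comp_div hd.ne').comp_sub_right x).const_mul (d ^ 2)⁻¹
  refine h.congr (ae_of_all _ fun u => ?_)
  simp only
  rw [← mul_inv]
  congr 1
  field_simp
  ring

lemma integral_inv_sq_add_sq (x : ℝ) {d : ℝ} (hd : 0 < d) :
    ∫ u : ℝ, ((u - x) ^ 2 + d ^ 2)⁻¹ = Real.pi / d := by
  have e : (fun u : ℝ => ((u - x) ^ 2 + d ^ 2)⁻¹)
      = fun u : ℝ => (d ^ 2)⁻¹ * (1 + ((u - x) / d) ^ 2)⁻¹ := by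
    funext u
    rw [← mul_inv]
    congr 1
    field_simp
    ring
  rw [e, integral_const_mul, integral_sub_right_eq_self (fun u : ℝ => (1 + (u / d) ^ 2)⁻¹) x,
    Measure.integral_comp_div (fun u : ℝ => (1 + u ^ 2)⁻¹) d, integral_univ_inv_one_add_sq,
    abs_of_pos hd, smul_eq_mul]
  field_simp

lemma normSq_line_sub (u y : ℝ) (k : ℂ) :
    ‖(u : ℂ) + I * y - k‖ ^ 2 = (u - k.re) ^ 2 + (y - k.im) ^ 2 := by
  rw [← normSq_eq_norm_sq, normSq_apply]
  simp
  ring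

/-- The Cauchy integral of a function `g` on the horizontal line through `iy`. -/
def cauchyLine (g : ℝ → ℂ) (y : ℝ) (k : ℂ) : ℂ := ∫ u : ℝ, g u / (u + I * y - k)

variable {g : ℝ → ℂ} {C y : ℝ}

lemma cauchyLine_bound (hg : Continuous g) (hC : ∀ u, ‖g u‖ ≤ C / (1 + |u|)) {k : ℂ} {d : ℝ}
    (hd : 0 < d) (hk : d ≤ |y - k.im|) :
    Integrable (fun u : ℝ => g u / (u + I * y - k)) ∧
      ‖cauchyLine g y k‖ ≤ C ^ 2 * Real.pi + Real.pi / d := by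
  have hne : ∀ u : ℝ, (u : ℂ) + I * y - k ≠ 0 := by
    intro u h0
    have h1 := normSq_line_sub u y k
    rw [h0] at h1
    have h2 : 0 < |y - k.im| := hd.trans_le hk
    have h3 := sq_abs (y - k.im)
    simp at h1
    nlinarith [sq_nonneg (u - k.re), pow_pos h2 2]
  have hbi : Integrable fun u : ℝ => C ^ 2 * (1 + u ^ 2)⁻¹ + ((u - k.re) ^ 2 + d ^ 2)⁻¹ :=
    (integrable_inv_one_add_sq.const_mul _).add (integrable_inv_sq_add_sq _ hd)
  -- the inequality between the means, each factor being square integrable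
  have hb : ∀ u : ℝ, ‖g u / (u + I * y - k)‖
      ≤ C ^ 2 * (1 + u ^ 2)⁻¹ + ((u - k.re) ^ 2 + d ^ 2)⁻¹ := by
    intro u
    have h1 : ‖g u‖ ^ 2 ≤ C ^ 2 * (1 + u ^ 2)⁻¹ := by
      calc ‖g u‖ ^ 2 ≤ (C / (1 + |u|)) ^ 2 := by gcongr; exact hC u
        _ = C ^ 2 * ((1 + |u|) ^ 2)⁻¹ := by rw [div_pow, div_eq_mul_inv]
        _ ≤ C ^ 2 * (1 + u ^ 2)⁻¹ := by
            gcongr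
            nlinarith [abs_nonneg u, sq_abs u]
    have h2 : (‖(u : ℂ) + I * y - k‖⁻¹) ^ 2 ≤ ((u - k.re) ^ 2 + d ^ 2)⁻¹ := by
      rw [inv_pow, normSq_line_sub]
      gcongr 1
      rw [← sq_abs (y - k.im)]
      gcongr
    rw [norm_div, div_eq_mul_inv]
    nlinarith [sq_nonneg (‖g u‖ - ‖(u : ℂ) + I * y - k‖⁻¹), sq_nonneg ‖g u‖,
      sq_nonneg (‖(u : ℂ) + I * y - k‖⁻¹)]
  have hm : Continuous fun u : ℝ => g u / (u + I * y - k) := hg.div (by fun_prop) hne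
  refine ⟨hbi.mono' hm.aestronglyMeasurable (ae_of_all _ hb), ?_⟩
  refine (norm_integral_le_of_norm_le hbi (ae_of_all _ hb)).trans (le_of_eq ?_)
  rw [integral_add (integrable_inv_one_add_sq.const_mul _) (integrable_inv_sq_add_sq _ hd),
    integral_const_mul, integral_univ_inv_one_add_sq, integral_inv_sq_add_sq _ hd]

lemma differentiableAt_cauchyLine (hg : Continuous g) (hC : ∀ u, ‖g u‖ ≤ C / (1 + |u|)) {k : ℂ}
    (hk : k.im ≠ y) : DifferentiableAt ℂ (cauchyLine g y) k := by
  have hpos : 0 < |y - k.im| := abs_pos.2 (sub_ne_zero.2 (Ne.symm hk))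
  set d := |y - k.im| / 2 with hd
  have hd0 : 0 < d := by positivity
  set R := ‖k‖ + 1 with hR
  set U : Set ℂ := {z | ‖z‖ < R ∧ d < |y - z.im|} with hU
  have hUo : IsOpen U := IsOpen.and (isOpen_lt continuous_norm continuous_const)
    (isOpen_lt continuous_const (continuous_const.sub continuous_im).abs)
  have hkU : k ∈ U := ⟨by simp [hR], by rw [hd]; linarith⟩
  have hC0 : 0 ≤ C := by simpa using (norm_nonneg _).trans (hC 0)
  have hlow : ∀ z ∈ U, ∀ u : ℝ, d / (1 + R + d) * (1 + |u|) ≤ ‖(u : ℂ) + I * y - z‖ := by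
    intro z hz u
    have h1 : d ≤ ‖(u : ℂ) + I * y - z‖ := by
      have := abs_im_le_norm ((u : ℂ) + I * y - z)
      simp at this
      exact hz.2.le.trans this
    have h2 : |u| ≤ ‖(u : ℂ) + I * y - z‖ + R := by
      have h3 := abs_re_le_norm ((u : ℂ) + I * y - z)
      have h4 := abs_re_le_norm z
      simp at h3
      have h5 : |u| ≤ |u - z.re| + |z.re| := by simpa using abs_add_le (u - z.re) z.re
      linarith [hz.1]
    have hR0 : 0 < R := by positivity
    rw [div_mul_eq_mul_div, div_le_iff₀ (by positivity)]
    nlinarith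
  have hc0 : 0 < d / (1 + R + d) := by positivity
  have hne : ∀ z ∈ U, ∀ u : ℝ, (u : ℂ) + I * y - z ≠ 0 := fun z hz u =>
    norm_pos_iff.1 (lt_of_lt_of_le (by positivity) (hlow z hz u))
  have hD : DifferentiableOn ℂ (cauchyLine g y) U := by
    refine differentiableOn_integral_of_dominated
      (b := fun u => C * (d / (1 + R + d))⁻¹ * (1 + u ^ 2)⁻¹) hUo (fun z hz => ?_)
      (ae_of_all _ fun u => ?_) (ae_of_all _ fun u z hz => ?_)
      (integrable_inv_one_add_sq.const_mul _)
    · exact (hg.div (by fun_prop) (hne z hz)).aestronglyMeasurable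
    · exact (differentiableOn_const _).div (by fun_prop) fun z hz => hne z hz u
    · have h1 := hlow z hz u
      rw [norm_div]
      calc ‖g u‖ / ‖(u : ℂ) + I * y - z‖
          ≤ C / (1 + |u|) / (d / (1 + R + d) * (1 + |u|)) := by
            gcongr
            exact hC u
        _ = C * (d / (1 + R + d))⁻¹ * ((1 + |u|) ^ 2)⁻¹ := by
            rw [div_div, div_eq_mul_inv, mul_assoc, ← mul_inv]
            congr 2
            ring
        _ ≤ C * (d / (1 + R + d))⁻¹ * (1 + u ^ 2)⁻¹ := by
            gcongr
            nlinarith [abs_nonneg u, sq_abs u]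
  exact (hD k hkU).differentiableAt (hUo.mem_nhds hkU)

lemma lintegral_inv_mul_inv_le {w k : ℂ} {b y : ℝ} (hw : w.im < b) (hk : k.im < b) (hy : b ≤ y) :
    ∫⁻ u : ℝ, ‖((u : ℂ) + I * y - w)⁻¹ * ((u : ℂ) + I * y - k)⁻¹‖ₑ
      ≤ ENNReal.ofReal (Real.pi / (b - w.im) + Real.pi / (b - k.im)) := by
  have h1 := integrable_inv_sq_add_sq w.re (sub_pos.2 hw)
  have h2 := integrable_inv_sq_add_sq k.re (sub_pos.2 hk)
  rw [← integral_inv_sq_add_sq w.re (sub_pos.2 hw), ← integral_inv_sq_add_sq k.re (sub_pos.2 hk),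
    ← integral_add h1 h2, ofReal_integral_eq_lintegral_ofReal (f := fun u =>
      ((u - w.re) ^ 2 + (b - w.im) ^ 2)⁻¹ + ((u - k.re) ^ 2 + (b - k.im) ^ 2)⁻¹) (h1.add h2)
      (ae_of_all _ fun u => by simp only [Pi.zero_apply]; positivity)]
  refine lintegral_mono fun u => ?_
  rw [← ofReal_norm]
  refine ENNReal.ofReal_le_ofReal ?_
  have key : ∀ {p : ℂ}, p.im < b →
      (‖(u : ℂ) + I * y - p‖⁻¹) ^ 2 ≤ ((u - p.re) ^ 2 + (b - p.im) ^ 2)⁻¹ := by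
    intro p hp
    have := sub_pos.2 hp
    rw [inv_pow, normSq_line_sub]
    gcongr
  have k1 := key hw
  have k2 := key hk
  rw [norm_mul, norm_inv, norm_inv]
  nlinarith [sq_nonneg (‖(u : ℂ) + I * y - w‖⁻¹ - ‖(u : ℂ) + I * y - k‖⁻¹),
    sq_nonneg (‖(u : ℂ) + I * y - w‖⁻¹), sq_nonneg (‖(u : ℂ) + I * y - k‖⁻¹)]

/-- The Cauchy integral of `1 / (λ - w)` over a horizontal line above both poles vanishes. -/
lemma integral_inv_mul_inv_eq_zero {w k : ℂ} {b : ℝ} (hw : w.im < b) (hk : k.im < b) :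
    Integrable (fun u : ℝ => ((u : ℂ) + I * b - w)⁻¹ * ((u : ℂ) + I * b - k)⁻¹) ∧
      ∫ u : ℝ, ((u : ℂ) + I * b - w)⁻¹ * ((u : ℂ) + I * b - k)⁻¹ = 0 := by
  have hne : ∀ {p z : ℂ}, p.im < b → z.im ∈ Set.Ici b → z - p ≠ 0 := by
    intro p z hp hz h0
    have hz' : b ≤ z.im := hz
    rw [sub_eq_zero.1 h0] at hz'
    linarith
  have hd : DifferentiableOn ℂ (fun z => (z - w)⁻¹ * (z - k)⁻¹) {z | z.im ∈ Set.Ici b} :=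
    ((differentiableOn_id.sub_const w).inv fun z hz => hne hw hz).mul
      ((differentiableOn_id.sub_const k).inv fun z hz => hne hk hz)
  exact ⟨integrable_line hd.continuousOn Set.self_mem_Ici ENNReal.ofReal_ne_top
    (lintegral_inv_mul_inv_le hw hk le_rfl), integral_line_eq_zero hd ENNReal.ofReal_ne_top
      fun y hy => lintegral_inv_mul_inv_le hw hk hy⟩

/-- The Poisson integral over a line `ℝ + ia` below `k`; the second pole is the mirror image
of `k` in the line. -/
lemma integral_poisson {k : ℂ} {a : ℝ} (hk : a < k.im) :
    ∫ u : ℝ, (2 * I * (k.im - a : ℝ)) * (((u : ℂ) + I * a - (k - 2 * I * (k.im - a : ℝ)))⁻¹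
      * ((u : ℂ) + I * a - k)⁻¹) = 2 * Real.pi * I := by
  have hd : 0 < k.im - a := sub_pos.2 hk
  have e : ∀ u : ℝ, ((u : ℂ) + I * a - (k - 2 * I * (k.im - a : ℝ)))⁻¹
      * ((u : ℂ) + I * a - k)⁻¹ = (((u - k.re) ^ 2 + (k.im - a) ^ 2)⁻¹ : ℝ) := by
    intro u
    rw [← mul_inv, ofReal_inv]
    congr 1
    apply Complex.ext <;> simp [pow_two] <;> ring
  simp_rw [e]
  rw [integral_const_mul, integral_complex_ofReal, integral_inv_sq_add_sq _ hd]
  push_cast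
  have : ((k.im : ℂ) - a) ≠ 0 := by exact_mod_cast hd.ne'
  field_simp

/-- `H` decays at least like `1 / |k|` on every strip `0 < Im k ≤ Y`. -/
def StripDecay (H : ℂ → ℂ) : Prop :=
  ∀ Y : ℝ, ∃ C : ℝ, ∀ k : ℂ, 0 < k.im → k.im ≤ Y → ‖H k‖ ≤ C / (1 + ‖k‖)

lemma StripDecay.exists_nonneg {H : ℂ → ℂ} (hd : StripDecay H) (Y : ℝ) :
    ∃ C : ℝ, 0 ≤ C ∧ ∀ k : ℂ, 0 < k.im → k.im ≤ Y → ‖H k‖ ≤ C / (1 + ‖k‖) := by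
  obtain ⟨C, hC⟩ := hd Y
  refine ⟨max C 0, le_max_right _ _, fun k h1 h2 => (hC k h1 h2).trans ?_⟩
  gcongr
  exact le_max_left _ _

lemma StripDecay.line {H : ℂ → ℂ} (hd : StripDecay H) {y : ℝ} (hy : 0 < y) :
    ∃ C : ℝ, ∀ u : ℝ, ‖H (u + I * y)‖ ≤ C / (1 + |u|) := by
  obtain ⟨C, hC0, hC⟩ := hd.exists_nonneg y
  have h := fun u : ℝ => hC (u + I * y) (by simpa using hy) (by simp)
  refine ⟨C, fun u => (h u).trans ?_⟩
  gcongr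
  simpa using abs_re_le_norm ((u : ℂ) + I * y)

/-- Cauchy's integral formula for a strip. The pole of `H(λ) / (λ - k)` at `k` is removed by
subtracting a multiple of the Poisson kernel of the lower line. -/
lemma cauchyLine_sub {H : ℂ → ℂ} (hH : DifferentiableOn ℂ H {z | 0 < z.im}) (hd : StripDecay H)
    {a b : ℝ} (ha : 0 < a) {k : ℂ} (hak : a < k.im) (hkb : k.im < b) :
    cauchyLine (fun u => H (u + I * a)) a k - cauchyLine (fun u => H (u + I * b)) b k
      = 2 * Real.pi * I * H k := by
  have hb : 0 < b := ha.trans (hak.trans hkb)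
  set δ := k.im - a with hδ
  have hδ0 : 0 < δ := sub_pos.2 hak
  set w : ℂ := k - 2 * I * δ with hw
  have hwim : w.im = a - δ := by simp [hw]; ring
  have hkw : k - w = 2 * I * δ := by rw [hw]; ring
  set N : ℂ → ℂ := fun z => H z - H k * (k - w) * (z - w)⁻¹ with hN
  set U : Set ℂ := {z | 0 < z.im ∧ w.im < z.im} with hU
  have hUo : IsOpen U := IsOpen.and (isOpen_lt continuous_const continuous_im)
    (isOpen_lt continuous_const continuous_im)
  have hkU : k ∈ U := ⟨ha.trans hak, by rw [hwim]; linarith⟩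
  have hwne : ∀ z ∈ U, z - w ≠ 0 := by
    intro z hz h0
    have := hz.2
    rw [sub_eq_zero.1 h0] at this
    exact lt_irrefl _ this
  have hNd : DifferentiableOn ℂ N U := (hH.mono fun z hz => hz.1).sub
    ((differentiableOn_const _).mul ((differentiableOn_id.sub_const w).inv hwne))
  have hNk : N k = 0 := by
    have := hwne k hkU
    simp only [hN]
    field_simp
    ring
  have hMd : DifferentiableOn ℂ (dslope N k) U :=
    (differentiableOn_dslope (hUo.mem_nhds hkU)).2 hNd
  have hsub : {z : ℂ | z.im ∈ Set.Icc a b} ⊆ U := fun z hz =>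
    ⟨ha.trans_le hz.1, lt_of_lt_of_le (by rw [hwim]; linarith) hz.1⟩
  have hM : ∀ z, z ≠ k → dslope N k z = H z / (z - k)
      - H k * ((2 * I * δ) * ((z - w)⁻¹ * (z - k)⁻¹)) := by
    intro z hz
    have h1 : z - k ≠ 0 := sub_ne_zero.2 hz
    rw [dslope_of_ne _ hz, slope_def_field, hNk, sub_zero, hN, ← hkw]
    field_simp
  -- the decay of the modified integrand, uniform in the strip
  obtain ⟨K, hK⟩ : ∃ K : ℝ, ∀ y ∈ Set.Icc a b, ∀ u : ℝ,
      ‖dslope N k (u + I * y)‖ ≤ K * ((u - k.re) ^ 2 + 1 ^ 2)⁻¹ := by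
    obtain ⟨C, hC0, hC⟩ := hd.exists_nonneg b
    have hcomp : IsCompact (Set.Icc (k.re - 1) (k.re + 1) ×ℂ Set.Icc a b) :=
      isCompact_Icc.reProdIm isCompact_Icc
    obtain ⟨B, hB⟩ := hcomp.exists_bound_of_continuousOn (f := dslope N k)
      (hMd.continuousOn.mono fun z hz => hsub hz.2)
    set K₁ := C * (1 + |k.re|) + ‖H k * (k - w)‖ with hK₁
    refine ⟨max B K₁ * 2, fun y hy u => ?_⟩
    have hz : (u : ℂ) + I * y ∈ {z : ℂ | z.im ∈ Set.Icc a b} := by simpa using hy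
    rcases le_or_gt |u - k.re| 1 with hu | hu
    · have h1 := hB (u + I * y) ⟨by
        simp only [Set.mem_preimage, add_re, ofReal_re, mul_re, I_re, zero_mul, I_im, ofReal_im,
          mul_zero, sub_zero, add_zero, Set.mem_Icc]
        constructor <;> linarith [abs_le.1 hu], hz⟩
      have hB0 : 0 ≤ B := (norm_nonneg _).trans h1
      have h2 : (u - k.re) ^ 2 ≤ 1 := by rw [← sq_abs]; exact pow_le_one₀ (abs_nonneg _) hu
      rw [mul_assoc]
      refine h1.trans ((le_max_left B K₁).trans (le_mul_of_one_le_right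
        (hB0.trans (le_max_left _ _)) ?_))
      rw [← div_eq_mul_inv, le_div_iff₀ (by positivity)]
      linarith
    · set r := |u - k.re| with hr
      have hr0 : 0 < r := one_pos.trans hu
      have hne : (u : ℂ) + I * y ≠ k := by
        intro h0
        rw [hr, ← h0] at hu
        simp at hu
        linarith
      have hk1 : r ≤ ‖(u : ℂ) + I * y - k‖ := by
        simpa [hr] using abs_re_le_norm ((u : ℂ) + I * y - k)
      have hw1 : r ≤ ‖(u : ℂ) + I * y - w‖ := by
        simpa [hr, hw] using abs_re_le_norm ((u : ℂ) + I * y - w)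
      have hH1 : ‖H (u + I * y)‖ ≤ C * (1 + |k.re|) / r := by
        refine (hC _ (hsub hz).1 hz.2).trans ?_
        rw [div_le_div_iff₀ (by positivity) hr0, mul_assoc]
        have h3 : |u| ≤ ‖(u : ℂ) + I * y‖ := by simpa using abs_re_le_norm ((u : ℂ) + I * y)
        have h4 : r ≤ |u| + |k.re| := abs_sub _ _
        gcongr
        nlinarith [abs_nonneg k.re, norm_nonneg ((u : ℂ) + I * y)]
      have hN1 : ‖N (u + I * y)‖ ≤ K₁ / r := by
        refine (norm_sub_le _ _).trans ?_
        rw [hK₁, add_div, norm_mul (H k * (k - w)), norm_inv, ← div_eq_mul_inv]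
        gcongr
      rw [dslope_of_ne _ hne, slope_def_field, hNk, sub_zero, norm_div]
      have hK0 : 0 ≤ K₁ := by positivity
      calc ‖N (u + I * y)‖ / ‖(u : ℂ) + I * y - k‖ ≤ K₁ / r / r := by gcongr
        _ = K₁ * (r ^ 2)⁻¹ := by rw [div_div, ← pow_two, div_eq_mul_inv]
        _ ≤ max B K₁ * 2 * ((u - k.re) ^ 2 + 1 ^ 2)⁻¹ := by
          rw [mul_assoc]
          refine mul_le_mul (le_max_right _ _) ?_ (by positivity) (hK0.trans (le_max_right _ _))
          rw [← sq_abs (u - k.re), ← hr, inv_le_comm₀ (by positivity) (by positivity), mul_inv,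
            inv_inv]
          nlinarith
  have heq := integral_line_eq (M := dslope N k) (hak.trans hkb).le (hMd.mono hsub)
    (C := ENNReal.ofReal (∫ u : ℝ, K * ((u - k.re) ^ 2 + 1 ^ 2)⁻¹)) ENNReal.ofReal_ne_top
    fun y hy => by
      have h1 := (integrable_inv_sq_add_sq k.re one_pos).const_mul K
      rw [ofReal_integral_eq_lintegral_ofReal h1
        (ae_of_all _ fun u => (norm_nonneg _).trans (hK y hy u))]
      refine lintegral_mono fun u => ?_
      rw [← ofReal_norm]
      exact ENNReal.ofReal_le_ofReal (hK y hy u)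
  have hsplit : ∀ y ∈ Set.Icc a b, k.im ≠ y → ∫ u : ℝ, dslope N k (u + I * y)
      = cauchyLine (fun u => H (u + I * y)) y k
        - H k * ∫ u : ℝ, (2 * I * δ) * (((u : ℂ) + I * y - w)⁻¹ * ((u : ℂ) + I * y - k)⁻¹) := by
    intro y hyI hy
    have hy0 : 0 < y := ha.trans_le hyI.1
    have hne : ∀ u : ℝ, (u : ℂ) + I * y ≠ k := by
      intro u h0
      apply hy
      rw [← h0]
      simp
    obtain ⟨C, hC⟩ := hd.line hy0
    have i1 := (cauchyLine_bound (continuous_line (s := Set.Ioi 0) hH.continuousOn hy0) hC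
      (abs_pos.2 (sub_ne_zero.2 hy.symm)) le_rfl).1
    have i2 : Integrable fun u : ℝ => dslope N k (u + I * y) :=
      ((integrable_inv_sq_add_sq k.re one_pos).const_mul K).mono'
        (continuous_line (hMd.continuousOn.mono hsub) hyI).aestronglyMeasurable
        (ae_of_all _ (hK y hyI))
    have e : ∀ u : ℝ, H k * ((2 * I * δ) * (((u : ℂ) + I * y - w)⁻¹ * ((u : ℂ) + I * y - k)⁻¹))
        = H (u + I * y) / (u + I * y - k) - dslope N k (u + I * y) := by
      intro u
      rw [hM _ (hne u), sub_sub_cancel]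
    rw [← integral_const_mul]
    simp_rw [e]
    rw [integral_sub i1 i2, cauchyLine, sub_sub_cancel]
  have hab := (hak.trans hkb).le
  have h1 := hsplit a (Set.left_mem_Icc.2 hab) hak.ne'
  have h2 := hsplit b (Set.right_mem_Icc.2 hab) hkb.ne
  rw [integral_const_mul (2 * I * (δ : ℂ)),
    (integral_inv_mul_inv_eq_zero (by rw [hwim]; linarith) hkb).2, mul_zero, mul_zero, sub_zero] at h2
  rw [integral_poisson hak] at h1
  rw [← h2, ← heq, h1]
  ring

/-- A function with the decay of `StripDecay` differs from its Cauchy integral over a horizontal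
line, continued from below that line to an entire function, by a bounded analytic function. -/
lemma exists_entire_extension {H : ℂ → ℂ} (hH : DifferentiableOn ℂ H {z | 0 < z.im})
    (hd : StripDecay H) {h : ℝ} (hh : 0 < h) :
    ∃ F : ℂ → ℂ, Differentiable ℂ F ∧
      (∀ k, k.im < h → F k = -(2 * Real.pi * I)⁻¹ * cauchyLine (fun u => H (u + I * h)) h k) ∧
      (∃ B : ℝ, ∀ k, k.im ≤ h / 2 → ‖F k‖ ≤ B) ∧ ∃ B : ℝ, ∀ k, 0 < k.im → ‖H k - F k‖ ≤ B := by
  have hc : (2 * Real.pi * I : ℂ) ≠ 0 := two_pi_I_ne_zero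
  have hl : ∀ {y : ℝ}, 0 < y → Continuous fun u : ℝ => H (u + I * y) := fun hy =>
    continuous_line (s := Set.Ioi 0) hH.continuousOn hy
  obtain ⟨C₁, hC₁⟩ := hd.line hh
  have hh4 : 0 < h / 4 := by positivity
  obtain ⟨C₂, hC₂⟩ := hd.line hh4
  set J : ℝ → ℂ → ℂ := fun y => cauchyLine (fun u => H (u + I * y)) y with hJ
  set F : ℂ → ℂ := fun k => if k.im < h then -(2 * Real.pi * I)⁻¹ * J h k
    else H k - (2 * Real.pi * I)⁻¹ * J (h / 4) k with hF
  have hF1 : ∀ k, k.im < h → F k = -(2 * Real.pi * I)⁻¹ * J h k := fun k hk => if_pos hk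
  -- the second representation, valid above the lower line `ℝ + ih/4`
  have hF2 : ∀ k, h / 4 < k.im → F k = H k - (2 * Real.pi * I)⁻¹ * J (h / 4) k := by
    intro k hk
    by_cases hkh : k.im < h
    · have := cauchyLine_sub hH hd hh4 hk hkh
      rw [hF1 k hkh]
      have h2 : H k = (2 * Real.pi * I)⁻¹ * (J (h / 4) k - J h k) := by
        rw [hJ, this, inv_mul_cancel_left₀ hc]
      rw [h2]
      ring
    · exact if_neg hkh
  have hB1 : ∀ k, k.im ≤ h / 2 →
      ‖F k‖ ≤ ‖(2 * Real.pi * I : ℂ)⁻¹‖ * (C₁ ^ 2 * Real.pi + Real.pi / (h / 2)) := by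
    intro k hk
    rw [hF1 k (by linarith), norm_mul, norm_neg]
    gcongr
    refine (cauchyLine_bound (hl hh) hC₁ (by positivity) ?_).2
    rw [abs_of_pos (by linarith)]
    linarith
  refine ⟨F, fun k => ?_, hF1, ⟨_, hB1⟩, ?_⟩
  · by_cases hkh : k.im < h
    · have h1 : DifferentiableAt ℂ (fun k => -(2 * Real.pi * I : ℂ)⁻¹ * J h k) k :=
        (differentiableAt_cauchyLine (hl hh) hC₁ hkh.ne).const_mul _
      refine h1.congr_of_eventuallyEq ?_
      filter_upwards [(isOpen_lt continuous_im continuous_const).mem_nhds hkh] with z hz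
        using hF1 z hz
    · have hk4 : h / 4 < k.im := by linarith [not_lt.1 hkh]
      have h1 : DifferentiableAt ℂ (fun k => H k - (2 * Real.pi * I : ℂ)⁻¹ * J (h / 4) k) k :=
        ((hH k (hh4.trans hk4)).differentiableAt (isOpen_upper.mem_nhds (hh4.trans hk4))).sub
          ((differentiableAt_cauchyLine (hl hh4) hC₂ hk4.ne').const_mul _)
      refine h1.congr_of_eventuallyEq ?_
      filter_upwards [(isOpen_lt continuous_const continuous_im).mem_nhds hk4] with z hz
        using hF2 z hz
  · obtain ⟨C₃, hC0, hC₃⟩ := hd.exists_nonneg (h / 2)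
    refine ⟨max (C₃ + ‖(2 * Real.pi * I : ℂ)⁻¹‖ * (C₁ ^ 2 * Real.pi + Real.pi / (h / 2)))
      (‖(2 * Real.pi * I : ℂ)⁻¹‖ * (C₂ ^ 2 * Real.pi + Real.pi / (h / 4))), fun k hk => ?_⟩
    rcases le_total k.im (h / 2) with hk2 | hk2
    · refine le_max_of_le_left ((norm_sub_le _ _).trans (add_le_add ?_ (hB1 k hk2)))
      have h1 := hC₃ k hk hk2
      exact h1.trans (div_le_self hC0 (by simp))
    · refine le_max_of_le_right ?_
      rw [hF2 k (by linarith), sub_sub_cancel, norm_mul]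
      gcongr
      refine (cauchyLine_bound (hl hh4) hC₂ hh4 ?_).2
      rw [abs_of_neg (by linarith)]
      linarith

end CauchyLine

/-! ### Removing the poles of the symbol -/

section Poles

/-- Simultaneous removal of finitely many isolated singularities. -/
lemma exists_differentiableOn_of_removable {U : Set ℂ} (hU : IsOpen U) (S : Finset ℂ) :
    ∀ f : ℂ → ℂ, DifferentiableOn ℂ f (U \ S) →
      (∀ p ∈ S, p ∈ U → Tendsto (fun k => (k - p) * f k) (𝓝[≠] p) (𝓝 0)) →
      ∃ H : ℂ → ℂ, DifferentiableOn ℂ H U ∧ Set.EqOn H f (U \ S) := by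
  classical
  induction S using Finset.induction_on with
  | empty => exact fun f hf _ => ⟨f, by simpa using hf, fun _ _ => rfl⟩
  | insert p S hp ih =>
    intro f hf hlim
    by_cases hpU : p ∈ U
    · set f' := Function.update f p (limUnder (𝓝[≠] p) f) with hf'
      have hs : U \ S ∈ 𝓝 p := (hU.sdiff S.finite_toSet.isClosed).mem_nhds ⟨hpU, by simpa using hp⟩
      have hd : DifferentiableOn ℂ f' (U \ S) := by
        refine differentiableOn_update_limUnder_of_isLittleO hs (hf.mono ?_) ?_
        · rintro z ⟨⟨h1, h2⟩, h3⟩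
          refine ⟨h1, ?_⟩
          simp only [Finset.coe_insert, Set.mem_insert_iff, not_or]
          exact ⟨h3, h2⟩
        · have hne : ∀ᶠ z in 𝓝[≠] p, (z - p)⁻¹ = 0 → f z - f p = 0 := by
            filter_upwards [self_mem_nhdsWithin] with z hz h0
            exact absurd (inv_eq_zero.1 h0) (sub_ne_zero.2 hz)
          rw [Asymptotics.isLittleO_iff_tendsto' hne]
          have h1 : Tendsto (fun z => (z - p) * f p) (𝓝[≠] p) (𝓝 0) := by
            have : Tendsto (fun z => (z - p) * f p) (𝓝 p) (𝓝 ((p - p) * f p)) :=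
              Continuous.tendsto (by fun_prop) _
            rw [sub_self, zero_mul] at this
            exact this.mono_left nhdsWithin_le_nhds
          have h2 := (hlim p (Finset.mem_insert_self _ _) hpU).sub h1
          rw [sub_zero] at h2
          refine h2.congr fun z => ?_
          rw [div_inv_eq_mul]
          ring
      obtain ⟨H, hH, hHf⟩ := ih f' hd fun p' hp' hpU' => by
        have hpp : p' ≠ p := fun h => hp (h ▸ hp')
        refine (hlim p' (Finset.mem_insert_of_mem hp') hpU').congr' ?_
        filter_upwards [nhdsWithin_le_nhds (isOpen_ne.mem_nhds hpp)] with z hz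
        rw [hf', Function.update_of_ne hz]
      refine ⟨H, hH, fun z hz => ?_⟩
      have hz' : z ∉ insert p (S : Set ℂ) := by simpa using hz.2
      rw [hHf ⟨hz.1, fun h => hz' (Set.mem_insert_of_mem _ h)⟩, hf',
        Function.update_of_ne fun h => hz' (Set.mem_insert_iff.2 (Or.inl h))]
    · obtain ⟨H, hH, hHf⟩ := ih f (hf.mono fun z hz => ⟨hz.1, by
        simp only [Finset.coe_insert, Set.mem_insert_iff, not_or]
        exact ⟨fun h => hpU (h ▸ hz.1), hz.2⟩⟩) fun p' hp' =>
          hlim p' (Finset.mem_insert_of_mem hp')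
      exact ⟨H, hH, fun z hz => hHf ⟨hz.1, fun h => hz.2 (by simp [Finset.mem_coe.1 h])⟩⟩

variable {q : ℝ → ℝ}

lemma wron_ne_zero_of_notMem (hq : ShortRange q) {k : ℂ} (hk : 0 < k.im)
    (h : ∀ κ ∈ boundStates q, k ≠ I * κ) : wron q k ≠ 0 := by
  intro h0
  have hre := re_eq_zero_of_wron_eq_zero hq hk h0
  have hkI : k = I * (k.im : ℂ) := by apply Complex.ext <;> simp [hre]
  exact h k.im ((mem_boundStates_iff hq).2 ⟨hk, by rwa [← hkI]⟩) hkI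

/-- The numbers `κ > 0` such that `G` may have a pole at `iκ`. -/
def poles (q : ℝ → ℝ) : Set ℝ := boundStates q ∪ boundStates (posPart q)

lemma poles_finite (hq : ShortRange q) : (poles q).Finite :=
  (boundStates_finite hq).union (boundStates_finite hq.posPart)

lemma poles_pos {κ : ℝ} (h : κ ∈ poles q) : 0 < κ := h.elim (fun h => h.1) fun h => h.1

/-- The residue of `G` at `iκ` divided by `i`: the difference of the norming constants of `q` and
`q₊`, an absent bound state counting as zero. -/
def residueCoeff (q : ℝ → ℝ) (κ : ℝ) : ℝ :=
  (boundStates q).indicator (normingConst q) κ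
    - (boundStates (posPart q)).indicator (normingConst (posPart q)) κ

lemma tendsto_residue_Gfun (hq : ShortRange q) {κ : ℝ} (hκ : 0 < κ) :
    Tendsto (fun k => (k - I * κ) * Gfun q k) (𝓝[≠] (I * κ)) (𝓝 (I * residueCoeff q κ)) := by
  have him : 0 < (I * (κ : ℂ)).im := by simpa using hκ
  obtain ⟨α, β, hc⟩ := exists_chart_ne_zero hq him.le
  obtain ⟨a1, a2⟩ := jost_data_posPart q (I * (κ : ℂ))
  have h1 := tendsto_residue hq hκ hc
  have h2 := tendsto_residue hq.posPart hκ (α := α) (β := β) (by rwa [a1, a2])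
  have h3 := h1.sub h2
  rw [← mul_sub, ← ofReal_sub] at h3
  refine h3.congr' ?_
  have hcont : ContinuousAt (fun k => α * jostA q k + β * jostB q k) (I * κ) :=
    ((continuousAt_jostA hq him).const_mul α).add ((continuousAt_jostB hq him).const_mul β)
  -- the other poles are at positive distance
  have hfar : ∀ᶠ k in 𝓝[≠] (I * (κ : ℂ)), ∀ κ' ∈ poles q, k ≠ I * κ' := by
    rw [eventually_all_finite (poles_finite hq)]
    intro κ' _
    by_cases h : κ' = κ
    · rw [h]; exact self_mem_nhdsWithin
    · refine nhdsWithin_le_nhds (isOpen_ne.mem_nhds fun h0 => h ?_)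
      exact_mod_cast (mul_left_cancel₀ I_ne_zero h0).symm
  filter_upwards [nhdsWithin_le_nhds (hcont.eventually_ne hc),
    nhdsWithin_le_nhds (isOpen_upper.mem_nhds him), hfar] with k hk1 hk2 hk3
  rw [Gfun_eq_chart_sub (le_of_lt hk2) hk1
    (wron_ne_zero_of_notMem hq.posPart hk2 fun κ' h => hk3 κ' (Or.inr h))
    (wron_ne_zero_of_notMem hq hk2 fun κ' h => hk3 κ' (Or.inl h))]
  ring

/-- The polar part of `ξ G` in the upper half-plane. -/
def polarPart (q : ℝ → ℝ) (x t : ℝ) (k : ℂ) : ℂ :=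
  ∑ᶠ κ ∈ poles q, xi x t (I * κ) * (I * residueCoeff q κ) / (k - I * κ)

lemma polarPart_eq_sum (hq : ShortRange q) (x t : ℝ) (k : ℂ) : polarPart q x t k
    = ∑ κ ∈ (poles_finite hq).toFinset, xi x t (I * κ) * (I * residueCoeff q κ) / (k - I * κ) :=
  finsum_mem_eq_finite_toFinset_sum _ (poles_finite hq)

lemma differentiable_xi (x t : ℝ) : Differentiable ℂ (xi x t) := by
  unfold xi
  fun_prop

lemma norm_xi_le (x : ℝ) {t : ℝ} (ht : 0 ≤ t) {Y : ℝ} {k : ℂ} (hk : 0 ≤ k.im) (hkY : k.im ≤ Y) :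
    ‖xi x t k‖ ≤ Real.exp (8 * t * Y ^ 3 + 2 * Y * |x|) := by
  rw [xi, norm_exp]
  refine Real.exp_le_exp.2 ?_
  have e : (I * (8 * k ^ 3 * t + 2 * k * x)).re
      = -(24 * t * (k.re ^ 2 * k.im)) + 8 * t * k.im ^ 3 + 2 * k.im * (-x) := by
    simp [pow_succ]
    ring
  rw [e]
  have h1 : k.im ^ 3 ≤ Y ^ 3 := pow_le_pow_left₀ hk hkY 3
  have h2 : k.im * (-x) ≤ Y * |x| :=
    (mul_le_mul_of_nonneg_left (neg_le_abs x) hk).trans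
      (mul_le_mul_of_nonneg_right hkY (abs_nonneg x))
  have h3 : 0 ≤ t * (k.re ^ 2 * k.im) := by positivity
  nlinarith [mul_le_mul_of_nonneg_left h1 ht]

lemma norm_xi_ofReal (x t k : ℝ) : ‖xi x t k‖ = 1 := by
  rw [xi, show I * (8 * (k : ℂ) ^ 3 * t + 2 * k * x) = ((8 * k ^ 3 * t + 2 * k * x : ℝ) : ℂ) * I by
    push_cast; ring]
  exact norm_exp_ofReal_mul_I _

/-- The possible poles of `G` in the upper half-plane. -/
def poleSet (hq : ShortRange q) : Finset ℂ :=
  (poles_finite hq).toFinset.map ⟨fun κ : ℝ => I * (κ : ℂ), fun a b h => by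
    exact_mod_cast mul_left_cancel₀ I_ne_zero h⟩

lemma mem_poleSet (hq : ShortRange q) {k : ℂ} : k ∈ poleSet hq ↔ ∃ κ ∈ poles q, I * κ = k := by
  simp only [poleSet, Finset.mem_map, Set.Finite.mem_toFinset]
  rfl

lemma ofReal_notMem_poleSet (hq : ShortRange q) (r : ℝ) : (r : ℂ) ∉ poleSet hq := by
  intro h
  obtain ⟨κ, hκ, h0⟩ := (mem_poleSet hq).1 h
  have h1 := congrArg im h0
  rw [I_mul_im, ofReal_im] at h1
  exact (poles_pos hκ).ne' h1

lemma differentiableAt_Gfun (hq : ShortRange q) {k : ℂ} (hk : 0 < k.im) (hkS : k ∉ poleSet hq) :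
    DifferentiableAt ℂ (Gfun q) k := by
  have hd : ∀ {f : ℂ → ℂ}, DifferentiableOn ℂ f {k | 0 < k.im} → DifferentiableAt ℂ f k :=
    fun hf => (hf k hk).differentiableAt (isOpen_upper.mem_nhds hk)
  have hS : ∀ κ ∈ poles q, k ≠ I * κ := fun κ hκ h => hkS ((mem_poleSet hq).2 ⟨κ, hκ, h.symm⟩)
  have d1 := hd (differentiableOn_jostA hq.reflect)
  have d2 := hd (differentiableOn_jostB hq.reflect)
  have d3 := hd (differentiableOn_wron hq)
  have d4 := hd (differentiableOn_wron hq.posPart)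
  unfold Gfun
  refine DifferentiableAt.div ?_ (d4.mul d3) (mul_ne_zero
    (wron_ne_zero_of_notMem hq.posPart hk fun κ h => hS κ (Or.inr h))
    (wron_ne_zero_of_notMem hq hk fun κ h => hS κ (Or.inl h)))
  fun_prop

lemma differentiableAt_polarPart (hq : ShortRange q) (x t : ℝ) {k : ℂ} (hkS : k ∉ poleSet hq) :
    DifferentiableAt ℂ (polarPart q x t) k := by
  rw [funext (polarPart_eq_sum hq x t)]
  refine DifferentiableAt.fun_sum fun κ hκ => ?_
  refine (differentiableAt_const _).div (by fun_prop) (sub_ne_zero.2 fun h => hkS ?_)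
  exact (mem_poleSet hq).2 ⟨κ, by simpa using hκ, h.symm⟩

/-- Near a pole, `ξ G` and its polar part have the same singularity. -/
lemma tendsto_pole_sub (hq : ShortRange q) (x t : ℝ) {κ : ℝ} (hκ : κ ∈ poles q) :
    Tendsto (fun k => (k - I * κ) * (xi x t k * Gfun q k - polarPart q x t k)) (𝓝[≠] (I * κ))
      (𝓝 0) := by
  classical
  set p : ℂ := I * κ with hp
  have h1 : Tendsto (fun k => xi x t k * ((k - p) * Gfun q k)) (𝓝[≠] p)
      (𝓝 (xi x t p * (I * residueCoeff q κ))) :=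
    ((differentiable_xi x t).continuous.tendsto p |>.mono_left nhdsWithin_le_nhds).mul
      (tendsto_residue_Gfun hq (poles_pos hκ))
  have hterm : ∀ κ' ∈ (poles_finite hq).toFinset, Tendsto
      (fun k => (k - p) * (xi x t (I * κ') * (I * residueCoeff q κ') / (k - I * κ'))) (𝓝[≠] p)
      (𝓝 (if κ' = κ then xi x t p * (I * residueCoeff q κ) else 0)) := by
    intro κ' _
    split_ifs with h
    · rw [h, ← hp]
      refine tendsto_const_nhds.congr' ?_
      filter_upwards [self_mem_nhdsWithin] with k hk
      have : k - p ≠ 0 := sub_ne_zero.2 hk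
      field_simp
    · have hne : p - I * κ' ≠ 0 := by
        rw [sub_ne_zero, hp]
        exact fun h0 => h (by exact_mod_cast (mul_left_cancel₀ I_ne_zero h0).symm)
      have hc : ContinuousAt
          (fun k => (k - p) * (xi x t (I * κ') * (I * residueCoeff q κ') / (k - I * κ'))) p :=
        ContinuousAt.mul (by fun_prop) (ContinuousAt.div (by fun_prop) (by fun_prop) hne)
      have := hc.tendsto.mono_left (nhdsWithin_le_nhds (s := {p}ᶜ))
      simpa using this
  have h2 := h1.sub (tendsto_finsetSum _ hterm)
  rw [Finset.sum_ite_eq' _ κ, if_pos (by simpa using hκ), sub_self] at h2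
  refine h2.congr fun k => ?_
  rw [polarPart_eq_sum hq, mul_sub, Finset.mul_sum]
  ring

/-- `ξ G` minus its polar part extends holomorphically to the upper half-plane. -/
lemma exists_regular_part (hq : ShortRange q) (x t : ℝ) :
    ∃ H : ℂ → ℂ, DifferentiableOn ℂ H {k | 0 < k.im} ∧
      ∀ k, 0 < k.im → k ∉ poleSet hq → H k = xi x t k * Gfun q k - polarPart q x t k := by
  suffices h : ∃ H : ℂ → ℂ, DifferentiableOn ℂ H {k | 0 < k.im} ∧ Set.EqOn H
      (fun k => xi x t k * Gfun q k - polarPart q x t k) ({k | 0 < k.im} \ poleSet hq) by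
    obtain ⟨H, hH, he⟩ := h
    exact ⟨H, hH, fun k hk hkS => he ⟨hk, hkS⟩⟩
  refine exists_differentiableOn_of_removable isOpen_upper (poleSet hq) _ ?_ ?_
  · rintro k ⟨hk, hkS⟩
    exact (((differentiable_xi x t k).mul (differentiableAt_Gfun hq hk hkS)).sub
      (differentiableAt_polarPart hq x t hkS)).differentiableWithinAt
  · intro p hp _
    obtain ⟨κ, hκ, rfl⟩ := (mem_poleSet hq).1 hp
    exact tendsto_pole_sub hq x t hκ

end Poles

/-! ### Bounds for the symbol on strips -/

section Bounds

open Asymptotics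

variable {q : ℝ → ℝ}

/-- The reciprocal of the Wronskian is `O(1 / |k|)` near every real point. -/
lemma isBigO_div_wron (hq : ShortRange q) (p : ℝ) :
    (fun k => k / wron q k) =O[𝓝[{k : ℂ | 0 < k.im}] (p : ℂ)] fun _ => (1 : ℂ) := by
  by_cases hp : p = 0
  · obtain ⟨c, hc, h⟩ := exists_wron_lower_bound hq
    rw [hp, ofReal_zero]
    refine IsBigO.of_bound c⁻¹ ?_
    filter_upwards [h, self_mem_nhdsWithin] with k hk him
    have hk0 : 0 < ‖k‖ := norm_pos_iff.2 fun h0 => by simp [h0] at him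
    have hw : 0 < ‖wron q k‖ := lt_of_lt_of_le (by positivity) hk
    rw [norm_div, norm_one, mul_one, div_le_iff₀ hw, inv_mul_eq_div, le_div_iff₀ hc]
    linarith
  · have h1 := ((continuousOn_wron hq) (p : ℂ) (by simp)).mono
      fun k (hk : 0 < k.im) => (hk.le : 0 ≤ k.im)
    have h2 : Tendsto (fun k : ℂ => k) (𝓝[{k : ℂ | 0 < k.im}] (p : ℂ)) (𝓝 p) :=
      tendsto_id.mono_left nhdsWithin_le_nhds
    exact (h2.div h1 (wron_real_ne_zero hq hp)).isBigO_one ℂ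

lemma isBigO_Gfun_real (hq : ShortRange q) (p : ℝ) :
    Gfun q =O[𝓝[{k : ℂ | 0 < k.im}] (p : ℂ)] fun _ => (1 : ℂ) := by
  set l := 𝓝[{k : ℂ | 0 < k.im}] (p : ℂ) with hl
  have hlim : ∀ {f : ℂ → ℂ}, ContinuousOn f {k | 0 ≤ k.im} → Tendsto f l (𝓝 (f p)) :=
    fun hf => (hf (p : ℂ) (by simp)).mono fun k (hk : 0 < k.im) => (hk.le : 0 ≤ k.im)
  have hp0 : 0 ≤ (p : ℂ).im := by simp
  obtain ⟨α, β, hc⟩ := exists_chart_ne_zero hq hp0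
  have hchart : ∀ {q' : ℝ → ℝ}, ShortRange q' → α * jostA q' p + β * jostB q' p ≠ 0 →
      chart q' α β =O[l] fun _ => (1 : ℂ) := by
    intro q' hq' hc'
    have h1 := ((((hlim (continuousOn_jostA hq'.reflect)).const_mul α).sub
      ((hlim (continuousOn_jostB hq'.reflect)).const_mul β)).const_mul (2 * I)).div
      (((hlim (continuousOn_jostA hq')).const_mul α).add
        ((hlim (continuousOn_jostB hq')).const_mul β)) hc'
    refine ((h1.isBigO_one ℂ).mul (isBigO_div_wron hq' p)).congr (fun k => ?_) fun k => mul_one _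
    rw [chart, Pi.div_apply, div_mul_div_comm]
    congr 1
    ring
  obtain ⟨a1, a2⟩ := jost_data_posPart q (p : ℂ)
  refine ((hchart hq hc).sub (hchart hq.posPart (by rwa [a1, a2]))).congr' ?_ EventuallyEq.rfl
  have hne : ∀ᶠ k in l, α * jostA q k + β * jostB q k ≠ 0 :=
    (((hlim (continuousOn_jostA hq)).const_mul α).add
        ((hlim (continuousOn_jostB hq)).const_mul β)).eventually_ne hc
  have hpS := ofReal_notMem_poleSet hq p
  have hS : ∀ᶠ k in l, k ∉ poleSet hq :=
    nhdsWithin_le_nhds ((poleSet hq).finite_toSet.isClosed.isOpen_compl.mem_nhds hpS)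
  filter_upwards [hne, hS, self_mem_nhdsWithin] with k h1 h2 h3
  have hk : 0 < k.im := h3
  have h2' : ∀ κ ∈ poles q, k ≠ I * κ := fun κ hκ h => h2 ((mem_poleSet hq).2 ⟨κ, hκ, h.symm⟩)
  exact (Gfun_eq_chart_sub hk.le h1
    (wron_ne_zero_of_notMem hq.posPart hk fun κ h => h2' κ (Or.inr h))
    (wron_ne_zero_of_notMem hq hk fun κ h => h2' κ (Or.inl h))).symm

/-- Decay of `G` at high frequency. -/
lemma exists_Gfun_bound (hq : ShortRange q) :
    ∃ C R : ℝ, 0 < R ∧ ∀ k : ℂ, 0 ≤ k.im → R ≤ ‖k‖ → ‖Gfun q k‖ ≤ C / ‖k‖ := by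
  obtain ⟨C₁, h₁, hb₁⟩ := exists_wron_bound hq
  obtain ⟨C₂, h₂, hb₂⟩ := exists_wron_bound hq.posPart
  obtain ⟨C₃, h₃, hb₃⟩ := exists_jostA_bound hq.reflect
  refine ⟨2 * C₃, C₁ + C₂ + 1, by positivity, fun k hk hR => ?_⟩
  have hk0 : 0 < ‖k‖ := lt_of_lt_of_le (by positivity) hR
  have e : ‖2 * I * k‖ = 2 * ‖k‖ := by simp
  have w₁ : ‖k‖ ≤ ‖wron q k‖ := by
    have h := norm_sub_norm_le (2 * I * k) (2 * I * k - wron q k)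
    rw [sub_sub_cancel, norm_sub_rev, e] at h
    linarith [hb₁ k hk]
  have w₂ : ‖k‖ ≤ ‖wron (posPart q) k‖ := by
    have h := norm_sub_norm_le (2 * I * k) (2 * I * k - wron (posPart q) k)
    rw [sub_sub_cancel, norm_sub_rev, e] at h
    linarith [hb₂ k hk]
  have hn : ‖I * k * jostA (reflect q) k - jostB (reflect q) k‖ ≤ C₃ := by
    rw [norm_sub_rev]
    exact (hb₃ k hk).2.1
  rw [Gfun, norm_div, norm_mul, norm_mul (wron _ _), e]
  calc 2 * ‖k‖ * ‖I * k * jostA (reflect q) k - jostB (reflect q) k‖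
        / (‖wron (posPart q) k‖ * ‖wron q k‖) ≤ 2 * ‖k‖ * C₃ / (‖k‖ * ‖k‖) := by gcongr
    _ = 2 * C₃ / ‖k‖ := by field_simp

/-- Decay of the polar part at high frequency. -/
lemma exists_polarPart_bound (hq : ShortRange q) (x t : ℝ) :
    ∃ C R : ℝ, 0 < R ∧ ∀ k : ℂ, R ≤ ‖k‖ → k ∉ poleSet hq ∧ ‖polarPart q x t k‖ ≤ C / ‖k‖ := by
  set S := (poles_finite hq).toFinset with hS
  have hpos : ∀ κ ∈ S, 0 < κ := fun κ hκ => poles_pos (q := q) (by simpa [hS] using hκ)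
  set R := 2 * ∑ κ ∈ S, κ + 1 with hR
  have hsum : 0 ≤ ∑ κ ∈ S, κ := Finset.sum_nonneg fun κ hκ => (hpos κ hκ).le
  have hfar : ∀ κ ∈ S, ∀ k : ℂ, R ≤ ‖k‖ → ‖k‖ / 2 < ‖k - I * κ‖ := by
    intro κ hκ k hk
    have h1 := norm_sub_norm_le k (I * κ)
    have h2 : ‖I * (κ : ℂ)‖ = κ := by simp [abs_of_pos (hpos κ hκ)]
    have h3 : κ ≤ ∑ κ ∈ S, κ := Finset.single_le_sum (fun κ hκ => (hpos κ hκ).le) hκ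
    rw [h2] at h1
    linarith
  refine ⟨∑ κ ∈ S, 2 * ‖xi x t (I * κ) * (I * residueCoeff q κ)‖, R, by positivity,
    fun k hk => ?_⟩
  have hk0 : 0 < ‖k‖ := lt_of_lt_of_le (by positivity) hk
  refine ⟨fun h => ?_, ?_⟩
  · obtain ⟨κ, hκ, rfl⟩ := (mem_poleSet hq).1 h
    have := hfar κ (by simpa [hS] using hκ) _ hk
    rw [sub_self, norm_zero] at this
    linarith
  · rw [polarPart_eq_sum hq, Finset.sum_div]
    refine (norm_sum_le _ _).trans (Finset.sum_le_sum fun κ hκ => ?_)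
    rw [norm_div]
    calc _ ≤ ‖xi x t (I * κ) * (I * residueCoeff q κ)‖ / (‖k‖ / 2) := by
          gcongr
          exact (hfar κ hκ k hk).le
      _ = _ := by field_simp

/-- The regular part of `ξ G` decays on horizontal strips. -/
lemma stripDecay_regular_part (hq : ShortRange q) (x : ℝ) {t : ℝ} (ht : 0 ≤ t) {H : ℂ → ℂ}
    (hH : DifferentiableOn ℂ H {k | 0 < k.im})
    (he : ∀ k, 0 < k.im → k ∉ poleSet hq → H k = xi x t k * Gfun q k - polarPart q x t k) :
    StripDecay H := by
  intro Y
  obtain ⟨C₁, R₁, hR₁, hG⟩ := exists_Gfun_bound hq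
  obtain ⟨C₂, R₂, hR₂, hP⟩ := exists_polarPart_bound hq x t
  set R := max (max R₁ R₂) 1 with hR
  set E := Real.exp (8 * t * Y ^ 3 + 2 * Y * |x|) with hE
  -- near every point of the closed half-plane the function is bounded
  have hloc : ∀ p : ℂ, 0 ≤ p.im → H =O[𝓝[{k : ℂ | 0 < k.im}] p] fun _ => (1 : ℂ) := by
    intro p hp
    rcases hp.eq_or_lt with hp0 | hp0
    · obtain ⟨r, rfl⟩ : ∃ r : ℝ, p = r := ⟨p.re, by apply Complex.ext <;> simp [← hp0]⟩
      have hpS := ofReal_notMem_poleSet hq r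
      have b1 : xi x t =O[𝓝[{k : ℂ | 0 < k.im}] (r : ℂ)] fun _ => (1 : ℂ) :=
        (((differentiable_xi x t).continuous.tendsto _).mono_left nhdsWithin_le_nhds).isBigO_one ℂ
      have b2 : polarPart q x t =O[𝓝[{k : ℂ | 0 < k.im}] (r : ℂ)] fun _ => (1 : ℂ) :=
        ((differentiableAt_polarPart hq x t hpS).continuousAt.tendsto.mono_left
          nhdsWithin_le_nhds).isBigO_one ℂ
      have b3 := ((b1.mul (isBigO_Gfun_real hq r)).congr_right fun _ => mul_one _).sub b2
      refine b3.congr' ?_ EventuallyEq.rfl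
      filter_upwards [self_mem_nhdsWithin,
        nhdsWithin_le_nhds ((poleSet hq).finite_toSet.isClosed.isOpen_compl.mem_nhds hpS)]
        with k h1 h2
      exact (he k h1 h2).symm
    · exact (((hH p hp0).continuousWithinAt).tendsto).isBigO_one ℂ
  have hcomp : IsCompact (Metric.closedBall (0 : ℂ) R ∩ {k | 0 ≤ k.im}) :=
    (isCompact_closedBall _ _).inter_right (isClosed_le continuous_const continuous_im)
  obtain ⟨B, hB⟩ : ∃ B : ℝ, ∀ k ∈ Metric.closedBall (0 : ℂ) R ∩ {k | 0 ≤ k.im}, 0 < k.im →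
      ‖H k‖ ≤ B := by
    refine hcomp.induction_on (p := fun s => ∃ B : ℝ, ∀ k ∈ s, 0 < k.im → ‖H k‖ ≤ B)
      ⟨0, by simp⟩ ?_ ?_ ?_
    · rintro s s' hss ⟨B, hB⟩
      exact ⟨B, fun k hk => hB k (hss hk)⟩
    · rintro s s' ⟨B, hB⟩ ⟨B', hB'⟩
      exact ⟨max B B', fun k hk him => hk.elim (fun h => le_max_of_le_left (hB k h him))
        fun h => le_max_of_le_right (hB' k h him)⟩
    · intro p hp
      obtain ⟨B, hB⟩ := (hloc p hp.2).bound
      rw [eventually_nhdsWithin_iff] at hB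
      exact ⟨_, nhdsWithin_le_nhds hB, B, fun k hk him => by simpa using hk him⟩
  refine ⟨max (2 * (E * C₁ + C₂)) (B * (1 + R)), fun k hk hkY => ?_⟩
  rcases le_or_gt R ‖k‖ with hkR | hkR
  · have h1 := hG k hk.le ((le_max_left _ _).trans ((le_max_left _ _).trans hkR))
    obtain ⟨h2, h3⟩ := hP k ((le_max_right _ _).trans ((le_max_left _ _).trans hkR))
    have hk1 : 1 ≤ ‖k‖ := (le_max_right _ _).trans hkR
    have hk0 : 0 < ‖k‖ := one_pos.trans_le hk1
    have h4 : ‖H k‖ ≤ (E * C₁ + C₂) / ‖k‖ := by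
      rw [he k hk h2]
      refine (norm_sub_le _ _).trans ?_
      rw [norm_mul, add_div, mul_div_assoc]
      gcongr
      exact norm_xi_le x ht hk.le hkY
    have h5 : 0 ≤ E * C₁ + C₂ := by
      have := (norm_nonneg _).trans h4
      by_contra hneg
      exact absurd this (not_le.2 (div_neg_of_neg_of_pos (not_le.1 hneg) hk0))
    calc ‖H k‖ ≤ (E * C₁ + C₂) / ‖k‖ := h4
      _ ≤ 2 * (E * C₁ + C₂) / (1 + ‖k‖) := by
          rw [div_le_div_iff₀ hk0 (by positivity)]
          nlinarith
      _ ≤ _ := by gcongr; exact le_max_left _ _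
  · have h1 := hB k ⟨by simpa using hkR.le, hk.le⟩ hk
    rw [le_div_iff₀ (by positivity)]
    refine le_trans ?_ (le_max_right _ _)
    have : 0 ≤ B := (norm_nonneg _).trans h1
    gcongr

end Bounds

/-! ### The symbols of the three Hankel operators -/

section Symbols

variable {q : ℝ → ℝ}

/-- The sum over bound states in the symbol, as a sum over any larger finite set. -/
lemma finsum_boundStates_eq {S : Finset ℝ} (hS : boundStates q ⊆ S) (e : ℝ → ℂ) :
    ∑ᶠ κ ∈ boundStates q, (normingConst q κ : ℂ) * e κ
      = ∑ κ ∈ S, (((boundStates q).indicator (normingConst q) κ : ℝ) : ℂ) * e κ := by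
  classical
  rw [finsum_mem_def, finsum_eq_sum_of_support_subset (s := S)]
  · refine Finset.sum_congr rfl fun κ _ => ?_
    by_cases h : κ ∈ boundStates q <;> simp [h]
  · refine fun κ hκ => hS ?_
    by_contra h
    exact hκ (Set.indicator_of_notMem h _)

lemma symbol_eq (hq : ShortRange q) (x t : ℝ) {S : Finset ℝ} (hS : boundStates q ⊆ S) {k : ℝ}
    (hk : k ≠ 0) : symbol q x t k
      = ∑ κ ∈ S, (((boundStates q).indicator (normingConst q) κ : ℝ) : ℂ)
        * (xi x t (I * κ) / (I * k + κ)) + xi x t k * Rfun q k := by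
  rw [symbol, rightReflection_eq hq hk, ← finsum_boundStates_eq hS]
  simp_rw [mul_div_assoc]

lemma ae_ne_zero : ∀ᵐ k : ℝ, k ≠ 0 := by simp [ae_iff]

lemma I_mul_add_ne_zero {κ : ℝ} (hκ : 0 < κ) (k : ℝ) : I * (k : ℂ) + κ ≠ 0 := by
  intro h
  have := congrArg re h
  simp at this
  exact hκ.ne' this

lemma memLp_symbol (hq : ShortRange q) (x t : ℝ) : MemLp (symbol q x t) ∞ volume := by
  set S := (boundStates_finite hq).toFinset with hS
  have hSs : boundStates q ⊆ S := by simp [hS]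
  have hpos : ∀ κ ∈ S, 0 < κ := fun κ hκ => ((boundStates_finite hq).mem_toFinset.1 hκ).1
  set f : ℝ → ℂ := fun k => ∑ κ ∈ S, (((boundStates q).indicator (normingConst q) κ : ℝ) : ℂ)
        * (xi x t (I * κ) / (I * k + κ)) + xi x t k * Rfun q k with hf
  have hae : f =ᵐ[volume] symbol q x t := by
    filter_upwards [ae_ne_zero] with k hk using (symbol_eq hq x t hSs hk).symm
  refine MemLp.ae_eq hae (memLp_top_of_bound ?_
    (∑ κ ∈ S, ‖(((boundStates q).indicator (normingConst q) κ : ℝ) : ℂ)‖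
      * (‖xi x t (I * κ)‖ / κ) + 1) (ae_of_all _ fun k => ?_))
  · have hc : ContinuousOn f {0}ᶜ := by
      refine ContinuousOn.add (Continuous.continuousOn ?_) (ContinuousOn.mul
        ((differentiable_xi x t).continuous.comp continuous_ofReal).continuousOn
        (continuousOn_Rfun hq))
      refine continuous_finsetSum _ fun κ hκ => continuous_const.mul
        (continuous_const.div (by fun_prop) (I_mul_add_ne_zero (hpos κ hκ)))
    have := hc.aestronglyMeasurable (μ := volume) (measurableSet_singleton 0).compl
    rwa [Measure.restrict_eq_self_of_ae_mem (by filter_upwards [ae_ne_zero] with k hk using hk)] at this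
  · refine (norm_add_le _ _).trans (add_le_add ((norm_sum_le _ _).trans
      (Finset.sum_le_sum fun κ hκ => ?_)) ?_)
    · rw [norm_mul, norm_div]
      gcongr
      · exact hpos κ hκ
      · have := abs_re_le_norm (I * (k : ℂ) + κ)
        simpa [abs_of_pos (hpos κ hκ)] using this
    · rw [norm_mul, norm_xi_ofReal, one_mul]
      exact norm_Rfun_le hq k

/-- On the real line, `φ - φ₊` is `ξ G` minus its polar part. -/
lemma symbol_sub (hq : ShortRange q) (x t : ℝ) {k : ℝ} (hk : k ≠ 0) :
    symbol q x t k - symbol (posPart q) x t k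
      = xi x t k * Gfun q k - polarPart q x t k := by
  have h1 : boundStates q ⊆ (poles_finite hq).toFinset := by simp [poles]
  have h2 : boundStates (posPart q) ⊆ (poles_finite hq).toFinset := by simp [poles]
  rw [symbol_eq hq x t h1 hk, symbol_eq hq.posPart x t h2 hk, ← Rfun_sub hq hk,
    polarPart_eq_sum hq, add_sub_add_comm, ← Finset.sum_sub_distrib, ← mul_sub, add_comm,
    sub_eq_add_neg (_ * _), ← Finset.sum_neg_distrib]
  congr 1
  refine Finset.sum_congr rfl fun κ hκ => ?_
  have hκ0 : 0 < κ := poles_pos (q := q) (by simpa using hκ)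
  have hd := I_mul_add_ne_zero hκ0 k
  have e : (k : ℂ) - I * κ = -I * (I * k + κ) := by linear_combination (k : ℂ) * I_sq
  rw [e, residueCoeff, ofReal_sub]
  field_simp

/-- On a line above all poles, the integrals of `ξ G` and of its regular part against the Cauchy
kernel agree. -/
lemma integrable_PhiIntegrand (hq : ShortRange q) (x t : ℝ) {H : ℂ → ℂ}
    (hH : DifferentiableOn ℂ H {k | 0 < k.im}) (hd : StripDecay H)
    (he : ∀ k, 0 < k.im → k ∉ poleSet hq → H k = xi x t k * Gfun q k - polarPart q x t k)
    {h : ℝ} (hh : 0 < h) (hp : ∀ κ ∈ poles q, κ < h) {k : ℂ} (hk : k.im < h) :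
    Integrable (PhiIntegrand q h x t k) ∧
      ∫ u, PhiIntegrand q h x t k u = cauchyLine (fun u => H (u + I * h)) h k := by
  obtain ⟨C, hC⟩ := hd.line hh
  have i1 := (cauchyLine_bound (continuous_line (s := Set.Ioi 0) hH.continuousOn hh) hC
    (abs_pos.2 (sub_pos.2 hk).ne') le_rfl).1
  set S := (poles_finite hq).toFinset with hS
  set P : ℝ → ℂ := fun u => ∑ κ ∈ S, xi x t (I * κ) * (I * residueCoeff q κ)
    * (((u : ℂ) + I * h - I * κ)⁻¹ * ((u : ℂ) + I * h - k)⁻¹) with hP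
  have hκ : ∀ κ ∈ S, (I * (κ : ℂ)).im < h := fun κ hκ => by
    rw [I_mul_im]
    exact hp κ ((poles_finite hq).mem_toFinset.1 hκ)
  have i2 : Integrable P := integrable_finsetSum _ fun κ h0 =>
    (integral_inv_mul_inv_eq_zero (hκ κ h0) hk).1.const_mul _
  have z2 : ∫ u, P u = 0 := by
    rw [hP, integral_finsetSum _ fun κ h0 =>
      (integral_inv_mul_inv_eq_zero (hκ κ h0) hk).1.const_mul _]
    refine Finset.sum_eq_zero fun κ h0 => ?_
    rw [integral_const_mul, (integral_inv_mul_inv_eq_zero (hκ κ h0) hk).2, mul_zero]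
  have hae : (fun u : ℝ => H (u + I * h) / (u + I * h - k) + P u)
      =ᵐ[volume] PhiIntegrand q h x t k := by
    filter_upwards [ae_ne_zero] with u hu
    have him : 0 < ((u : ℂ) + I * h).im := by simpa using hh
    -- all zeros of the three Wronskians lie on the imaginary axis
    have hre : ((u : ℂ) + I * h).re ≠ 0 := by simpa using hu
    have hG := G_eq_Gfun hq him (fun h0 => hre (re_eq_zero_of_wron_eq_zero hq.posPart him h0))
      (fun h0 => hre (re_eq_zero_of_wron_eq_zero hq.negPart him h0))
      (fun h0 => hre (re_eq_zero_of_wron_eq_zero hq him h0))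
    have hpS : (u : ℂ) + I * h ∉ poleSet hq := by
      intro h0
      obtain ⟨κ, -, h1⟩ := (mem_poleSet hq).1 h0
      exact hre (by rw [← h1]; simp)
    rw [PhiIntegrand, hG, he _ him hpS, polarPart_eq_sum hq, hP, sub_div, Finset.sum_div]
    simp_rw [div_eq_mul_inv, mul_assoc]
    rw [sub_add_cancel]
  refine ⟨(i1.add i2).congr hae, ?_⟩
  rw [← integral_congr_ae hae, integral_add i1 i2, z2, add_zero, cauchyLine]

/-- The regular part of `ξ G` has the boundary value `φ - φ₊`. -/
lemma tendsto_regular_part (hq : ShortRange q) (x t : ℝ) {H : ℂ → ℂ}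
    (he : ∀ k, 0 < k.im → k ∉ poleSet hq → H k = xi x t k * Gfun q k - polarPart q x t k)
    {k : ℝ} (hk : k ≠ 0) : Tendsto (fun y : ℝ => H (k + I * y)) (𝓝[>] 0)
      (𝓝 (symbol q x t k - symbol (posPart q) x t k)) := by
  rw [symbol_sub hq x t hk]
  have hmap : Tendsto (fun y : ℝ => (k : ℂ) + I * y) (𝓝[>] 0) (𝓝[{z : ℂ | 0 < z.im}] (k : ℂ)) := by
    refine tendsto_nhdsWithin_iff.2 ⟨?_, ?_⟩
    · have hc : Continuous fun y : ℝ => (k : ℂ) + I * y := by fun_prop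
      have := (hc.tendsto 0).mono_left (nhdsWithin_le_nhds (s := Set.Ioi 0))
      simpa using this
    · filter_upwards [self_mem_nhdsWithin] with y hy
      simpa using hy
  have hkS := ofReal_notMem_poleSet hq k
  have hlim : ∀ {f : ℂ → ℂ}, ContinuousOn f {k | 0 ≤ k.im} →
      Tendsto f (𝓝[{z : ℂ | 0 < z.im}] (k : ℂ)) (𝓝 (f k)) :=
    fun hf => (hf (k : ℂ) (by simp)).mono fun z (hz : 0 < z.im) => (hz.le : 0 ≤ z.im)
  have hid : Tendsto (fun z : ℂ => z) (𝓝[{z : ℂ | 0 < z.im}] (k : ℂ)) (𝓝 k) :=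
    tendsto_id.mono_left nhdsWithin_le_nhds
  have hG : Tendsto (Gfun q) (𝓝[{z : ℂ | 0 < z.im}] (k : ℂ)) (𝓝 (Gfun q k)) :=
    ((hid.const_mul (2 * I)).mul (((hid.const_mul I).mul
      (hlim (continuousOn_jostA hq.reflect))).sub (hlim (continuousOn_jostB hq.reflect)))).div
      ((hlim (continuousOn_wron hq.posPart)).mul (hlim (continuousOn_wron hq)))
      (mul_ne_zero (wron_real_ne_zero hq.posPart hk) (wron_real_ne_zero hq hk))
  have hraw := ((((differentiable_xi x t).continuous.tendsto (k : ℂ)).mono_left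
    nhdsWithin_le_nhds).mul hG).sub
      ((differentiableAt_polarPart hq x t hkS).continuousAt.tendsto.mono_left
        (nhdsWithin_le_nhds (s := {z : ℂ | 0 < z.im})))
  refine (hraw.congr' ?_).comp hmap
  filter_upwards [self_mem_nhdsWithin,
    nhdsWithin_le_nhds ((poleSet hq).finite_toSet.isClosed.isOpen_compl.mem_nhds hkS)]
    with z h1 h2 using (he z h1 h2).symm

end Symbols

end SepInf

end

theorem mainTheorem4 (q : ℝ → ℝ) (hq : SepInf.ShortRange q) (x t : ℝ) (ht : 0 ≤ t) :
    (SepInf.boundStates q).Finite ∧ (SepInf.boundStates (SepInf.posPart q)).Finite ∧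
    ∀ h : ℝ, 0 < h →
      (∀ κ ∈ SepInf.boundStates q ∪ SepInf.boundStates (SepInf.posPart q), κ < h) →
      (∀ k : ℂ, k.im < h → Integrable (SepInf.PhiIntegrand q h x t k)) ∧
      (∃ F : ℂ → ℂ, Differentiable ℂ F ∧ ∀ k : ℂ, k.im < h → F k = SepInf.Phi q h x t k) ∧
      ∃ (hφ : MemLp (SepInf.symbol q x t) ∞ volume)
        (hφp : MemLp (SepInf.symbol (SepInf.posPart q) x t) ∞ volume)
        (hΦ : MemLp (fun k : ℝ => SepInf.Phi q h x t k) ∞ volume),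
        SepInf.hankel hφ.toLp
          = SepInf.hankel hφp.toLp + SepInf.hankel hΦ.toLp := by
  refine ⟨SepInf.boundStates_finite hq, SepInf.boundStates_finite hq.posPart,
    fun h hh hp => ?_⟩
  obtain ⟨H, hH, he⟩ := SepInf.exists_regular_part hq x t
  have hd := SepInf.stripDecay_regular_part hq x ht hH he
  have hint := fun (k : ℂ) (hk : k.im < h) =>
    SepInf.integrable_PhiIntegrand hq x t hH hd he hh hp hk
  obtain ⟨F, hF, hFc, ⟨B, hB⟩, ⟨B', hB'⟩⟩ := SepInf.exists_entire_extension hH hd hh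
  have hFΦ : ∀ k : ℂ, k.im < h → F k = SepInf.Phi q h x t k := fun k hk => by
    rw [hFc k hk, SepInf.Phi, (hint k hk).2]
  have hFr : ∀ k : ℝ, SepInf.Phi q h x t k = F k := fun k => (hFΦ k (by simpa using hh)).symm
  have hφ := SepInf.memLp_symbol hq x t
  have hφp := SepInf.memLp_symbol hq.posPart x t
  have hΦ : MemLp (fun k : ℝ => SepInf.Phi q h x t k) ∞ volume := by
    simp_rw [hFr]
    exact memLp_top_of_bound (hF.continuous.comp continuous_ofReal).aestronglyMeasurable B
      (ae_of_all _ fun k => hB k (by simpa using (half_pos hh).le))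
  refine ⟨fun k hk => (hint k hk).1, ⟨F, hF, hFΦ⟩, hφ, hφp, hΦ, ?_⟩
  -- the defect of the symbols is the boundary value of the bounded analytic function `H - F`
  set g := hφ.toLp - (hφp.toLp + hΦ.toLp) with hg
  have hbv : SepInf.IsBoundedBoundaryValue g := by
    refine ⟨fun z => H z - F z, hH.sub hF.differentiableOn, ⟨B', hB'⟩, ?_⟩
    filter_upwards [SepInf.ae_ne_zero, Lp.coeFn_sub hφ.toLp (hφp.toLp + hΦ.toLp),
      Lp.coeFn_add hφp.toLp hΦ.toLp, hφ.coeFn_toLp, hφp.coeFn_toLp, hΦ.coeFn_toLp]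
      with k hk h1 h2 h3 h4 h5
    have hFk : Tendsto (fun y : ℝ => F (k + I * y)) (𝓝[>] 0) (𝓝 (F k)) := by
      have hc : Continuous fun y : ℝ => F ((k : ℂ) + I * y) :=
        hF.continuous.comp (by fun_prop)
      have := (hc.tendsto 0).mono_left (nhdsWithin_le_nhds (s := Set.Ioi 0))
      simpa using this
    have hlim := (SepInf.tendsto_regular_part hq x t he hk).sub hFk
    rw [hg, h1, Pi.sub_apply, h2, Pi.add_apply, h3, h4, h5, hFr, ← sub_sub]
    exact hlim
  have hsum : hφ.toLp = hφp.toLp + hΦ.toLp + g := by rw [hg]; abel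
  rw [hsum, SepInf.hankel_add, SepInf.hankel_add, SepInf.hankel_eq_zero hbv, add_zero]
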